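/- Let $\mathbb M^4$ be $\mathbb R^4$ with coordinates $(x^0,x^1,x^2,x^3)$ and the Minkowski metric $g=\eta=\operatorname{diag}(+1,-1,-1,-1)$. For a connection $\Gamma$ put $\nabla_\mu v^\lambda=\partial_\mu v^\lambda+\Gamma^\lambda{}_{\mu\nu}v^\nu$, $T^\lambda{}_{\mu\nu}=\Gamma^\lambda{}_{\mu\nu}-\Gamma^\lambda{}_{\nu\mu}$ and $R^\kappa{}_{\lambda\mu\nu}=\partial_\mu\Gamma^\kappa{}_{\nu\lambda}-\partial_\nu\Gamma^\kappa{}_{\mu\lambda}+\Gamma^\kappa{}_{\mu\eta}\Gamma^\eta{}_{\nu\lambda}-\Gamma^\kappa{}_{\nu\eta}\Gamma^\eta{}_{\mu\lambda}$. A curvature tensor $R$ is purely Weyl if $R_{\kappa\lambda\mu\nu}=-R_{\lambda\kappa\mu\nu}$ and all traces of $R$ and of its right Hodge dual $R^*$ vanish. A Weyl pseudoinstanton is a spacetime $\{M,g,\Gamma\}$ with metric compatible connection ($\nabla g=0$) and purely Weyl curvature. For an $\mathrm O(1,3)$-invariant quadratic form $q$ on the space of tensors $R^\kappa{}_{\lambda\mu\nu}=-R^\kappa{}_{\lambda\nu\mu}$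 consider the action $S=\int q(R)\sqrt{|\det g|}\,dx$ ($q$ being evaluated in any $g$-orthonormal frame); its field equations are $\partial S/\partial g=0$ and $\partial S/\partial\Gamma=0$, that is, stationarity under independent smooth compactly supported variations of the metric $g$ and of the connection $\Gamma$. Let $l\in\mathbb R^4$ and $w\in\mathbb C^4$ be constant covectors such that the plane wave $u(x)=w\,e^{-i\,l\cdot x}$ (where $l\cdot x=l_\mu x^\mu$) satisfies $*du=i\,du$ or $*du=-i\,du$ on $\mathbb M^4$, where $(du)_{\mu\nu}=\partial_\mu u_\nu-\partial_\nu u_\mu$. Then there is exactly one metric compatible connection $\Gamma$ on $\mathbb M^4$ with torsion $T=\tfrac12\operatorname{Re}(u\otimes du)$, i.e. $T_{\lambda\mu\nu}=\tfrac12\operatorname{Re}(u_\lambda(du)_{\mu\nu})$, and: 1. $\{\mathbb M^4,\Gamma\}$ is a Weyl pseudoinstanton, with curvature $R=\operatorname{Re}(du\otimes du)$, i.e. $R_{\kappa\lambda\mu\nu}=\operatorname{Re}((du)_{\kappa\lambda}(du)_{\mu\nu})$. 2. For every $\mathrm O(1,3)$-invariant quadratic form $q$ on curvature, $\{\mathbb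 M^4,\Gamma\}$ solves the field equations $\partial S/\partial g=0$, $\partial S/\partial\Gamma=0$. 3. $\Gamma$ is non-Riemannian (not the Levi-Civita connection of $\eta$) if and only if $l\neq0$ and $w\notin\operatorname{span}_{\mathbb C}l$; the same condition is necessary and sufficient for $R\not\equiv0$. 4. If $l\ne0$ and $w\notin\operatorname{span}_{\mathbb C}l$, then the holonomy group of $\Gamma$ at every point is, up to conjugation, $B^2=\left\{\begin{pmatrix}1&b\\0&1\end{pmatrix}: b\in\mathbb C\right\}\subset\mathrm{SL}(2,\mathbb C)$, under the standard identification (via the double covering) of $\mathrm{SL}(2,\mathbb C)$ with the proper orthochronous Lorentz group. -/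

import Mathlib

open scoped ContDiff Topology Matrix

noncomputable section

namespace TorsionWave

/-- Points of `ℝ⁴`, with the global coordinates `x⁰, x¹, x², x³`. -/
abbrev Pt : Type := Fin 4 → ℝ

/-- A `4 × 4` real matrix: components `g_{μν}` of a rank 2 tensor at a point, or a linear map. -/
abbrev Mat4 : Type := Matrix (Fin 4) (Fin 4) ℝ

/-- Components `R k l m n = R^k_{l m n}` of a rank 4 tensor at a point. -/
abbrev Tensor4 : Type := Fin 4 → Fin 4 → Fin 4 → Fin 4 → ℝ

/-- A metric field on `ℝ⁴`: `g x m n = g_{mn}(x)`. -/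
abbrev MetricField : Type := Pt → Mat4

/-- An affine connection on `ℝ⁴` given by its 64 coefficients: `Γ x l m n = Γ^l_{mn}(x)`, where
`∇_m v^l = ∂_m v^l + Γ^l_{mn} v^n`. -/
abbrev Connection : Type := Pt → Fin 4 → Fin 4 → Fin 4 → ℝ

/-- The matrix `diag(+1, -1, -1, -1)`. -/
def eta : Mat4 := Matrix.diagonal ![1, -1, -1, -1]

/-- The Minkowski metric on `ℝ⁴`. -/
def minkowski : MetricField := fun _ => eta

/-- The partial derivative `∂_m f` at `x`. -/
def pd {E : Type*} [NormedAddCommGroup E] [NormedSpace ℝ E]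
    (m : Fin 4) (f : Pt → E) (x : Pt) : E :=
  fderiv ℝ f x (Pi.single m 1)

/-! ### Metric, torsion, curvature -/

/-- A frame `e` (with `e l b` the `l`-th component of the `b`-th frame vector) which is
orthonormal for the metric `g` at a point: `g(e_a, e_b) = η_{ab}`. -/
def IsOrthonormalFrame (g e : Mat4) : Prop := eᵀ * g * e = eta

/-- `g` is (the matrix of) a symmetric bilinear form of Lorentzian signature. -/
def IsLorentzian (g : Mat4) : Prop := ∃ e : Mat4, IsOrthonormalFrame g e

/-- A smooth Lorentzian metric and a smooth connection on `ℝ⁴`. -/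
structure IsSpacetime (g : MetricField) (Γ : Connection) : Prop where
  smooth_metric : ∀ m n, ContDiff ℝ ∞ (fun x => g x m n)
  lorentzian : ∀ x, IsLorentzian (g x)
  smooth_connection : ∀ l m n, ContDiff ℝ ∞ (fun x => Γ x l m n)

/-- `∇g = 0`. -/
def MetricCompatible (g : MetricField) (Γ : Connection) : Prop :=
  ∀ (x : Pt) (m a b : Fin 4),
    pd m (fun y => g y a b) x - ∑ k, Γ x k m a * g x k b - ∑ k, Γ x k m b * g x a k = 0

/-- Torsion `T^l_{mn} = Γ^l_{mn} - Γ^l_{nm}`. -/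
def torsion (Γ : Connection) : Pt → Fin 4 → Fin 4 → Fin 4 → ℝ :=
  fun x l m n => Γ x l m n - Γ x l n m

/-- The Christoffel symbol of a metric. -/
def christoffel (g : MetricField) : Connection := fun x l m n =>
  (1 / 2) * ∑ k, (g x)⁻¹ l k *
    (pd m (fun y => g y n k) x + pd n (fun y => g y m k) x - pd k (fun y => g y m n) x)

/-- The connection is the Levi-Civita connection of the (Lorentzian) metric. -/
def IsRiemannian (g : MetricField) (Γ : Connection) : Prop := Γ = christoffel g

/-- The space of rank 4 tensors `R^k_{lmn}` with `R^k_{lmn} = -R^k_{lnm}`. -/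
def CurvSpace : Submodule ℝ Tensor4 where
  carrier := {R | ∀ k l m n, R k l m n = -R k l n m}
  add_mem' := by
    intro R Q hR hQ k l m n
    simp only [Pi.add_apply, hR k l m n, hQ k l m n]
    ring
  zero_mem' := by
    intro k l m n
    simp
  smul_mem' := by
    intro c R hR k l m n
    simp only [Pi.smul_apply, smul_eq_mul, hR k l m n]
    ring

/-- Curvature
`R^k_{lmn} = ∂_m Γ^k_{nl} - ∂_n Γ^k_{ml} + Γ^k_{mj} Γ^j_{nl} - Γ^k_{nj} Γ^j_{ml}` at `x`. -/
def curvature (Γ : Connection) (x : Pt) : CurvSpace :=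
  ⟨fun k l m n =>
    pd m (fun y => Γ y k n l) x - pd n (fun y => Γ y k m l) x
      + ∑ j, Γ x k m j * Γ x j n l - ∑ j, Γ x k n j * Γ x j m l, by
    intro k l m n
    ring⟩

/-- Lowering the first index: `R_{klmn} = g_{ka} R^a_{lmn}`. -/
def lower (g : Mat4) (R : Tensor4) : Tensor4 := fun k l m n => ∑ a, g k a * R a l m n

/-! ### Hodge star and Weyl curvature -/

/-- The totally antisymmetric symbol with `ε_{0123} = +1`. -/
def eps (k l m n : Fin 4) : ℤ :=
  ((1 : Matrix (Fin 4) (Fin 4) ℤ).submatrix ![k, l, m, n] id).det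

/-- The Hodge star of a rank 2 tensor with lower indices (real or complex),
`(*F)_{mn} = ½ √|det g| F_{ab} ε^{ab}_{mn}`. -/
def hodge {A : Type*} [AddCommGroup A] [Module ℝ A] (g : Mat4)
    (F : Fin 4 → Fin 4 → A) : Fin 4 → Fin 4 → A := fun m n =>
  ∑ a, ∑ b, ((1 / 2) * √|g.det| * ∑ c, ∑ d, g⁻¹ a c * g⁻¹ b d * (eps c d m n : ℝ)) • F a b

/-- The right Hodge star `R*` of a curvature tensor (it acts on the last pair of indices). -/
def rightStar (g : Mat4) (R : Tensor4) : Tensor4 := fun k l => hodge g (R k l)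

/-- The trace `R^k_{lkn}` (Ricci curvature). -/
def ricci (R : Tensor4) (l n : Fin 4) : ℝ := ∑ k, R k l k n

/-- The trace `R_k^l_{ln}`. -/
def ricci' (g : Mat4) (R : Tensor4) (k n : Fin 4) : ℝ :=
  ∑ l, ∑ b, g⁻¹ b l * lower g R k b l n

/-- The irreducible 10-dimensional subspace of Weyl curvatures: all possible traces of `R` and
of `R*` vanish, and `R_{klmn} = -R_{lkmn}`. (`R_{klmn} = -R_{klnm}` holds for every element
of `CurvSpace`.) -/
structure IsWeyl (g : Mat4) (R : CurvSpace) : Prop where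
  ricci_eq : ∀ l n, ricci R.1 l n = 0
  ricci_star_eq : ∀ l n, ricci (rightStar g R.1) l n = 0
  ricci'_eq : ∀ k n, ricci' g R.1 k n = 0
  ricci'_star_eq : ∀ k n, ricci' g (rightStar g R.1) k n = 0
  trace_eq : ∀ m n, ∑ k, R.1 k k m n = 0
  antisymm : ∀ k l m n, lower g R.1 k l m n = -lower g R.1 l k m n

/-- A Weyl pseudoinstanton: a spacetime with metric compatible connection
and purely Weyl curvature. -/
structure IsWeylPseudoinstanton (g : MetricField) (Γ : Connection) : Prop where
  spacetime : IsSpacetime g Γ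
  compatible : MetricCompatible g Γ
  weyl : ∀ x, IsWeyl (g x) (curvature Γ x)

/-! ### Quadratic actions and their field equations -/

/-- The components of a curvature tensor in the frame `e`:
`R'^a_{bcd} = (e⁻¹)^a_k e^l_b e^m_c e^n_d R^k_{lmn}`. -/
def inFrame (e : Mat4) (R : CurvSpace) : CurvSpace :=
  ⟨fun a b c d => ∑ k, ∑ l, ∑ m, ∑ n, e⁻¹ a k * e l b * e m c * e n d * R.1 k l m n, by
    intro a b c d
    rw [← Finset.sum_neg_distrib]
    refine Finset.sum_congr rfl fun k _ => ?_
    rw [← Finset.sum_neg_distrib]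
    refine Finset.sum_congr rfl fun l _ => ?_
    rw [Finset.sum_comm, ← Finset.sum_neg_distrib]
    refine Finset.sum_congr rfl fun m _ => ?_
    rw [← Finset.sum_neg_distrib]
    refine Finset.sum_congr rfl fun n _ => ?_
    rw [R.2 k l n m]
    ring⟩

/-- Invariance of a quadratic form on curvature under the full Lorentz group `O(1,3)`. -/
def IsLorentzInvariant (q : QuadraticForm ℝ CurvSpace) : Prop :=
  ∀ L : Mat4, Lᵀ * eta * L = eta → ∀ R : CurvSpace, q (inFrame L R) = q R

open Classical in
/-- The value `q(R)` of an `O(1,3)`-invariant quadratic form on the curvature `R` at a point where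
the metric is `g`: evaluate `q` on the components of `R` in a `g`-orthonormal frame.
By `quadAt_eq` the choice of the frame does not matter. -/
def quadAt (q : QuadraticForm ℝ CurvSpace) (g : Mat4) (R : CurvSpace) : ℝ :=
  if h : IsLorentzian g then q (inFrame h.choose R) else 0

/-- The Lagrangian density `q(R) √|det g|`. -/
def lagrangian (q : QuadraticForm ℝ CurvSpace) (g : MetricField) (Γ : Connection) (x : Pt) : ℝ :=
  quadAt q (g x) (curvature Γ x) * √|(g x).det|

/-- The action `∫ q(R)` over a region `K`. -/
def action (q : QuadraticForm ℝ CurvSpace) (K : Set Pt) (g : MetricField) (Γ : Connection) : ℝ :=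
  ∫ x in K, lagrangian q g Γ x

/-- `∂S/∂g = 0`: the action is stationary under all smooth compactly supported variations
of the metric, the connection being fixed. -/
def MetricEquation (q : QuadraticForm ℝ CurvSpace) (g : MetricField) (Γ : Connection) : Prop :=
  ∀ (K : Set Pt) (h : Pt → Mat4), IsCompact K →
    (∀ m n, ContDiff ℝ ∞ (fun x => h x m n)) → (∀ x, (h x).IsSymm) → (∀ x, x ∉ K → h x = 0) →
    (∀ᶠ t in 𝓝 (0 : ℝ),
      MeasureTheory.IntegrableOn (lagrangian q (fun x => g x + t • h x) Γ) K) ∧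
    HasDerivAt (fun t : ℝ => action q K (fun x => g x + t • h x) Γ) 0 0

/-- `∂S/∂Γ = 0`: the action is stationary under all smooth compactly supported variations
of the connection, the metric being fixed. -/
def ConnectionEquation (q : QuadraticForm ℝ CurvSpace) (g : MetricField) (Γ : Connection) : Prop :=
  ∀ (K : Set Pt) (B : Connection), IsCompact K →
    (∀ l m n, ContDiff ℝ ∞ (fun x => B x l m n)) → (∀ x, x ∉ K → B x = 0) →
    (∀ᶠ t in 𝓝 (0 : ℝ),
      MeasureTheory.IntegrableOn (lagrangian q g (fun x => Γ x + t • B x)) K) ∧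
    HasDerivAt (fun t : ℝ => action q K g (fun x => Γ x + t • B x)) 0 0

/-- The Euler-Lagrange equations of the action `∫ q(R)` under independent variation of
the metric and of the connection. -/
def SolvesFieldEquations (q : QuadraticForm ℝ CurvSpace) (g : MetricField) (Γ : Connection) :
    Prop :=
  MetricEquation q g Γ ∧ ConnectionEquation q g Γ

/-! ### Holonomy -/

/-- `ParallelTransport Γ x y A`: the matrix `A` is the parallel transport from `T_x` to `T_y` along
some piecewise `C¹` path, i.e. a finite concatenation of `C¹` paths `c : [0,1] → ℝ⁴`; along such
a path `P t` is the solution of `P' = -Γ(c')P`, `P 0 = 1`. -/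
inductive ParallelTransport (Γ : Connection) : Pt → Pt → Mat4 → Prop
  | along (c : ℝ → Pt) (P : ℝ → Mat4)
      (hc : ContDiffOn ℝ 1 c (Set.Icc 0 1))
      (h0 : P 0 = 1)
      (hP : ∀ t ∈ Set.Icc (0 : ℝ) 1, ∀ l j,
        HasDerivWithinAt (fun s => P s l j)
          (-∑ m, ∑ n, Γ (c t) l m n * derivWithin c (Set.Icc 0 1) t m * P t n j)
          (Set.Icc 0 1) t) :
      ParallelTransport Γ (c 0) (c 1) (P 1)
  | concat {x y z : Pt} {A B : Mat4}
      (hA : ParallelTransport Γ x y A) (hB : ParallelTransport Γ y z B) :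
      ParallelTransport Γ x z (B * A)

/-- The holonomy group at `x`: parallel transports along loops based at `x`. -/
def holonomy (Γ : Connection) (x : Pt) : Set Mat4 := {A | ParallelTransport Γ x x A}

/-- The Pauli matrices `σ_0 = 1, σ_1, σ_2, σ_3`. -/
def pauli : Fin 4 → Matrix (Fin 2) (Fin 2) ℂ :=
  ![!![1, 0; 0, 1], !![0, 1; 1, 0], !![0, -Complex.I; Complex.I, 0], !![1, 0; 0, -1]]

/-- The standard homomorphism from `SL(2, ℂ)` onto the proper orthochronous Lorentz group:
`A σ_n A† = ∑ m, L^m_n σ_m`, that is `L^m_n = ½ tr (σ_m A σ_n A†)`. -/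
def spinorMap (A : Matrix.SpecialLinearGroup (Fin 2) ℂ) : Mat4 := fun m n =>
  ((1 / 2) * (pauli m * A.1 * pauli n * A.1ᴴ).trace).re

/-- The group `B²` of matrices `(1 b; 0 1)`, `b ∈ ℂ`, in `SL(2, ℂ)`. -/
def B2 : Set (Matrix.SpecialLinearGroup (Fin 2) ℂ) := {A | ∃ b : ℂ, A.1 = !![1, b; 0, 1]}

/-- A set of linear maps of Minkowski space is, up to conjugation in `SL(2, ℂ)`, equal to `B²`
(identified with a subgroup of the proper orthochronous Lorentz group). -/
def IsConjB2 (H : Set Mat4) : Prop :=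
  ∃ S : Matrix.SpecialLinearGroup (Fin 2) ℂ, H = (fun A => spinorMap (S * A * S⁻¹)) '' B2

/-! ### The torsion wave -/

/-- The complex plane wave `u_m(x) = w_m exp(-i l·x)`, a complex-valued 1-form. -/
def planeWave (l : Fin 4 → ℝ) (w : Fin 4 → ℂ) : Pt → Fin 4 → ℂ := fun x m =>
  w m * Complex.exp (-Complex.I * ((∑ a, l a * x a : ℝ) : ℂ))

/-- The exterior derivative of a 1-form: `(du)_{mn} = ∂_m u_n - ∂_n u_m`. -/
def dform (u : Pt → Fin 4 → ℂ) : Pt → Fin 4 → Fin 4 → ℂ := fun x m n =>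
  pd m (fun y => u y n) x - pd n (fun y => u y m) x

/-- The tensor `½ Re(u ⊗ du)` with its first index raised by the Minkowski metric:
`T^k_{mn} = ½ η^{ka} Re(u_a (du)_{mn})`. -/
def waveTorsion (u : Pt → Fin 4 → ℂ) : Pt → Fin 4 → Fin 4 → Fin 4 → ℝ := fun x k m n =>
  (1 / 2) * ∑ a, eta⁻¹ k a * (u x a * dform u x m n).re

/-! ### Independence of the frame -/

lemma det_eta : eta.det = -1 := by
  simp [eta, Fin.prod_univ_four]

lemma IsOrthonormalFrame.isUnit_det {g e : Mat4} (h : IsOrthonormalFrame g e) :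
    IsUnit e.det := by
  have h1 := congrArg Matrix.det h
  rw [Matrix.det_mul, Matrix.det_mul, det_eta] at h1
  refine isUnit_iff_ne_zero.mpr fun h0 => ?_
  rw [h0] at h1
  norm_num at h1

lemma sum_prod_four (f g h i : Fin 4 → ℝ) (r : ℝ) :
    (∑ p, f p) * (∑ p, g p) * (∑ p, h p) * (∑ p, i p) * r =
      ∑ p₁, ∑ p₂, ∑ p₃, ∑ p₄, f p₁ * g p₂ * h p₃ * i p₄ * r := by
  simp only [← Finset.mul_sum, ← Finset.sum_mul]

lemma sum_comm_four (F : Fin 4 → Fin 4 → Fin 4 → Fin 4 → Tensor4) :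
    ∑ k, ∑ l, ∑ m, ∑ n, ∑ p₁, ∑ p₂, ∑ p₃, ∑ p₄, F k l m n p₁ p₂ p₃ p₄ =
      ∑ p₁, ∑ p₂, ∑ p₃, ∑ p₄, ∑ k, ∑ l, ∑ m, ∑ n, F k l m n p₁ p₂ p₃ p₄ := by
  have h := Finset.sum_comm (s := (Finset.univ : Finset (Fin 4 × Fin 4 × Fin 4 × Fin 4)))
    (t := (Finset.univ : Finset (Fin 4 × Fin 4 × Fin 4 × Fin 4)))
    (f := fun x y => F x.1 x.2.1 x.2.2.1 x.2.2.2 y.1 y.2.1 y.2.2.1 y.2.2.2)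
  simpa only [Fintype.sum_prod_type] using h

lemma inFrame_mul (e L : Mat4) (R : CurvSpace) :
    inFrame (e * L) R = inFrame L (inFrame e R) := by
  apply Subtype.ext
  funext a b c d
  simp only [inFrame, Matrix.mul_inv_rev, Matrix.mul_apply]
  simp only [sum_prod_four]
  rw [sum_comm_four]
  refine Finset.sum_congr rfl fun p₁ _ => Finset.sum_congr rfl fun p₂ _ =>
    Finset.sum_congr rfl fun p₃ _ => Finset.sum_congr rfl fun p₄ _ => ?_
  simp only [Finset.mul_sum]
  refine Finset.sum_congr rfl fun k _ => Finset.sum_congr rfl fun l _ =>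
    Finset.sum_congr rfl fun m _ => Finset.sum_congr rfl fun n _ => ?_
  ring

lemma quadAt_eq {q : QuadraticForm ℝ CurvSpace} (hq : IsLorentzInvariant q) {g e : Mat4}
    (he : IsOrthonormalFrame g e) (R : CurvSpace) : quadAt q g R = q (inFrame e R) := by
  have h : IsLorentzian g := ⟨e, he⟩
  have hc := h.choose_spec
  rw [quadAt, dif_pos h]
  set f := h.choose with hf
  have hu := he.isUnit_det
  have h1 : f = e * (e⁻¹ * f) := (Matrix.mul_nonsing_inv_cancel_left e f hu).symm
  rw [h1, inFrame_mul]
  apply hq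
  have h2 : eta = eᵀ * g * e := he.symm
  rw [h2]
  have h3 : (e⁻¹ * f)ᵀ * (eᵀ * g * e) * (e⁻¹ * f) = (e * (e⁻¹ * f))ᵀ * g * (e * (e⁻¹ * f)) := by
    simp only [Matrix.transpose_mul, Matrix.mul_assoc]
  rw [h3, ← h1]
  exact hc.trans h2

end TorsionWave

end

open scoped ContDiff Topology Matrix

noncomputable section

namespace TorsionWave

/-! ### The Minkowski matrix -/

/-! Write F = -i l∧w, so that du = F e^{-il·x}, let N be the endomorphism F^k_n, and let N̄ be its
complex conjugate. If F ≠ 0, proportionality of F to its Hodge dual forces l·l = l·w = w·w = 0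
(`isNullPair_of_hodge`). Hence N² = 0, and N N̄ = N̄ N is a multiple of l⊗l
(`IsNullPair.isNullBivector`). The real matrices Re(zN) therefore commute, and any product of three
of them vanishes. If F = 0, torsion, connection and curvature all vanish.

The connection Γ_{kmn} = ½ Re(w_m F_{kn} e^{-2il·x}) is metric since F is antisymmetric, and has the
required torsion since w∧F = 0. Its values are commuting matrices, so the curvature is linear in Γ
and equals Re(du⊗du). The Ricci traces of this tensor are entries of N², hence zero, and the right
dual only multiplies F⊗F by a constant.

The field equations need no classification of the invariant forms q. By `exists_polar_rad` the polar
form of q at Re(z F⊗F) is Q ↦ Re(z c ⟨F⊗F, Q⟩) for one complex constant c. The reason is that a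
boost combined with a rotation multiplies F by a number and a null rotation fixes F; covariance
under these two Lorentz maps leaves a single complex parameter for the functional. For the
connection equation, the first variation of the curvature is dB + [Γ,B]. The commutator is killed
because F commutes with Γ under the trace, and the dB term becomes a total divergence because l^m
F_{mn} = 0. For the metric equation, R is expressed in an orthonormal frame e(g) depending smoothly
on g near η. There ⟨F⊗F, R⟩ is a combination of products of two scalars, both vanishing at g = η
since tr N² = tr N N̄ = 0. So the Lagrangian is O(‖g-η‖²), and its first variation is zero.

Parallel transport solves P' = -Re(ζ(t)N)P with commuting coefficients, so it is always exp Re(zN),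
a quadratic polynomial in Re(zN). Suitable parallelograms realise every z. A spinor transformation
brings F to a canonical form, for which these exponentials are exactly the images of the matrices (1
b; 0 1). -/

/-- The diagonal entries of the Minkowski matrix. -/
def sig : Fin 4 → ℝ := ![1, -1, -1, -1]

lemma sig_mul_self (k : Fin 4) : sig k * sig k = 1 := by
  fin_cases k <;> simp [sig]

lemma eta_mul_eta : eta * eta = 1 := by
  rw [eta, Matrix.diagonal_mul_diagonal, ← Matrix.diagonal_one]
  congr 1
  funext k
  exact sig_mul_self k

lemma eta_inv : eta⁻¹ = eta := Matrix.inv_eq_left_inv eta_mul_eta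

lemma eta_apply (a b : Fin 4) : eta a b = if a = b then sig a else 0 := Matrix.diagonal_apply ..

lemma sum_eta_mul (k : Fin 4) (f : Fin 4 → ℝ) : ∑ a, eta k a * f a = sig k * f k := by
  simp [eta_apply]

lemma eta_transpose : etaᵀ = eta := Matrix.diagonal_transpose _

/-! ### Phase factors -/

/-- The phase factor `exp(-i l·x)`. -/
def osc (l : Fin 4 → ℝ) (x : Pt) : ℂ := Complex.exp (-Complex.I * ((∑ a, l a * x a : ℝ) : ℂ))

lemma contDiff_osc (l : Fin 4 → ℝ) : ContDiff ℝ ∞ (osc l) := by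
  refine Complex.contDiff_exp.comp (contDiff_const.mul (Complex.ofRealCLM.contDiff.comp ?_))
  have h : ContDiff ℝ ∞ fun x : Pt => ∑ a, l a * x a :=
    ContDiff.sum fun a _ => contDiff_const.mul (contDiff_apply ℝ ℝ a)
  exact h

lemma hasFDerivAt_osc (l : Fin 4 → ℝ) (x : Pt) :
    HasFDerivAt (osc l) (osc l x • (-Complex.I) • Complex.ofRealCLM.comp
      (∑ a, l a • (ContinuousLinearMap.proj a : Pt →L[ℝ] ℝ))) x := by
  have h : HasFDerivAt (fun y : Pt => ∑ a, l a * y a)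
      (∑ a, l a • (ContinuousLinearMap.proj a : Pt →L[ℝ] ℝ)) x :=
    HasFDerivAt.fun_sum fun a _ => (hasFDerivAt_apply a x).const_mul (l a)
  exact (((Complex.ofRealCLM.hasFDerivAt (x := ∑ a, l a * x a)).comp x h).const_mul
    (-Complex.I)).cexp

lemma pd_const_mul_osc (l : Fin 4 → ℝ) (c : ℂ) (m : Fin 4) (x : Pt) :
    pd m (fun y => c * osc l y) x = -Complex.I * l m * (c * osc l x) := by
  rw [pd, ((hasFDerivAt_osc l x).const_mul c).fderiv]
  simp [Pi.single_apply]
  ring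

lemma osc_mul_self (l : Fin 4 → ℝ) (x : Pt) : osc l x * osc l x = osc (2 • l) x := by
  have h : ∑ a, (2 • l) a * x a = 2 * ∑ a, l a * x a := by
    simp [Finset.mul_sum, mul_assoc]
  rw [osc, ← Complex.exp_add, osc, h]
  congr 1
  push_cast
  ring

lemma pd_re_const_mul_osc (l : Fin 4 → ℝ) (c : ℂ) (m : Fin 4) (x : Pt) :
    pd m (fun y => (c * osc l y).re) x = (-Complex.I * l m * (c * osc l x)).re := by
  have h := (Complex.reCLM.hasFDerivAt (x := c * osc l x)).comp x
    ((hasFDerivAt_osc l x).const_mul c)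
  rw [← pd_const_mul_osc, pd, pd, ((hasFDerivAt_osc l x).const_mul c).fderiv]
  erw [h.fderiv]
  rfl

lemma contDiff_re_const_mul_osc (l : Fin 4 → ℝ) (c : ℂ) :
    ContDiff ℝ ∞ (fun y => (c * osc l y).re) :=
  Complex.reCLM.contDiff.comp (contDiff_const.mul (contDiff_osc l))

lemma osc_zero (l : Fin 4 → ℝ) : osc l 0 = 1 := by simp [osc]

lemma norm_osc (l : Fin 4 → ℝ) (x : Pt) : ‖osc l x‖ = 1 := by
  rw [osc, neg_mul, mul_comm, ← neg_mul, ← Complex.ofReal_neg, Complex.norm_exp_ofReal_mul_I]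

lemma osc_add (l : Fin 4 → ℝ) (x y : Pt) : osc l (x + y) = osc l x * osc l y := by
  rw [osc, osc, osc, ← Complex.exp_add]
  congr 1
  simp [mul_add, Finset.sum_add_distrib]

/-! ### The bivector of a plane wave -/

/-- The bivector `-i l ∧ w`. -/
def biv (l : Fin 4 → ℝ) (w : Fin 4 → ℂ) : Fin 4 → Fin 4 → ℂ := fun m n =>
  -Complex.I * (l m * w n - l n * w m)

lemma biv_antisymm (l : Fin 4 → ℝ) (w : Fin 4 → ℂ) (m n : Fin 4) :
    biv l w m n = -biv l w n m := by
  simp only [biv]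
  ring

lemma planeWave_eq (l : Fin 4 → ℝ) (w : Fin 4 → ℂ) (x : Pt) (m : Fin 4) :
    planeWave l w x m = w m * osc l x := rfl

lemma dform_planeWave (l : Fin 4 → ℝ) (w : Fin 4 → ℂ) (x : Pt) (m n : Fin 4) :
    dform (planeWave l w) x m n = biv l w m n * osc l x := by
  simp only [dform, planeWave_eq, pd_const_mul_osc, biv]
  ring

/-- A wedge of two covectors vanishes exactly when they are dependent. This turns the condition in
claims 3 and 4 into F ≠ 0, the form in which it is used throughout. -/
lemma biv_eq_zero_iff (l : Fin 4 → ℝ) (w : Fin 4 → ℂ) :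
    biv l w = 0 ↔ ¬ (l ≠ 0 ∧ w ∉ Submodule.span ℂ {fun m => (l m : ℂ)}) := by
  have hb : ∀ m n, biv l w m n = 0 ↔ l m * w n = l n * w m := fun m n => by
    simp [biv, sub_eq_zero]
  rw [not_and_or, not_not, not_not, Submodule.mem_span_singleton]
  constructor
  · intro h
    by_cases hl : l = 0
    · exact Or.inl hl
    · right
      obtain ⟨m, hm⟩ := Function.ne_iff.mp hl
      have hm' : (l m : ℂ) ≠ 0 := by exact_mod_cast hm
      refine ⟨w m / l m, ?_⟩
      funext n
      have := (hb m n).1 (congrFun (congrFun h m) n)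
      simp only [Pi.smul_apply, smul_eq_mul]
      field_simp
      linear_combination -this
  · rintro (rfl | ⟨c, rfl⟩)
    · ext m n; simp [biv]
    · ext m n; simp [biv]; ring

/-! ### Polarized bivectors are null -/

/-- `l` and `w` are null and orthogonal to each other. -/
structure IsNullPair (l : Fin 4 → ℝ) (w : Fin 4 → ℂ) : Prop where
  null_left : ∑ a, sig a * l a * l a = 0
  orthogonal : ∑ a, (sig a : ℂ) * l a * w a = 0
  null_right : ∑ a, (sig a : ℂ) * w a * w a = 0

lemma hodge_eta (G : Fin 4 → Fin 4 → ℂ) (hG : ∀ m n, G m n = -G n m) :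
    hodge eta G 0 1 = G 2 3 ∧ hodge eta G 0 2 = -G 1 3 ∧ hodge eta G 0 3 = G 1 2 ∧
    hodge eta G 1 2 = -G 0 3 ∧ hodge eta G 1 3 = G 0 2 ∧ hodge eta G 2 3 = -G 0 1 := by
  have he : ∀ a b m n, ((1 / 2 : ℝ) * √|eta.det| * ∑ c, ∑ d, eta⁻¹ a c * eta⁻¹ b d *
      (eps c d m n : ℝ)) = 1 / 2 * sig a * sig b * (eps a b m n : ℝ) := by
    intro a b m n
    rw [eta_inv, det_eta]
    simp [eta_apply, mul_assoc]
  have h10 := hG 1 0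
  have h20 := hG 2 0
  have h30 := hG 3 0
  have h21 := hG 2 1
  have h31 := hG 3 1
  have h32 := hG 3 2
  have e1 : ∀ m n, hodge eta G m n = ∑ a, ∑ b, (1 / 2 * sig a * sig b * (eps a b m n : ℝ)) • G a b :=
    fun m n => by simp only [hodge, he]
  have v01 : ∀ a b, eps a b 0 1 = if (a, b) = (2, 3) then 1 else if (a, b) = (3, 2) then -1 else 0 :=
    by decide
  have v02 : ∀ a b, eps a b 0 2 = if (a, b) = (1, 3) then -1 else if (a, b) = (3, 1) then 1 else 0 :=
    by decide
  have v03 : ∀ a b, eps a b 0 3 = if (a, b) = (1, 2) then 1 else if (a, b) = (2, 1) then -1 else 0 :=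
    by decide
  have v12 : ∀ a b, eps a b 1 2 = if (a, b) = (0, 3) then 1 else if (a, b) = (3, 0) then -1 else 0 :=
    by decide
  have v13 : ∀ a b, eps a b 1 3 = if (a, b) = (0, 2) then -1 else if (a, b) = (2, 0) then 1 else 0 :=
    by decide
  have v23 : ∀ a b, eps a b 2 3 = if (a, b) = (0, 1) then 1 else if (a, b) = (1, 0) then -1 else 0 :=
    by decide
  refine ⟨?_, ?_, ?_, ?_, ?_, ?_⟩ <;> rw [e1] <;>
    simp [Fin.sum_univ_four, v01, v02, v03, v12, v13, v23, sig, h10, h20, h30, h21, h31, h32]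
  all_goals ring

/-- Contracting *F with l or w gives zero, because l∧F = w∧F = 0. As *F = cF with c ≠ 0, the same
contractions of F vanish, and these are linear relations between l and w. Since l∧w ≠ 0, their
coefficients l·l, l·w and w·w must be zero. Only proportionality of F and *F matters, not the value
of c. -/
lemma isNullPair_of_hodge {l : Fin 4 → ℝ} {w : Fin 4 → ℂ} {c : ℂ}
    (h : hodge eta (biv l w) = c • biv l w) (h0 : biv l w ≠ 0) : IsNullPair l w := by
  obtain ⟨h1, h2, h3, h4, h5, h6⟩ := hodge_eta (biv l w) (biv_antisymm l w)
  rw [h] at h1 h2 h3 h4 h5 h6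
  simp only [Pi.smul_apply, smul_eq_mul] at h1 h2 h3 h4 h5 h6
  -- The components of *F are those of F permuted up to sign, so c = 0 would give F = 0.
  have hc : c ≠ 0 := by
    rintro rfl
    apply h0
    have e1 : biv l w 2 3 = 0 := by linear_combination -h1
    have e2 : biv l w 1 3 = 0 := by linear_combination h2
    have e3 : biv l w 1 2 = 0 := by linear_combination -h3
    have e4 : biv l w 0 3 = 0 := by linear_combination h4
    have e5 : biv l w 0 2 = 0 := by linear_combination -h5
    have e6 : biv l w 0 1 = 0 := by linear_combination h6
    ext m n
    fin_cases m <;> fin_cases n <;>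
      simp [biv_antisymm l w 1 0, biv_antisymm l w 2 0, biv_antisymm l w 3 0,
        biv_antisymm l w 2 1, biv_antisymm l w 3 1, biv_antisymm l w 3 2, e1, e2, e3, e4, e5, e6] <;>
      simp [biv]
  have hI : ∀ z z' : ℂ, c * (-Complex.I * z) = -Complex.I * z' → c * z = z' := fun z z' h => by
    linear_combination Complex.I * h + (c * z - z') * Complex.I_mul_I
  have hI' : ∀ z z' : ℂ, c * (-Complex.I * z) = -(-Complex.I * z') → c * z = -z' := fun z z' h =>
    hI z (-z') (by linear_combination h)
  have g1 := hI _ _ h1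
  have g2 := hI' _ _ h2
  have g3 := hI _ _ h3
  have g4 := hI' _ _ h4
  have g5 := hI _ _ h5
  have g6 := hI' _ _ h6
  -- This is l^m F_{mn} = 0 written out; `hW` below is the same relation for w.
  have hL : ∀ n, (∑ a, (sig a : ℂ) * l a * l a) * w n = (∑ a, (sig a : ℂ) * l a * w a) * l n := by
    intro n
    have : c * ((∑ a, (sig a : ℂ) * l a * l a) * w n - (∑ a, (sig a : ℂ) * l a * w a) * l n) = 0 := by
      rw [Fin.sum_univ_four, Fin.sum_univ_four]
      fin_cases n <;> simp [-mul_eq_zero, sig]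
      · linear_combination l 1 * g1 + l 2 * g2 + l 3 * g3
      · linear_combination l 0 * g1 + l 2 * g4 + l 3 * g5
      · linear_combination l 0 * g2 - l 1 * g4 + l 3 * g6
      · linear_combination l 0 * g3 - l 1 * g5 - l 2 * g6
    exact sub_eq_zero.1 ((mul_eq_zero.1 this).resolve_left hc)
  have hW : ∀ n, (∑ a, (sig a : ℂ) * l a * w a) * w n = (∑ a, (sig a : ℂ) * w a * w a) * l n := by
    intro n
    have : c * ((∑ a, (sig a : ℂ) * l a * w a) * w n - (∑ a, (sig a : ℂ) * w a * w a) * l n) = 0 := by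
      rw [Fin.sum_univ_four, Fin.sum_univ_four]
      fin_cases n <;> simp [-mul_eq_zero, sig]
      · linear_combination w 1 * g1 + w 2 * g2 + w 3 * g3
      · linear_combination w 0 * g1 + w 2 * g4 + w 3 * g5
      · linear_combination w 0 * g2 - w 1 * g4 + w 3 * g6
      · linear_combination w 0 * g3 - w 1 * g5 - w 2 * g6
    exact sub_eq_zero.1 ((mul_eq_zero.1 this).resolve_left hc)
  obtain ⟨m, n, hmn⟩ : ∃ m n, (l m * w n - l n * w m : ℂ) ≠ 0 := by
    by_contra! hcon
    apply h0
    ext m n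
    simp [biv, hcon m n]
  refine ⟨?_, ?_, ?_⟩
  · have : (∑ a, (sig a : ℂ) * l a * l a) * (l m * w n - l n * w m) = 0 := by
      linear_combination l m * hL n - l n * hL m
    exact_mod_cast (mul_eq_zero.1 this).resolve_right hmn
  · have : (∑ a, (sig a : ℂ) * l a * w a) * (l m * w n - l n * w m) = 0 := by
      linear_combination w m * hL n - w n * hL m
    exact (mul_eq_zero.1 this).resolve_right hmn
  · have : (∑ a, (sig a : ℂ) * w a * w a) * (l m * w n - l n * w m) = 0 := by
      linear_combination w m * hW n - w n * hW m
    exact (mul_eq_zero.1 this).resolve_right hmn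

/-- A plane wave whose field strength is polarized is null, unless its field strength vanishes. -/
lemma biv_eq_zero_or_isNullPair {l : Fin 4 → ℝ} {w : Fin 4 → ℂ}
    (hu : (∀ x, hodge eta (dform (planeWave l w) x) = Complex.I • dform (planeWave l w) x) ∨
      (∀ x, hodge eta (dform (planeWave l w) x) = (-Complex.I) • dform (planeWave l w) x)) :
    biv l w = 0 ∨ IsNullPair l w := by
  rw [or_iff_not_imp_left]
  intro h0
  have hd : dform (planeWave l w) 0 = biv l w := by
    ext m n
    simp [dform_planeWave, osc_zero]
  rcases hu with h | h
  all_goals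
    have h := h 0
    rw [hd] at h
    exact isNullPair_of_hodge h h0

/-- The algebraic identities of the field strength of a polarized plane wave. -/
structure IsNullBivector (l : Fin 4 → ℝ) (w : Fin 4 → ℂ) : Prop where
  contract_left : ∀ n, ∑ a, (sig a : ℂ) * l a * biv l w a n = 0
  sq : ∀ m n, ∑ a, biv l w m a * sig a * biv l w a n = 0
  comm : ∀ m n, ∑ a, biv l w m a * sig a * star (biv l w a n) =
    ∑ a, star (biv l w m a) * sig a * biv l w a n
  cross : ∑ m, ∑ a, sig m * biv l w m a * sig a * star (biv l w a m) = 0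

lemma IsNullPair.star_right {l : Fin 4 → ℝ} {w : Fin 4 → ℂ} (h : IsNullPair l w) :
    IsNullPair l (star w) := by
  refine ⟨h.null_left, ?_, ?_⟩
  · have := congrArg Star.star h.orthogonal
    simpa [Fin.sum_univ_four, mul_comm] using this
  · have := congrArg Star.star h.null_right
    simpa [Fin.sum_univ_four, mul_comm] using this

lemma star_biv (l : Fin 4 → ℝ) (w : Fin 4 → ℂ) (m n : Fin 4) :
    star (biv l w m n) = -biv l (star w) m n := by
  simp [biv]

/-- Expanding the products leaves only the scalars l·l, l·w, w·w, l·w̄ and w·w̄. All but the last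
vanish, and w·w̄ enters N N̄ only as the coefficient of l_m l_n, which is the same in both orders
and has zero trace. -/
lemma IsNullPair.isNullBivector {l : Fin 4 → ℝ} {w : Fin 4 → ℂ} (h : IsNullPair l w) :
    IsNullBivector l w := by
  have h1 : ∑ a, (sig a : ℂ) * l a * l a = 0 := by exact_mod_cast h.null_left
  have h2 := h.orthogonal
  have h3 := h.null_right
  have h4 := h.star_right.orthogonal
  rw [Fin.sum_univ_four] at h1 h2 h3 h4
  constructor
  · intro n
    rw [Fin.sum_univ_four]
    simp only [biv]
    linear_combination (-Complex.I * w n) * h1 + Complex.I * l n * h2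
  · intro m n
    rw [Fin.sum_univ_four]
    simp only [biv]
    linear_combination (l m * w n + l n * w m) * Complex.I ^ 2 * h2 - w m * w n * Complex.I ^ 2 * h1 -
      l m * l n * Complex.I ^ 2 * h3
  · intro m n
    simp only [star_biv]
    generalize star w = v at h4
    rw [Fin.sum_univ_four, Fin.sum_univ_four]
    simp only [biv]
    linear_combination (-Complex.I * Complex.I) * ((l m * v n - v m * l n) * h2
      + (w m * l n - l m * w n) * h4 - (w m * v n - v m * w n) * h1)
  · simp only [star_biv]
    generalize star w = v at h4
    simp only [Fin.sum_univ_four]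
    simp only [biv]
    simp only [sig] at h1 h2 h3 h4 ⊢
    simp at h1 h2 h3 h4 ⊢
    linear_combination (-Complex.I * Complex.I) *
      (2 * (l 0 * v 0 - l 1 * v 1 - l 2 * v 2 - l 3 * v 3) * h2 -
        2 * (w 0 * v 0 - w 1 * v 1 - w 2 * v 2 - w 3 * v 3) * h1)

lemma isNullBivector_of_biv_eq_zero {l : Fin 4 → ℝ} {w : Fin 4 → ℂ} (h : biv l w = 0) :
    IsNullBivector l w := by
  constructor <;> simp [h]

/-! ### The connection with the given torsion -/

/-- The metric compatible connection whose torsion is that of the plane wave. -/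
def waveConnection (l : Fin 4 → ℝ) (w : Fin 4 → ℂ) : Connection := fun x k m n =>
  sig k * (1 / 2 * (w m * biv l w k n * osc (2 • l) x).re)

lemma metricCompatible_minkowski_iff (Γ : Connection) :
    MetricCompatible minkowski Γ ↔ ∀ x m a b, sig b * Γ x b m a + sig a * Γ x a m b = 0 := by
  have h : ∀ (x : Pt) (m a b : Fin 4),
      pd m (fun y => minkowski y a b) x - ∑ k, Γ x k m a * minkowski x k b
        - ∑ k, Γ x k m b * minkowski x a k = -(sig b * Γ x b m a + sig a * Γ x a m b) := by
    intro x m a b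
    simp [minkowski, pd, eta_apply]
    ring
  simp only [MetricCompatible, h, neg_eq_zero]

lemma metricCompatible_waveConnection (l : Fin 4 → ℝ) (w : Fin 4 → ℂ) :
    MetricCompatible minkowski (waveConnection l w) := by
  rw [metricCompatible_minkowski_iff]
  intro x m a b
  simp only [waveConnection]
  rw [biv_antisymm l w a b, mul_neg, neg_mul, Complex.neg_re]
  linear_combination (1 / 2 * (w m * biv l w b a * osc (2 • l) x).re) *
    (sig_mul_self b - sig_mul_self a)

lemma waveTorsion_planeWave (l : Fin 4 → ℝ) (w : Fin 4 → ℂ) (x : Pt) (k m n : Fin 4) :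
    waveTorsion (planeWave l w) x k m n =
      sig k * (1 / 2 * (w k * biv l w m n * osc (2 • l) x).re) := by
  rw [waveTorsion, eta_inv, sum_eta_mul, dform_planeWave, planeWave_eq, ← osc_mul_self]
  rw [show w k * osc l x * (biv l w m n * osc l x) = w k * biv l w m n * (osc l x * osc l x) by ring]
  ring

/-- The identity behind this is w_m F_{kn} - w_n F_{km} = w_k F_{mn}, that is w∧F = 0. -/
lemma torsion_waveConnection (l : Fin 4 → ℝ) (w : Fin 4 → ℂ) :
    torsion (waveConnection l w) = waveTorsion (planeWave l w) := by
  funext x k m n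
  rw [waveTorsion_planeWave]
  simp only [torsion, waveConnection]
  rw [← mul_sub, ← mul_sub, ← Complex.sub_re]
  congr 4
  simp only [biv]
  ring

/-- A metric compatible connection is determined by its torsion. -/
lemma eq_of_torsion_eq {Γ Γ' : Connection} (h : MetricCompatible minkowski Γ)
    (h' : MetricCompatible minkowski Γ') (ht : torsion Γ = torsion Γ') : Γ = Γ' := by
  rw [metricCompatible_minkowski_iff] at h h'
  funext x k m n
  have t : ∀ a b c, Γ x a b c - Γ x a c b = Γ' x a b c - Γ' x a c b := fun a b c =>
    congrFun (congrFun (congrFun (congrFun ht x) a) b) c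
  -- The lowered difference of the connections is antisymmetric in its first and third indices and
  -- symmetric in the last two. The coefficients are those of Koszul's cyclic combination, which
  -- shows that such a tensor is zero.
  have key : sig k * (Γ x k m n - Γ' x k m n) = 0 := by
    linear_combination (1 / 2) * (h x m n k - h' x m n k) + (1 / 2) * sig k * t k m n
      - (1 / 2) * sig n * t n m k + (1 / 2) * (h x n m k - h' x n m k)
      + (1 / 2) * sig m * t m k n - (1 / 2) * (h x k m n - h' x k m n)
  have hs : sig k ≠ 0 := fun h0 => by simpa [h0] using sig_mul_self k
  exact sub_eq_zero.1 ((mul_eq_zero.1 key).resolve_left hs)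

lemma contDiff_waveConnection (l : Fin 4 → ℝ) (w : Fin 4 → ℂ) (k m n : Fin 4) :
    ContDiff ℝ ∞ (fun x => waveConnection l w x k m n) :=
  contDiff_const.mul (contDiff_const.mul (contDiff_re_const_mul_osc _ _))

/-! ### Its curvature -/

/-- The curvature tensor `Re(z F ⊗ F)`, with `F = -i l ∧ w`. -/
def rad (l : Fin 4 → ℝ) (w : Fin 4 → ℂ) (z : ℂ) : CurvSpace :=
  ⟨fun k j m n => sig k * (z * biv l w k j * biv l w m n).re, by
    intro k j m n
    simp only
    rw [biv_antisymm l w m n, mul_neg, Complex.neg_re, mul_neg]⟩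

lemma rad_apply (l : Fin 4 → ℝ) (w : Fin 4 → ℂ) (z : ℂ) (k j m n : Fin 4) :
    (rad l w z).1 k j m n = sig k * (z * biv l w k j * biv l w m n).re := rfl

lemma rad_add (l : Fin 4 → ℝ) (w : Fin 4 → ℂ) (z z' : ℂ) :
    rad l w (z + z') = rad l w z + rad l w z' := by
  apply Subtype.ext
  funext k j m n
  simp only [rad_apply, Submodule.coe_add, Pi.add_apply, add_mul, Complex.add_re, mul_add]

lemma rad_real_mul (l : Fin 4 → ℝ) (w : Fin 4 → ℂ) (r : ℝ) (z : ℂ) :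
    rad l w (r * z) = r • rad l w z := by
  apply Subtype.ext
  funext k j m n
  simp only [rad_apply, Submodule.coe_smul, Pi.smul_apply, smul_eq_mul, mul_assoc,
    Complex.re_ofReal_mul]
  ring

/-- Products of the connection matrices commute. -/
lemma waveConnection_comm {l : Fin 4 → ℝ} {w : Fin 4 → ℂ} (h : IsNullBivector l w)
    (a b : ℂ) (k n : Fin 4) :
    ∑ j, (sig k * (a * biv l w k j).re) * (sig j * (b * biv l w j n).re) =
      ∑ j, (sig k * (b * biv l w k j).re) * (sig j * (a * biv l w j n).re) := by
  -- This splits a product of real parts into an N N term, which vanishes, and an N N̄ term.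
  have re_mul : ∀ p q : ℂ, p.re * q.re = (1 / 2) * (p * q + p * star q).re := by
    intro p q
    simp
    ring
  have aux : ∀ a b : ℂ, ∑ j, (sig k * (a * biv l w k j).re) * (sig j * (b * biv l w j n).re) =
      sig k * (1 / 2) * (a * b * ∑ j, biv l w k j * sig j * biv l w j n +
        a * star b * ∑ j, biv l w k j * sig j * star (biv l w j n)).re := by
    intro a b
    rw [Finset.mul_sum, Finset.mul_sum, ← Finset.sum_add_distrib, Complex.re_sum, Finset.mul_sum]
    refine Finset.sum_congr rfl fun j _ => ?_
    have := re_mul (a * biv l w k j) (b * biv l w j n)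
    have h2 : a * b * (biv l w k j * sig j * biv l w j n) +
        a * star b * (biv l w k j * sig j * star (biv l w j n)) =
        (sig j : ℂ) * (a * biv l w k j * (b * biv l w j n) +
          a * biv l w k j * star (b * biv l w j n)) := by
      rw [star_mul']
      ring
    rw [h2, Complex.re_ofReal_mul]
    linear_combination sig k * sig j * this
  rw [aux, aux, h.sq, mul_zero, mul_zero, zero_add, zero_add]
  congr 1
  -- The entries of the N N̄ contraction are real, so only Re(a b̄) remains, and this is symmetric
  -- in a and b.
  have hc : star (∑ j, biv l w k j * sig j * star (biv l w j n)) =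
      ∑ j, biv l w k j * sig j * star (biv l w j n) := by
    rw [h.comm, star_sum]
    rw [← h.comm]
    refine Finset.sum_congr rfl fun j _ => ?_
    simp
  rw [← Complex.conj_re (a * star b * _)]
  congr 1
  rw [← Complex.star_def, star_mul', hc, star_mul', star_star]
  ring

/-- The quadratic terms cancel because the connection matrices commute. In the linear terms
differentiation produces -2i l_m, whose antisymmetrization against w_n is 2F_{mn}; the 2 cancels the
½ in the connection. -/
lemma curvature_waveConnection {l : Fin 4 → ℝ} {w : Fin 4 → ℂ} (h : IsNullBivector l w) (x : Pt) :
    curvature (waveConnection l w) x = rad l w (osc (2 • l) x) := by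
  apply Subtype.ext
  funext k j m n
  have hpd : ∀ k m n p, pd p (fun y => waveConnection l w y k m n) x =
      sig k * (1 / 2 * (-Complex.I * ((2 • l) p : ℝ) * (w m * biv l w k n * osc (2 • l) x)).re) := by
    intro k m n p
    have hf : DifferentiableAt ℝ (fun y => (w m * biv l w k n * osc (2 • l) y).re) x :=
      (contDiff_re_const_mul_osc (2 • l) _).differentiable (by simp) x
    rw [← pd_re_const_mul_osc]
    simp only [waveConnection, pd]
    rw [fderiv_const_mul (hf.const_mul _), fderiv_const_mul hf]
    simp
  have hc : ∀ p q, ∑ i, waveConnection l w x k p i * waveConnection l w x i q j =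
      ∑ i, (sig k * ((1 / 2 * w p * osc (2 • l) x) * biv l w k i).re) *
        (sig i * ((1 / 2 * w q * osc (2 • l) x) * biv l w i j).re) := by
    intro p q
    refine Finset.sum_congr rfl fun i _ => ?_
    have : ∀ z : ℂ, 1 / 2 * z.re = (1 / 2 * z).re := fun z => by
      rw [← Complex.re_ofReal_mul]; norm_num
    simp only [waveConnection, this]
    congr 3 <;> ring
  change pd m (fun y => waveConnection l w y k n j) x - pd n (fun y => waveConnection l w y k m j) x
    + ∑ i, waveConnection l w x k m i * waveConnection l w x i n j
    - ∑ i, waveConnection l w x k n i * waveConnection l w x i m j = _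
  rw [hc m n, hc n m, waveConnection_comm h, add_sub_cancel_right, hpd, hpd, rad_apply, ← mul_sub,
    ← mul_sub, ← Complex.sub_re]
  congr 1
  rw [show (1 / 2 : ℝ) = ((1 / 2 : ℝ) : ℂ).re by simp, ← Complex.re_ofReal_mul]
  congr 1
  simp [biv]
  ring

lemma lower_rad (l : Fin 4 → ℝ) (w : Fin 4 → ℂ) (z : ℂ) (k j m n : Fin 4) :
    lower eta (rad l w z).1 k j m n = (z * biv l w k j * biv l w m n).re := by
  simp only [lower, sum_eta_mul, rad_apply]
  linear_combination (z * biv l w k j * biv l w m n).re * sig_mul_self k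

lemma hodge_const_mul (g : Mat4) (c : ℂ) (G : Fin 4 → Fin 4 → ℂ) (m n : Fin 4) :
    hodge g (fun a b => c * G a b) m n = c * hodge g G m n := by
  simp only [hodge, Finset.mul_sum, mul_smul_comm]

lemma hodge_re (g : Mat4) (r : ℝ) (G : Fin 4 → Fin 4 → ℂ) (m n : Fin 4) :
    hodge g (fun a b => r * (G a b).re) m n = r * (hodge g G m n).re := by
  simp only [hodge, Complex.re_sum, Finset.mul_sum (s := (Finset.univ : Finset (Fin 4))) (a := r),
    Complex.real_smul, Complex.re_ofReal_mul, smul_eq_mul]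
  refine Finset.sum_congr rfl fun a _ => Finset.sum_congr rfl fun b _ => ?_
  ring

/-- The star acts on the second factor F alone, which is an eigenvector. The dual is again of the
form `rad`, so its traces need no separate computation. -/
lemma rightStar_rad {l : Fin 4 → ℝ} {w : Fin 4 → ℂ} {c : ℂ}
    (h : hodge eta (biv l w) = c • biv l w) (z : ℂ) :
    rightStar eta (rad l w z).1 = (rad l w (z * c)).1 := by
  funext k j m n
  have : (rad l w z).1 k j = fun m n => sig k * (z * biv l w k j * biv l w m n).re := rfl
  rw [rightStar, this, hodge_re, hodge_const_mul, h, rad_apply]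
  simp only [Pi.smul_apply, smul_eq_mul]
  congr 2
  ring

/-- The trace joins one index of each factor F and gives an entry of N² = 0. -/
lemma ricci_rad {l : Fin 4 → ℝ} {w : Fin 4 → ℂ} (h : IsNullBivector l w) (z : ℂ)
    (j n : Fin 4) : ricci (rad l w z).1 j n = 0 := by
  have h1 : ∀ k, (rad l w z).1 k j k n = (-z * (biv l w j k * sig k * biv l w k n)).re := by
    intro k
    rw [rad_apply, ← Complex.re_ofReal_mul, biv_antisymm l w k j]
    congr 1
    ring
  simp only [ricci, h1]
  rw [← Complex.re_sum, ← Finset.mul_sum, h.sq, mul_zero, Complex.zero_re]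

lemma ricci'_rad {l : Fin 4 → ℝ} {w : Fin 4 → ℂ} (h : IsNullBivector l w) (z : ℂ)
    (k n : Fin 4) : ricci' eta (rad l w z).1 k n = 0 := by
  have h1 : ∀ a, ∑ b, eta⁻¹ b a * lower eta (rad l w z).1 k b a n =
      (z * (biv l w k a * sig a * biv l w a n)).re := by
    intro a
    rw [eta_inv]
    simp only [eta_apply, lower_rad]
    simp only [ite_mul, zero_mul, Finset.sum_ite_eq', Finset.mem_univ, if_true]
    rw [← Complex.re_ofReal_mul]
    congr 1
    ring
  simp only [ricci', h1]
  rw [← Complex.re_sum, ← Finset.mul_sum, h.sq, mul_zero, Complex.zero_re]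

lemma isWeyl_rad {l : Fin 4 → ℝ} {w : Fin 4 → ℂ} (h : IsNullBivector l w) {c : ℂ}
    (hc : hodge eta (biv l w) = c • biv l w) (z : ℂ) : IsWeyl eta (rad l w z) where
  ricci_eq := ricci_rad h z
  ricci_star_eq := by
    rw [rightStar_rad hc]
    exact ricci_rad h _
  ricci'_eq := ricci'_rad h z
  ricci'_star_eq := by
    rw [rightStar_rad hc]
    exact ricci'_rad h _
  trace_eq := by
    intro m n
    refine Finset.sum_eq_zero fun k _ => ?_
    rw [rad_apply, show biv l w k k = 0 by simp [biv]]
    simp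
  antisymm := by
    intro k j m n
    rw [lower_rad, lower_rad, biv_antisymm l w k j]
    simp

lemma hodge_biv {l : Fin 4 → ℝ} {w : Fin 4 → ℂ} {c : ℂ}
    (h : ∀ x, hodge eta (dform (planeWave l w) x) = c • dform (planeWave l w) x) :
    hodge eta (biv l w) = c • biv l w := by
  have hd : dform (planeWave l w) 0 = biv l w := by
    ext m n
    simp [dform_planeWave, osc_zero]
  simpa only [hd] using h 0

lemma isLorentzian_eta : IsLorentzian eta := ⟨1, by simp [IsOrthonormalFrame]⟩

lemma isSpacetime_waveConnection (l : Fin 4 → ℝ) (w : Fin 4 → ℂ) :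
    IsSpacetime minkowski (waveConnection l w) where
  smooth_metric _ _ := contDiff_const
  lorentzian _ := isLorentzian_eta
  smooth_connection := contDiff_waveConnection l w

/-! ### Vanishing of the connection and of the curvature -/

lemma christoffel_minkowski : christoffel minkowski = 0 := by
  funext x k m n
  simp [christoffel, minkowski, pd]

/-- At the origin the value of the function is Re c, and its derivative along a direction with l_m ≠
0 is a nonzero multiple of Im c. If the function were identically zero, both would vanish. -/
lemma exists_re_mul_osc_ne_zero {l : Fin 4 → ℝ} (hl : l ≠ 0) {c : ℂ} (hc : c ≠ 0) :
    ∃ x, (c * osc (2 • l) x).re ≠ 0 := by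
  by_contra! hcon
  obtain ⟨m, hm⟩ := Function.ne_iff.mp hl
  have h1 : c.re = 0 := by simpa [osc_zero] using hcon 0
  have h2 : (-Complex.I * ((2 • l) m : ℝ) * (c * osc (2 • l) 0)).re = 0 := by
    rw [← pd_re_const_mul_osc]
    simp only [hcon, pd]
    simp
  rw [osc_zero] at h2
  have h3 : c.im = 0 := by
    have : l m ≠ 0 := hm
    simpa [this, h1] using h2
  exact hc (Complex.ext h1 h3)

lemma waveConnection_eq_zero_iff (l : Fin 4 → ℝ) (w : Fin 4 → ℂ) :
    waveConnection l w = 0 ↔ biv l w = 0 := by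
  constructor
  · intro h
    by_contra hb
    have hb' := hb
    rw [biv_eq_zero_iff, not_not] at hb'
    have hw : w ≠ 0 := fun h0 => hb'.2 (h0 ▸ Submodule.zero_mem _)
    obtain ⟨m, hm⟩ := Function.ne_iff.mp hw
    obtain ⟨k, n, hkn⟩ : ∃ k n, biv l w k n ≠ 0 := by
      by_contra! hcon
      exact hb (funext fun m => funext (hcon m))
    obtain ⟨x, hx⟩ := exists_re_mul_osc_ne_zero hb'.1 (mul_ne_zero hm hkn)
    have hs : sig k ≠ 0 := fun h0 => by simpa [h0] using sig_mul_self k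
    have := congrFun (congrFun (congrFun (congrFun h x) k) m) n
    simp only [waveConnection, Pi.zero_apply, mul_eq_zero, hs, hx] at this
    norm_num at this
  · intro h
    funext x k m n
    simp [waveConnection, h]

lemma exists_rad_osc_ne_zero_iff (l : Fin 4 → ℝ) (w : Fin 4 → ℂ) :
    (∃ x, rad l w (osc (2 • l) x) ≠ 0) ↔ biv l w ≠ 0 := by
  constructor
  · rintro ⟨x, hx⟩ hb
    apply hx
    apply Subtype.ext
    funext k j m n
    simp [rad_apply, hb]
  · intro hb
    have hb' := hb
    rw [Ne, biv_eq_zero_iff, not_not] at hb'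
    obtain ⟨k, n, hkn⟩ : ∃ k n, biv l w k n ≠ 0 := by
      by_contra! hcon
      exact hb (funext fun m => funext (hcon m))
    -- The component with index pairs (k,n),(k,n) has the nonzero amplitude F_{kn}².
    obtain ⟨x, hx⟩ := exists_re_mul_osc_ne_zero hb'.1 (mul_ne_zero hkn hkn)
    refine ⟨x, fun h0 => hx ?_⟩
    have := congrFun (congrFun (congrFun (congrFun (congrArg Subtype.val h0) k) n) k) n
    have hs : sig k ≠ 0 := fun h0 => by simpa [h0] using sig_mul_self k
    rw [rad_apply] at this
    rw [mul_comm, ← mul_assoc]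
    exact (mul_eq_zero.1 this).resolve_left hs

/-! ### Change of frame -/

lemma sum_two_mul_sum_two (f g : Fin 4 → Fin 4 → ℂ) :
    (∑ k, ∑ l, f k l) * (∑ m, ∑ n, g m n) = ∑ k, ∑ l, ∑ m, ∑ n, f k l * g m n := by
  simp only [Finset.sum_mul]
  refine Finset.sum_congr rfl fun k _ => Finset.sum_congr rfl fun l _ => ?_
  simp only [Finset.mul_sum]

lemma sum_comm_two_two (F : Fin 4 → Fin 4 → Fin 4 → Fin 4 → ℂ) :
    ∑ a, ∑ b, ∑ k, ∑ l, F a b k l = ∑ k, ∑ l, ∑ a, ∑ b, F a b k l := by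
  have h := Finset.sum_comm (s := (Finset.univ : Finset (Fin 4 × Fin 4)))
    (t := (Finset.univ : Finset (Fin 4 × Fin 4))) (f := fun x y => F x.1 x.2 y.1 y.2)
  simpa only [Fintype.sum_prod_type] using h

lemma sum_prod_four_complex (f g h i : Fin 4 → ℂ) :
    (∑ p, f p) * (∑ p, g p) * (∑ p, h p) * (∑ p, i p) =
      ∑ p₁, ∑ p₂, ∑ p₃, ∑ p₄, f p₁ * g p₂ * h p₃ * i p₄ := by
  simp only [← Finset.mul_sum, ← Finset.sum_mul]

lemma sum_comm_four_complex (F : Fin 4 → Fin 4 → Fin 4 → Fin 4 → Fin 4 → Fin 4 → Fin 4 → Fin 4 → ℂ) :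
    ∑ k, ∑ l, ∑ m, ∑ n, ∑ p₁, ∑ p₂, ∑ p₃, ∑ p₄, F k l m n p₁ p₂ p₃ p₄ =
      ∑ p₁, ∑ p₂, ∑ p₃, ∑ p₄, ∑ k, ∑ l, ∑ m, ∑ n, F k l m n p₁ p₂ p₃ p₄ := by
  have h := Finset.sum_comm (s := (Finset.univ : Finset (Fin 4 × Fin 4 × Fin 4 × Fin 4)))
    (t := (Finset.univ : Finset (Fin 4 × Fin 4 × Fin 4 × Fin 4)))
    (f := fun x y => F x.1 x.2.1 x.2.2.1 x.2.2.2 y.1 y.2.1 y.2.2.1 y.2.2.2)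
  simpa only [Fintype.sum_prod_type] using h

/-- The components of the endomorphism `F^k_j` in the frame `e`. -/
def endoInFrame (F : Fin 4 → Fin 4 → ℂ) (e : Mat4) (a b : Fin 4) : ℂ :=
  ∑ k, ∑ j, (e⁻¹ a k : ℂ) * e j b * (sig k * F k j)

/-- The components of the 2-form `F_{mn}` in the frame `e`. -/
def formInFrame (F : Fin 4 → Fin 4 → ℂ) (e : Mat4) (c d : Fin 4) : ℂ :=
  ∑ m, ∑ n, (e m c : ℂ) * e n d * F m n

lemma inFrame_rad_apply (l : Fin 4 → ℝ) (w : Fin 4 → ℂ) (e : Mat4) (z : ℂ) (a b c d : Fin 4) :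
    (inFrame e (rad l w z)).1 a b c d =
      (z * endoInFrame (biv l w) e a b * formInFrame (biv l w) e c d).re := by
  rw [mul_assoc, endoInFrame, formInFrame, sum_two_mul_sum_two]
  simp only [Finset.mul_sum, Complex.re_sum]
  change ∑ k, ∑ j, ∑ m, ∑ n, e⁻¹ a k * e j b * e m c * e n d * (rad l w z).1 k j m n = _
  refine Finset.sum_congr rfl fun k _ => Finset.sum_congr rfl fun j _ =>
    Finset.sum_congr rfl fun m _ => Finset.sum_congr rfl fun n _ => ?_
  rw [rad_apply, ← mul_assoc, ← Complex.re_ofReal_mul]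
  congr 1
  push_cast
  ring

/-- `L` is a Lorentz transformation. -/
def IsLorentz (L : Mat4) : Prop := Lᵀ * eta * L = eta

lemma IsLorentz.inv_eq {L : Mat4} (h : IsLorentz L) : L⁻¹ = eta * Lᵀ * eta := by
  apply Matrix.inv_eq_left_inv
  rw [Matrix.mul_assoc, Matrix.mul_assoc, ← Matrix.mul_assoc Lᵀ, h, eta_mul_eta]

lemma IsLorentz.mul_eta_mul_transpose {L : Mat4} (h : IsLorentz L) : L * eta * Lᵀ = eta := by
  have h1 : (eta * Lᵀ * eta) * L = 1 := by
    rw [Matrix.mul_assoc, Matrix.mul_assoc, ← Matrix.mul_assoc Lᵀ, h, eta_mul_eta]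
  have h2 := mul_eq_one_comm.1 h1
  calc L * eta * Lᵀ = L * (eta * Lᵀ * eta) * eta := by
        simp only [Matrix.mul_assoc, eta_mul_eta, Matrix.mul_one]
    _ = eta := by rw [h2, Matrix.one_mul]

lemma eta_mul_mul_eta_apply (M : Mat4) (a b : Fin 4) :
    (eta * M * eta) a b = sig a * M a b * sig b := by
  have h : eta = Matrix.diagonal sig := rfl
  rw [h, Matrix.mul_diagonal, Matrix.diagonal_mul]

lemma IsLorentz.inv_apply {L : Mat4} (h : IsLorentz L) (a k : Fin 4) :
    L⁻¹ a k = sig a * L k a * sig k := by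
  rw [h.inv_eq, eta_mul_mul_eta_apply, Matrix.transpose_apply]

/-- Pull back of a covector. -/
def pullReal (L : Mat4) (l : Fin 4 → ℝ) : Fin 4 → ℝ := fun a => ∑ k, L k a * l k

/-- Pull back of a complex covector. -/
def pull (L : Mat4) (w : Fin 4 → ℂ) : Fin 4 → ℂ := fun a => ∑ k, (L k a : ℂ) * w k

lemma formInFrame_biv (l : Fin 4 → ℝ) (w : Fin 4 → ℂ) (L : Mat4) :
    formInFrame (biv l w) L = biv (pullReal L l) (pull L w) := by
  funext c d
  simp only [formInFrame, biv, pullReal, pull, Complex.ofReal_sum, Complex.ofReal_mul,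
    Finset.sum_mul_sum]
  rw [Finset.sum_comm (f := fun i j => (L i d : ℂ) * l i * (L j c * w j))]
  simp only [← Finset.sum_sub_distrib, Finset.mul_sum]
  refine Finset.sum_congr rfl fun k _ => Finset.sum_congr rfl fun j _ => ?_
  ring

lemma IsLorentz.endoInFrame {L : Mat4} (h : IsLorentz L) (F : Fin 4 → Fin 4 → ℂ) (a b : Fin 4) :
    endoInFrame F L a b = sig a * formInFrame F L a b := by
  simp only [TorsionWave.endoInFrame, formInFrame, h.inv_apply, Finset.mul_sum]
  refine Finset.sum_congr rfl fun k _ => Finset.sum_congr rfl fun j _ => ?_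
  have : (sig k : ℂ) * sig k = 1 := by exact_mod_cast sig_mul_self k
  push_cast
  linear_combination (sig a : ℂ) * L k a * L j b * F k j * this

/-- In a Lorentz frame raising an index commutes with the change of frame, so both factors of F⊗F
are pulled back as 2-forms, and a pulled-back wedge is the wedge of the pull backs. -/
lemma IsLorentz.inFrame_rad {L : Mat4} (h : IsLorentz L) (l : Fin 4 → ℝ) (w : Fin 4 → ℂ) (z : ℂ) :
    inFrame L (rad l w z) = rad (pullReal L l) (pull L w) z := by
  apply Subtype.ext
  funext a b c d
  rw [inFrame_rad_apply, h.endoInFrame, formInFrame_biv, rad_apply, ← Complex.re_ofReal_mul]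
  congr 1
  ring

lemma rad_eq_of_biv_eq {l l' : Fin 4 → ℝ} {w w' : Fin 4 → ℂ} {κ : ℂ}
    (h : biv l w = κ • biv l' w') (z : ℂ) : rad l w z = rad l' w' (κ ^ 2 * z) := by
  apply Subtype.ext
  funext a b c d
  rw [rad_apply, rad_apply, h]
  congr 2
  simp only [Pi.smul_apply, smul_eq_mul]
  ring

/-! ### Contraction of a curvature tensor with F⊗F -/

/-- The contraction `F_k^j F^{mn} Q^k_{jmn}`. -/
def contract (F : Fin 4 → Fin 4 → ℂ) (Q : CurvSpace) : ℂ :=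
  ∑ k, ∑ j, ∑ m, ∑ n, F k j * sig j * (sig m * F m n * sig n) * (Q.1 k j m n : ℂ)

lemma IsLorentz.sum_raise {L : Mat4} (h : IsLorentz L) (j k : Fin 4) :
    ∑ a, (sig a : ℂ) * L j a * L k a = if j = k then (sig j : ℂ) else 0 := by
  have h1 := congrFun (congrFun h.mul_eta_mul_transpose j) k
  rw [eta_apply] at h1
  have h2 : (L * eta * Lᵀ) j k = ∑ a, sig a * L j a * L k a := by
    have hd : eta = Matrix.diagonal sig := rfl
    rw [Matrix.mul_apply]
    refine Finset.sum_congr rfl fun a _ => ?_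
    rw [hd, Matrix.mul_diagonal, Matrix.transpose_apply]
    ring
  rw [h2] at h1
  have := congrArg (fun r : ℝ => (r : ℂ)) h1
  push_cast at this
  rw [this]
  split_ifs <;> simp

lemma IsLorentz.sum_raise_formInFrame {L : Mat4} (h : IsLorentz L) (F : Fin 4 → Fin 4 → ℂ)
    (m n : Fin 4) :
    ∑ c, ∑ d, (sig c * formInFrame F L c d * sig d) * (L m c * L n d) = sig m * F m n * sig n := by
  have h1 : ∀ c d, (sig c * formInFrame F L c d * sig d : ℂ) * (L m c * L n d) =
      ∑ p, ∑ r, F p r * ((sig c : ℂ) * L p c * L m c) * ((sig d : ℂ) * L r d * L n d) := by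
    intro c d
    simp only [formInFrame, Finset.mul_sum, Finset.sum_mul]
    refine Finset.sum_congr rfl fun k _ => Finset.sum_congr rfl fun j _ => ?_
    ring
  simp only [h1]
  rw [sum_comm_two_two]
  have h2 : ∀ p r, ∑ c, ∑ d, F p r * ((sig c : ℂ) * L p c * L m c) *
      ((sig d : ℂ) * L r d * L n d) =
      F p r * (if p = m then (sig p : ℂ) else 0) * (if r = n then (sig r : ℂ) else 0) := by
    intro p r
    rw [← h.sum_raise, ← h.sum_raise, mul_assoc, Finset.sum_mul_sum, Finset.mul_sum]
    refine Finset.sum_congr rfl fun c _ => ?_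
    rw [Finset.mul_sum]
    refine Finset.sum_congr rfl fun d _ => ?_
    ring
  simp only [h2, mul_ite, ite_mul, mul_zero, zero_mul, Finset.sum_ite_eq', Finset.mem_univ, if_true]
  ring

lemma IsLorentz.contract_inFrame {L : Mat4} (h : IsLorentz L) (F : Fin 4 → Fin 4 → ℂ)
    (Q : CurvSpace) : contract (formInFrame F L) (inFrame L Q) = contract F Q := by
  have e1 : ∀ k j, ∑ a, ∑ b, formInFrame F L a b * sig b * ((L⁻¹ a k : ℂ) * L j b) =
      F k j * sig j := by
    intro k j
    have := h.sum_raise_formInFrame F k j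
    have hk : (sig k : ℂ) * sig k = 1 := by exact_mod_cast sig_mul_self k
    calc _ = sig k * ∑ c, ∑ d, (sig c * formInFrame F L c d * sig d : ℂ) * (L k c * L j d) := by
          simp only [Finset.mul_sum]
          refine Finset.sum_congr rfl fun a _ => Finset.sum_congr rfl fun b _ => ?_
          rw [h.inv_apply]
          push_cast
          ring
      _ = _ := by
          rw [this]
          linear_combination F k j * sig j * hk
  have e2 : ∀ a b c d, formInFrame F L a b * sig b * (sig c * formInFrame F L c d * sig d) *
      ((inFrame L Q).1 a b c d : ℂ) = ∑ k, ∑ j, ∑ m, ∑ n,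
      (formInFrame F L a b * sig b * ((L⁻¹ a k : ℂ) * L j b)) *
      ((sig c * formInFrame F L c d * sig d) * (L m c * L n d)) * (Q.1 k j m n : ℂ) := by
    intro a b c d
    simp only [inFrame, Complex.ofReal_sum, Finset.mul_sum]
    refine Finset.sum_congr rfl fun k _ => Finset.sum_congr rfl fun j _ =>
      Finset.sum_congr rfl fun m _ => Finset.sum_congr rfl fun n _ => ?_
    push_cast
    ring
  simp only [contract, e2]
  rw [sum_comm_four_complex]
  refine Finset.sum_congr rfl fun k _ => Finset.sum_congr rfl fun j _ =>
    Finset.sum_congr rfl fun m _ => Finset.sum_congr rfl fun n _ => ?_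
  rw [← e1 k j, ← h.sum_raise_formInFrame F m n, sum_two_mul_sum_two]
  simp only [Finset.sum_mul]

lemma contract_smul (κ : ℂ) (F : Fin 4 → Fin 4 → ℂ) (Q : CurvSpace) :
    contract (κ • F) Q = κ ^ 2 * contract F Q := by
  simp only [contract, Finset.mul_sum]
  refine Finset.sum_congr rfl fun k _ => Finset.sum_congr rfl fun j _ =>
    Finset.sum_congr rfl fun m _ => Finset.sum_congr rfl fun n _ => ?_
  simp only [Pi.smul_apply, smul_eq_mul]
  ring

lemma contract_star (F : Fin 4 → Fin 4 → ℂ) (Q : CurvSpace) :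
    contract (star F) Q = star (contract F Q) := by
  simp only [contract, star_sum]
  refine Finset.sum_congr rfl fun k _ => Finset.sum_congr rfl fun j _ =>
    Finset.sum_congr rfl fun m _ => Finset.sum_congr rfl fun n _ => ?_
  simp [Complex.conj_ofReal]

/-! ### Functionals on curvature tensors which transform by a character -/

/-- The curvature tensor `v ⊗ α ⊗ (β ∧ γ)`. -/
def elem (v α β γ : Fin 4 → ℝ) : CurvSpace :=
  ⟨fun k j m n => v k * α j * (β m * γ n - γ m * β n), by
    intro k j m n
    ring⟩

lemma sum_smul_elem_single (c : Tensor4) (p q r s : Fin 4) :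
    (∑ k, ∑ j, ∑ m, ∑ n, c k j m n •
      elem (Pi.single k 1) (Pi.single j 1) (Pi.single m 1) (Pi.single n 1)).1 p q r s =
      c p q r s - c p q s r := by
  simp only [elem, Submodule.coe_sum, Submodule.coe_smul, Finset.sum_apply, Pi.smul_apply,
    smul_eq_mul, Pi.single_apply]
  have h : ∀ k j, ∑ m, ∑ n, c k j m n * ((if p = k then (1 : ℝ) else 0) * (if q = j then 1 else 0) *
      ((if r = m then 1 else 0) * (if s = n then 1 else 0) -
        (if r = n then 1 else 0) * (if s = m then 1 else 0))) =
      (if p = k then (1 : ℝ) else 0) * (if q = j then 1 else 0) * (c k j r s - c k j s r) := by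
    intro k j
    have : ∀ m n, c k j m n * ((if p = k then (1 : ℝ) else 0) * (if q = j then 1 else 0) *
      ((if r = m then 1 else 0) * (if s = n then 1 else 0) -
        (if r = n then 1 else 0) * (if s = m then 1 else 0))) =
      (if p = k then (1 : ℝ) else 0) * (if q = j then 1 else 0) *
        (c k j m n * (if r = m then 1 else 0) * (if s = n then 1 else 0)) -
      (if p = k then (1 : ℝ) else 0) * (if q = j then 1 else 0) *
        (c k j m n * (if r = n then 1 else 0) * (if s = m then 1 else 0)) := by
      intro m n
      ring
    simp only [this, Finset.sum_sub_distrib, ← Finset.mul_sum]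
    rw [mul_sub]
    simp
  simp only [h]
  simp

/-- The factor ½ appears because each antisymmetric pair (m,n) occurs twice in the sum. -/
lemma eq_half_sum_smul_elem (Q : CurvSpace) : Q = ∑ k, ∑ j, ∑ m, ∑ n, (1 / 2 * Q.1 k j m n) •
    elem (Pi.single k 1) (Pi.single j 1) (Pi.single m 1) (Pi.single n 1) := by
  apply Subtype.ext
  funext p q r s
  rw [sum_smul_elem_single (fun k j m n => 1 / 2 * Q.1 k j m n), Q.2 p q s r]
  ring

lemma elem_eq_sum (v α β γ : Fin 4 → ℝ) : elem v α β γ =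
    ∑ k, ∑ j, ∑ m, ∑ n, (v k * α j * β m * γ n) •
      elem (Pi.single k 1) (Pi.single j 1) (Pi.single m 1) (Pi.single n 1) := by
  apply Subtype.ext
  funext p q r s
  rw [sum_smul_elem_single (fun k j m n => v k * α j * β m * γ n)]
  simp only [elem]
  ring

lemma inFrame_elem (e : Mat4) (v α β γ : Fin 4 → ℝ) : inFrame e (elem v α β γ) =
    elem (fun a => ∑ k, e⁻¹ a k * v k) (pullReal e α) (pullReal e β) (pullReal e γ) := by
  apply Subtype.ext
  funext a b c d
  have h := sum_prod_four (fun k => e⁻¹ a k * v k) (fun j => e j b * α j) (fun m => e m c * β m)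
    (fun n => e n d * γ n) 1
  have h' := sum_prod_four (fun k => e⁻¹ a k * v k) (fun j => e j b * α j) (fun m => e m c * γ m)
    (fun n => e n d * β n) 1
  have e1 : (elem (fun a => ∑ k, e⁻¹ a k * v k) (pullReal e α) (pullReal e β)
      (pullReal e γ)).1 a b c d = (∑ k, e⁻¹ a k * v k) * (∑ j, e j b * α j) *
        (∑ m, e m c * β m) * (∑ n, e n d * γ n) * 1 - (∑ k, e⁻¹ a k * v k) * (∑ j, e j b * α j) *
        (∑ m, e m c * γ m) * (∑ n, e n d * β n) * 1 := by
    simp only [elem, pullReal]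
    ring
  rw [e1, h, h']
  change ∑ k, ∑ j, ∑ m, ∑ n, e⁻¹ a k * e j b * e m c * e n d * (elem v α β γ).1 k j m n = _
  simp only [← Finset.sum_sub_distrib]
  refine Finset.sum_congr rfl fun k _ => Finset.sum_congr rfl fun j _ =>
    Finset.sum_congr rfl fun m _ => Finset.sum_congr rfl fun n _ => ?_
  simp only [elem]
  ring

/-- The components of a functional on curvature tensors. -/
def comps (Λ : CurvSpace →ₗ[ℝ] ℂ) (k j m n : Fin 4) : ℂ :=
  Λ (elem (Pi.single k 1) (Pi.single j 1) (Pi.single m 1) (Pi.single n 1))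

lemma comps_antisymm (Λ : CurvSpace →ₗ[ℝ] ℂ) (k j m n : Fin 4) :
    comps Λ k j m n = -comps Λ k j n m := by
  rw [comps, comps, ← map_neg]
  congr 1
  apply Subtype.ext
  funext p q r s
  simp only [elem, Submodule.coe_neg, Pi.neg_apply]
  ring

lemma apply_eq_sum_comps (Λ : CurvSpace →ₗ[ℝ] ℂ) (Q : CurvSpace) :
    Λ Q = ∑ k, ∑ j, ∑ m, ∑ n, (1 / 2 * (Q.1 k j m n : ℂ)) * comps Λ k j m n := by
  conv_lhs => rw [eq_half_sum_smul_elem Q]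
  simp only [map_sum, map_smul, comps, Complex.real_smul]
  push_cast
  rfl

lemma apply_elem (Λ : CurvSpace →ₗ[ℝ] ℂ) (v α β γ : Fin 4 → ℝ) : Λ (elem v α β γ) =
    ∑ k, ∑ j, ∑ m, ∑ n, ((v k : ℂ) * α j * β m * γ n) * comps Λ k j m n := by
  rw [elem_eq_sum]
  simp only [map_sum, map_smul, comps, Complex.real_smul]
  push_cast
  rfl

/-- The value of a functional with components `E` on the complex tensor
`α^♯ ⊗ β ⊗ γ ⊗ δ`. -/
def form4 (E : Fin 4 → Fin 4 → Fin 4 → Fin 4 → ℂ) (α β γ δ : Fin 4 → ℂ) : ℂ :=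
  ∑ k, ∑ j, ∑ m, ∑ n, (sig k * α k) * β j * γ m * δ n * E k j m n

lemma form4_sum (E : Fin 4 → Fin 4 → Fin 4 → Fin 4 → ℂ) (θ : Fin 4 → Fin 4 → ℂ)
    (p q r s : Fin 4 → ℂ) :
    form4 E (fun i => ∑ a, p a * θ a i) (fun i => ∑ a, q a * θ a i) (fun i => ∑ a, r a * θ a i)
      (fun i => ∑ a, s a * θ a i) =
    ∑ a, ∑ b, ∑ c, ∑ d, p a * q b * r c * s d * form4 E (θ a) (θ b) (θ c) (θ d) := by
  simp only [form4]
  conv_rhs =>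
    simp only [Finset.mul_sum]
    rw [sum_comm_four_complex]
  refine Finset.sum_congr rfl fun k _ => Finset.sum_congr rfl fun j _ =>
    Finset.sum_congr rfl fun m _ => Finset.sum_congr rfl fun n _ => ?_
  rw [Finset.mul_sum _ _ (sig k : ℂ), sum_prod_four_complex]
  simp only [Finset.sum_mul]
  refine Finset.sum_congr rfl fun a _ => Finset.sum_congr rfl fun b _ =>
    Finset.sum_congr rfl fun c _ => Finset.sum_congr rfl fun d _ => ?_
  ring

/-- `Λ` transforms under `L` by the factor `χ`. -/
def IsCovariant (Λ : CurvSpace →ₗ[ℝ] ℂ) (L : Mat4) (χ : ℂ) : Prop :=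
  ∀ Q, Λ Q = χ * Λ (inFrame L Q)

lemma IsCovariant.comps {Λ : CurvSpace →ₗ[ℝ] ℂ} {L : Mat4} {χ : ℂ} (h : IsCovariant Λ L χ)
    (k j m n : Fin 4) : comps Λ k j m n = χ * ∑ a, ∑ b, ∑ c, ∑ d,
      ((L⁻¹ a k : ℂ) * L j b * L m c * L n d) * comps Λ a b c d := by
  rw [TorsionWave.comps, h, inFrame_elem, apply_elem]
  simp [pullReal, Pi.single_apply]

/-- Covariance passes from real tensors to complex covectors by multilinearity. This makes it
possible to evaluate the functional on the complex eigenvectors of a real Lorentz map. -/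
lemma IsCovariant.form4_eq {Λ : CurvSpace →ₗ[ℝ] ℂ} {L : Mat4} {χ : ℂ} (h : IsCovariant Λ L χ)
    (hL : IsLorentz L) (α β γ δ : Fin 4 → ℂ) : form4 (TorsionWave.comps Λ) α β γ δ =
      χ * form4 (TorsionWave.comps Λ) (pull L α) (pull L β) (pull L γ) (pull L δ) := by
  have e1 : ∀ a, (sig a : ℂ) * pull L α a = ∑ k, (L⁻¹ a k : ℂ) * (sig k * α k) := by
    intro a
    rw [pull, Finset.mul_sum]
    refine Finset.sum_congr rfl fun k _ => ?_
    rw [hL.inv_apply]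
    have : (sig k : ℂ) * sig k = 1 := by exact_mod_cast sig_mul_self k
    push_cast
    linear_combination -(sig a : ℂ) * L k a * α k * this
  calc form4 (TorsionWave.comps Λ) α β γ δ = ∑ k, ∑ j, ∑ m, ∑ n, ∑ a, ∑ b, ∑ c, ∑ d,
        (sig k * α k) * β j * γ m * δ n * (χ *
          (((L⁻¹ a k : ℂ) * L j b * L m c * L n d) * TorsionWave.comps Λ a b c d)) := by
        rw [form4]
        refine Finset.sum_congr rfl fun k _ => Finset.sum_congr rfl fun j _ =>
          Finset.sum_congr rfl fun m _ => Finset.sum_congr rfl fun n _ => ?_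
        rw [h.comps]
        simp only [Finset.mul_sum]
    _ = _ := sum_comm_four_complex _
    _ = _ := by
        simp only [form4, e1]
        simp only [pull]
        simp only [sum_prod_four_complex]
        simp only [Finset.sum_mul]
        simp only [Finset.mul_sum]
        refine Finset.sum_congr rfl fun a _ => Finset.sum_congr rfl fun b _ =>
          Finset.sum_congr rfl fun c _ => Finset.sum_congr rfl fun d _ =>
          Finset.sum_congr rfl fun k _ => Finset.sum_congr rfl fun j _ =>
          Finset.sum_congr rfl fun m _ => Finset.sum_congr rfl fun n _ => ?_
        ring

/-- If the covectors `θ a` span a subspace which is mapped to itself by `L`, with matrix `M`, then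
the values of a covariant functional on them satisfy linear relations. -/
lemma IsCovariant.form4_of_pull {Λ : CurvSpace →ₗ[ℝ] ℂ} {L : Mat4} {χ : ℂ} (h : IsCovariant Λ L χ)
    (hL : IsLorentz L) (θ M : Fin 4 → Fin 4 → ℂ)
    (hM : ∀ a, pull L (θ a) = fun i => ∑ b, M a b * θ b i) (a b c d : Fin 4) :
    form4 (TorsionWave.comps Λ) (θ a) (θ b) (θ c) (θ d) = χ * ∑ a', ∑ b', ∑ c', ∑ d',
      M a a' * M b b' * M c c' * M d d' *
        form4 (TorsionWave.comps Λ) (θ a') (θ b') (θ c') (θ d') := by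
  rw [h.form4_eq hL, hM, hM, hM, hM, form4_sum]

/-! ### The canonical null pair -/

/-- The covector `(1, 0, 0, -1)`. -/
def lightCov : Fin 4 → ℝ := ![1, 0, 0, -1]

/-- The polarization covector `(0, 1, i, 0)`. -/
def polCov : Fin 4 → ℂ := ![0, 1, Complex.I, 0]

/-- A null tetrad of complex covectors. -/
def tetrad : Fin 4 → Fin 4 → ℂ :=
  ![![1, 0, 0, -1], ![1, 0, 0, 1], ![0, 1, Complex.I, 0], ![0, 1, -Complex.I, 0]]

/-- A boost along the third axis, composed with a rotation around it. -/
def boostRotation : Mat4 :=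
  !![5 / 4, 0, 0, -3 / 4; 0, 3 / 5, -4 / 5, 0; 0, 4 / 5, 3 / 5, 0; -3 / 4, 0, 0, 5 / 4]

/-- A null rotation. -/
def nullRotation : Mat4 :=
  !![3 / 2, 1, 0, -1 / 2; 1, 1, 0, -1; 0, 0, 1, 0; 1 / 2, 1, 0, 1 / 2]

lemma isLorentz_boostRotation : IsLorentz boostRotation := by
  ext a b
  fin_cases a <;> fin_cases b <;>
    simp [boostRotation, eta, Matrix.mul_apply, Fin.sum_univ_four, Matrix.diagonal_apply] <;>
    norm_num

lemma isLorentz_nullRotation : IsLorentz nullRotation := by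
  ext a b
  fin_cases a <;> fin_cases b <;>
    simp [nullRotation, eta, Matrix.mul_apply, Fin.sum_univ_four, Matrix.diagonal_apply] <;>
    norm_num

/-- The phase of the rotation in `boostRotation`. -/
def rotPhase : ℂ := 3 / 5 + 4 / 5 * Complex.I

/-- The eigenvalues of `boostRotation` on the null tetrad. -/
def tetradEigenvalue : Fin 4 → ℂ := ![2, 1 / 2, rotPhase, star rotPhase]

/-- The matrix of `nullRotation` in the null tetrad. -/
def nullRotationCoeff : Fin 4 → Fin 4 → ℂ :=
  ![![1, 0, 0, 0], ![1, 1, 1, 1], ![1, 0, 1, 0], ![1, 0, 0, 1]]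

lemma pull_boostRotation (a : Fin 4) : pull boostRotation (tetrad a) =
    fun i => ∑ b, (if a = b then tetradEigenvalue a else 0) * tetrad b i := by
  funext i
  simp only [ite_mul, zero_mul, Finset.sum_ite_eq, Finset.mem_univ, if_true]
  fin_cases a <;> fin_cases i <;>
    simp [pull, boostRotation, tetrad, tetradEigenvalue, rotPhase, Fin.sum_univ_four,
      Complex.ext_iff] <;> norm_num

lemma pull_nullRotation (a : Fin 4) : pull nullRotation (tetrad a) =
    fun i => ∑ b, nullRotationCoeff a b * tetrad b i := by
  funext i
  fin_cases a <;> fin_cases i <;>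
    simp [pull, nullRotation, tetrad, nullRotationCoeff, Fin.sum_univ_four, Complex.ext_iff] <;>
    norm_num

/-- Boost weights of the null tetrad. -/
def boostWeight : Fin 4 → ℤ := ![1, -1, 0, 0]

/-- Rotation weights of the null tetrad. -/
def rotWeight : Fin 4 → ℤ := ![0, 0, 1, -1]

lemma rotPhase_mul_star : rotPhase * star rotPhase = 1 := by
  simp [rotPhase, Complex.ext_iff]
  norm_num

lemma rotPhase_ne_zero : rotPhase ≠ 0 := fun h => by
  simpa [h] using rotPhase_mul_star

lemma norm_rotPhase : ‖rotPhase‖ = 1 := by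
  have h : ‖rotPhase‖ * ‖rotPhase‖ = 1 := by
    have := congrArg norm rotPhase_mul_star
    rwa [norm_mul, norm_star, norm_one] at this
  nlinarith [norm_nonneg rotPhase]

lemma tetradEigenvalue_eq (a : Fin 4) :
    tetradEigenvalue a = (2 : ℂ) ^ boostWeight a * rotPhase ^ rotWeight a := by
  have h : star rotPhase = rotPhase⁻¹ := eq_inv_of_mul_eq_one_right rotPhase_mul_star
  fin_cases a <;> simp [tetradEigenvalue, boostWeight, rotWeight, h]

lemma rotPhase_sq_ne_one : rotPhase ^ (2 : ℤ) ≠ 1 := by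
  intro h
  have h1 := congrArg Complex.im h
  rw [show (2 : ℤ) = ((2 : ℕ) : ℤ) by rfl, zpow_natCast, pow_two] at h1
  simp [rotPhase] at h1
  norm_num at h1

lemma rotPhase_pow_four_ne_one : rotPhase ^ (4 : ℤ) ≠ 1 := by
  intro h
  have h1 := congrArg Complex.im h
  rw [show (4 : ℤ) = ((4 : ℕ) : ℤ) by rfl, zpow_natCast, show 4 = 2 * 2 by rfl, pow_mul, pow_two,
    pow_two] at h1
  simp [rotPhase] at h1
  norm_num at h1

/-- The boost eigenvalues are powers of 2 and the rotation eigenvalues have norm 1, so taking norms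
determines the boost weight. Boost weight -2 leaves only rotation weights -2, 0 and 2; the last two
are excluded because the square and the fourth power of `rotPhase` differ from 1. -/
lemma weights_of_eigenvalue_eq_one (a b c d : Fin 4)
    (h : 4 * rotPhase ^ 2 * (tetradEigenvalue a * tetradEigenvalue b * tetradEigenvalue c *
      tetradEigenvalue d) = 1) :
    boostWeight a + boostWeight b + boostWeight c + boostWeight d = -2 ∧
      rotWeight a + rotWeight b + rotWeight c + rotWeight d = -2 := by
  set s := boostWeight a + boostWeight b + boostWeight c + boostWeight d with hs
  set t := rotWeight a + rotWeight b + rotWeight c + rotWeight d with ht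
  have h2 : (2 : ℂ) ≠ 0 := two_ne_zero
  have hr := rotPhase_ne_zero
  have h1 : (2 : ℂ) ^ (s + 2) * rotPhase ^ (t + 2) = 1 := by
    rw [← h, tetradEigenvalue_eq, tetradEigenvalue_eq, tetradEigenvalue_eq, tetradEigenvalue_eq,
      hs, ht]
    simp only [zpow_add₀ h2, zpow_add₀ hr]
    norm_cast
    push_cast
    ring
  have hn := congrArg norm h1
  rw [norm_mul, norm_zpow, norm_zpow, norm_rotPhase, one_zpow, mul_one, norm_one,
    Complex.norm_ofNat] at hn
  have hs2 : s + 2 = 0 := (zpow_eq_one_iff_right₀ (by norm_num) (by norm_num)).1 hn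
  refine ⟨by omega, ?_⟩
  rw [hs2, zpow_zero, one_mul] at h1
  have hcases : ∀ a b c d : Fin 4,
      boostWeight a + boostWeight b + boostWeight c + boostWeight d + 2 = 0 →
      rotWeight a + rotWeight b + rotWeight c + rotWeight d = -2 ∨
      rotWeight a + rotWeight b + rotWeight c + rotWeight d = 0 ∨
      rotWeight a + rotWeight b + rotWeight c + rotWeight d = 2 := by decide
  rcases hcases a b c d hs2 with h3 | h3 | h3
  · exact h3
  · rw [← ht] at h3
    rw [h3] at h1
    exact absurd h1 rotPhase_sq_ne_one
  · rw [← ht] at h3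
    rw [h3] at h1
    exact absurd h1 rotPhase_pow_four_ne_one

lemma weights_cases : ∀ a b c d : Fin 4,
    boostWeight a + boostWeight b + boostWeight c + boostWeight d = -2 ∧
      rotWeight a + rotWeight b + rotWeight c + rotWeight d = -2 →
    (a, b, c, d) ∈ [((1, 1, 3, 3) : Fin 4 × Fin 4 × Fin 4 × Fin 4), (3, 3, 1, 1), (1, 3, 1, 3),
      (1, 3, 3, 1), (3, 1, 1, 3), (3, 1, 3, 1)] := by decide

/-- The antisymmetric symbol on the pair of indices `1`, `3`. -/
def alt13 (a b : Fin 4) : ℤ :=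
  if a = 1 ∧ b = 3 then 1 else if a = 3 ∧ b = 1 then -1 else 0

lemma alt13_mul_eq_zero : ∀ a b c d : Fin 4,
    ¬ (boostWeight a + boostWeight b + boostWeight c + boostWeight d = -2 ∧
      rotWeight a + rotWeight b + rotWeight c + rotWeight d = -2) →
    alt13 a b * alt13 c d = 0 := by decide

/-- The boost-rotation kills all tetrad components except those of weights (-2,-2), in which the
indices 1 and 3 each occur twice. Antisymmetry in the last pair leaves two independent values, and
the null rotation relates them. -/
lemma form4_tetrad {Λ : CurvSpace →ₗ[ℝ] ℂ}
    (h1 : IsCovariant Λ boostRotation (4 * rotPhase ^ 2)) (h2 : IsCovariant Λ nullRotation 1)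
    (a b c d : Fin 4) :
    form4 (comps Λ) (tetrad a) (tetrad b) (tetrad c) (tetrad d) =
      form4 (comps Λ) (tetrad 1) (tetrad 3) (tetrad 1) (tetrad 3) *
        ((alt13 a b * alt13 c d : ℤ) : ℂ) := by
  set V : Fin 4 → Fin 4 → Fin 4 → Fin 4 → ℂ := fun a b c d =>
    form4 (comps Λ) (tetrad a) (tetrad b) (tetrad c) (tetrad d) with hV
  have hzero : ∀ a b c d, ¬ (boostWeight a + boostWeight b + boostWeight c + boostWeight d = -2 ∧
      rotWeight a + rotWeight b + rotWeight c + rotWeight d = -2) → V a b c d = 0 := by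
    intro a b c d hw
    have h := h1.form4_of_pull isLorentz_boostRotation tetrad _ pull_boostRotation a b c d
    simp only [ite_mul, mul_ite, zero_mul, mul_zero, Finset.sum_ite_eq, Finset.mem_univ,
      if_true] at h
    by_contra hne
    refine hw (weights_of_eigenvalue_eq_one a b c d ?_)
    exact mul_right_cancel₀ hne (by rw [one_mul]; simp only [hV]; linear_combination -h)
  have hanti : ∀ a b c d, V a b c d = -V a b d c := by
    intro a b c d
    simp only [hV, form4, ← Finset.sum_neg_distrib]
    refine Finset.sum_congr rfl fun k _ => Finset.sum_congr rfl fun j _ => ?_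
    rw [Finset.sum_comm]
    refine Finset.sum_congr rfl fun m _ => Finset.sum_congr rfl fun n _ => ?_
    rw [comps_antisymm Λ k j n m]
    ring
  have hself : ∀ a b c, V a b c c = 0 := fun a b c => by
    have := hanti a b c c
    linear_combination (1 / 2) * this
  -- The component (1,1,1,3) has the wrong weight and is zero. Expanding its image under the null
  -- rotation, only (1,3,1,3) and (3,1,1,3) survive, each with coefficient 1, so their sum is zero.
  have hsymm : V 3 1 1 3 = -V 1 3 1 3 := by
    have h : V 1 1 1 3 = 1 * ∑ a', ∑ b', ∑ c', ∑ d', nullRotationCoeff 1 a' *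
        nullRotationCoeff 1 b' * nullRotationCoeff 1 c' * nullRotationCoeff 3 d' * V a' b' c' d' :=
      h2.form4_of_pull isLorentz_nullRotation tetrad _ pull_nullRotation 1 1 1 3
    have hz : ∀ a b c d, (boostWeight a + boostWeight b + boostWeight c + boostWeight d = -2 ∧
        rotWeight a + rotWeight b + rotWeight c + rotWeight d = -2) ∨ V a b c d = 0 :=
      fun a b c d => or_iff_not_imp_left.2 (hzero a b c d)
    have h0 : V 1 1 1 3 = 0 := hzero _ _ _ _ (by decide)
    have hs : ∀ a' b' c' d', nullRotationCoeff 1 a' *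
        nullRotationCoeff 1 b' * nullRotationCoeff 1 c' * nullRotationCoeff 3 d' * V a' b' c' d' =
        (if (a', b', c', d') = (1, 3, 1, 3) then V 1 3 1 3 else 0) +
        (if (a', b', c', d') = (3, 1, 1, 3) then V 3 1 1 3 else 0) := by
      intro a' b' c' d'
      by_cases hw : boostWeight a' + boostWeight b' + boostWeight c' + boostWeight d' = -2 ∧
        rotWeight a' + rotWeight b' + rotWeight c' + rotWeight d' = -2
      · have := weights_cases a' b' c' d' hw
        simp only [List.mem_cons, Prod.mk.injEq, List.not_mem_nil, or_false] at this
        rcases this with ⟨rfl, rfl, rfl, rfl⟩ | ⟨rfl, rfl, rfl, rfl⟩ | ⟨rfl, rfl, rfl, rfl⟩ |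
          ⟨rfl, rfl, rfl, rfl⟩ | ⟨rfl, rfl, rfl, rfl⟩ | ⟨rfl, rfl, rfl, rfl⟩ <;>
          simp [nullRotationCoeff, hself]
      · rw [hzero _ _ _ _ hw, if_neg, if_neg]
        · simp
        · rintro ⟨⟩
          exact hw (by decide)
        · rintro ⟨⟩
          exact hw (by decide)
    simp only [hs, h0] at h
    simp [Finset.sum_add_distrib, Prod.mk.injEq, ite_and] at h
    linear_combination -h
  change V a b c d = V 1 3 1 3 * _
  by_cases hw : boostWeight a + boostWeight b + boostWeight c + boostWeight d = -2 ∧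
    rotWeight a + rotWeight b + rotWeight c + rotWeight d = -2
  · have := weights_cases a b c d hw
    simp only [List.mem_cons, Prod.mk.injEq, List.not_mem_nil, or_false] at this
    rcases this with ⟨rfl, rfl, rfl, rfl⟩ | ⟨rfl, rfl, rfl, rfl⟩ | ⟨rfl, rfl, rfl, rfl⟩ |
      ⟨rfl, rfl, rfl, rfl⟩ | ⟨rfl, rfl, rfl, rfl⟩ | ⟨rfl, rfl, rfl, rfl⟩
    · simp [alt13, hself]
    · simp [alt13, hself]
    · simp [alt13]
    · simp [alt13, hanti 1 3 3 1]
    · simp [alt13, hsymm]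
    · simp [alt13, hanti 3 1 3 1, hsymm]
  · rw [hzero _ _ _ _ hw, alt13_mul_eq_zero _ _ _ _ hw]
    simp

/-- The coordinates of the standard basis covectors in the null tetrad. -/
def tetradCoord : Fin 4 → Fin 4 → ℂ :=
  ![![1 / 2, 1 / 2, 0, 0], ![0, 0, 1 / 2, 1 / 2], ![0, 0, -Complex.I / 2, Complex.I / 2],
    ![-1 / 2, 1 / 2, 0, 0]]

lemma single_eq_sum_tetrad (k : Fin 4) : (Pi.single k 1 : Fin 4 → ℂ) =
    fun i => ∑ a, tetradCoord k a * tetrad a i := by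
  funext i
  fin_cases k <;> fin_cases i <;>
    simp [tetradCoord, tetrad, Fin.sum_univ_four, Complex.ext_iff] <;> norm_num

/-- The index pair 1, 3 of the tetrad represents, up to a constant, the canonical bivector with both
indices raised. The surviving components of a covariant functional are thus those of F⊗F. -/
lemma sum_alt13 (k j : Fin 4) : ∑ a, ∑ b, tetradCoord k a * tetradCoord j b * (alt13 a b : ℂ) =
    -Complex.I / 4 * (sig k * biv lightCov polCov k j * sig j) := by
  fin_cases k <;> fin_cases j <;>
    simp [tetradCoord, alt13, Fin.sum_univ_four, sig, biv, lightCov, polCov, Complex.ext_iff] <;>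
    norm_num

lemma comps_eq_of_isCovariant {Λ : CurvSpace →ₗ[ℝ] ℂ}
    (h1 : IsCovariant Λ boostRotation (4 * rotPhase ^ 2)) (h2 : IsCovariant Λ nullRotation 1) :
    ∃ x : ℂ, ∀ k j m n, comps Λ k j m n = x * (biv lightCov polCov k j * sig j *
      (sig m * biv lightCov polCov m n * sig n)) := by
  -- The constant -1/16 is (-i/4)², one factor -i/4 from each use of `sum_alt13`.
  refine ⟨form4 (comps Λ) (tetrad 1) (tetrad 3) (tetrad 1) (tetrad 3) * (-1 / 16), ?_⟩
  intro k j m n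
  have hk : (sig k : ℂ) * sig k = 1 := by exact_mod_cast sig_mul_self k
  have e1 : form4 (comps Λ) (Pi.single k 1) (Pi.single j 1) (Pi.single m 1) (Pi.single n 1) =
      sig k * comps Λ k j m n := by
    simp [form4, Pi.single_apply]
  rw [single_eq_sum_tetrad, single_eq_sum_tetrad, single_eq_sum_tetrad, single_eq_sum_tetrad,
    form4_sum] at e1
  have e2 : ∑ a, ∑ b, ∑ c, ∑ d, tetradCoord k a * tetradCoord j b * tetradCoord m c *
      tetradCoord n d * form4 (comps Λ) (tetrad a) (tetrad b) (tetrad c) (tetrad d) =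
      form4 (comps Λ) (tetrad 1) (tetrad 3) (tetrad 1) (tetrad 3) *
        ((∑ a, ∑ b, tetradCoord k a * tetradCoord j b * (alt13 a b : ℂ)) *
        (∑ c, ∑ d, tetradCoord m c * tetradCoord n d * (alt13 c d : ℂ))) := by
    rw [sum_two_mul_sum_two]
    simp only [Finset.mul_sum]
    refine Finset.sum_congr rfl fun a _ => Finset.sum_congr rfl fun b _ =>
      Finset.sum_congr rfl fun c _ => Finset.sum_congr rfl fun d _ => ?_
    rw [form4_tetrad h1 h2]
    push_cast
    ring
  rw [e2, sum_alt13, sum_alt13] at e1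
  linear_combination (-sig k : ℂ) * e1 - (comps Λ k j m n +
    form4 (comps Λ) (tetrad 1) (tetrad 3) (tetrad 1) (tetrad 3) / 16 *
      (biv lightCov polCov k j * sig j * (sig m * biv lightCov polCov m n * sig n))) * hk +
    form4 (comps Λ) (tetrad 1) (tetrad 3) (tetrad 1) (tetrad 3) / 16 * sig k * sig k *
      (biv lightCov polCov k j * sig j * (sig m * biv lightCov polCov m n * sig n)) *
      (Complex.I_sq)

/-! ### Invariant quadratic forms and the curvature of plane waves -/

lemma inFrame_add (e : Mat4) (Q Q' : CurvSpace) :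
    inFrame e (Q + Q') = inFrame e Q + inFrame e Q' := by
  apply Subtype.ext
  funext a b c d
  simp only [inFrame, Submodule.coe_add, Pi.add_apply, mul_add, Finset.sum_add_distrib]

lemma inFrame_smul (e : Mat4) (r : ℝ) (Q : CurvSpace) : inFrame e (r • Q) = r • inFrame e Q := by
  apply Subtype.ext
  funext a b c d
  simp only [inFrame, Submodule.coe_smul, Pi.smul_apply, smul_eq_mul, Finset.mul_sum]
  refine Finset.sum_congr rfl fun k _ => Finset.sum_congr rfl fun j _ =>
    Finset.sum_congr rfl fun m _ => Finset.sum_congr rfl fun n _ => ?_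
  ring

lemma inFrame_one (Q : CurvSpace) : inFrame 1 Q = Q := by
  apply Subtype.ext
  funext a b c d
  simp [inFrame, Matrix.one_apply]

lemma IsLorentzInvariant.polar_inFrame {q : QuadraticForm ℝ CurvSpace} (hq : IsLorentzInvariant q)
    {L : Mat4} (hL : IsLorentz L) (Q Q' : CurvSpace) :
    QuadraticMap.polar q (inFrame L Q) (inFrame L Q') = QuadraticMap.polar q Q Q' := by
  simp only [QuadraticMap.polar]
  rw [← inFrame_add, hq L hL, hq L hL, hq L hL]

/-- The functional `Λ` with `polar q (rad z) Q = Re(z Λ(Q))`. -/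
def radFunctional (q : QuadraticForm ℝ CurvSpace) (l : Fin 4 → ℝ) (w : Fin 4 → ℂ) :
    CurvSpace →ₗ[ℝ] ℂ where
  toFun Q := ((QuadraticMap.polar q (rad l w 1) Q : ℝ) : ℂ) -
    Complex.I * ((QuadraticMap.polar q (rad l w Complex.I) Q : ℝ) : ℂ)
  map_add' Q Q' := by
    rw [QuadraticMap.polar_add_right, QuadraticMap.polar_add_right]
    push_cast
    ring
  map_smul' r Q := by
    rw [QuadraticMap.polar_smul_right, QuadraticMap.polar_smul_right]
    simp
    ring

lemma polar_rad_eq_re (q : QuadraticForm ℝ CurvSpace) (l : Fin 4 → ℝ) (w : Fin 4 → ℂ) (z : ℂ)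
    (Q : CurvSpace) : QuadraticMap.polar q (rad l w z) Q = (z * radFunctional q l w Q).re := by
  have h : rad l w z = z.re • rad l w 1 + z.im • rad l w Complex.I := by
    rw [← rad_real_mul, ← rad_real_mul, ← rad_add, mul_one, Complex.re_add_im]
  rw [h, QuadraticMap.polar_add_left, QuadraticMap.polar_smul_left, QuadraticMap.polar_smul_left]
  simp [radFunctional]

lemma complex_eq_of_re_mul_eq {p r : ℂ} (h : ∀ z : ℂ, (z * p).re = (z * r).re) : p = r := by
  apply Complex.ext
  · simpa using h 1
  · have := h Complex.I
    simpa using this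

/-- F⊗F is quadratic in F, so a Lorentz map that scales F by κ changes the functional by κ². -/
lemma isCovariant_radFunctional {q : QuadraticForm ℝ CurvSpace} (hq : IsLorentzInvariant q)
    {l : Fin 4 → ℝ} {w : Fin 4 → ℂ} {L : Mat4} (hL : IsLorentz L) {κ : ℂ}
    (h : biv (pullReal L l) (pull L w) = κ • biv l w) :
    IsCovariant (radFunctional q l w) L (κ ^ 2) := by
  intro Q
  apply complex_eq_of_re_mul_eq
  intro z
  rw [← polar_rad_eq_re, ← hq.polar_inFrame hL, hL.inFrame_rad, rad_eq_of_biv_eq h,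
    polar_rad_eq_re]
  congr 1
  ring

/-- The boost-rotation multiplies the canonical F by 2·`rotPhase`, the product of the eigenvalues of
its two covectors. The null rotation fixes F. These two covariances determine the functional up to a
complex factor. -/
lemma polar_rad_canonical {q : QuadraticForm ℝ CurvSpace} (hq : IsLorentzInvariant q) :
    ∃ c : ℂ, ∀ z Q, QuadraticMap.polar q (rad lightCov polCov z) Q =
      (z * (c * contract (biv lightCov polCov) Q)).re := by
  have h1 : IsCovariant (radFunctional q lightCov polCov) boostRotation (4 * rotPhase ^ 2) := by
    have := isCovariant_radFunctional hq isLorentz_boostRotation (l := lightCov) (w := polCov)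
      (κ := 2 * rotPhase) (by
        ext m n
        fin_cases m <;> fin_cases n <;>
          simp [biv, pullReal, pull, boostRotation, lightCov, polCov, rotPhase, Fin.sum_univ_four,
            Complex.ext_iff] <;> norm_num)
    rwa [mul_pow, show (2 : ℂ) ^ 2 = 4 by norm_num] at this
  have h2 : IsCovariant (radFunctional q lightCov polCov) nullRotation 1 := by
    have := isCovariant_radFunctional hq isLorentz_nullRotation (l := lightCov) (w := polCov)
      (κ := 1) (by
        ext m n
        fin_cases m <;> fin_cases n <;>
          simp [biv, pullReal, pull, nullRotation, lightCov, polCov, Fin.sum_univ_four,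
            Complex.ext_iff] <;> norm_num)
    rwa [one_pow] at this
  obtain ⟨x, hx⟩ := comps_eq_of_isCovariant h1 h2
  refine ⟨1 / 2 * x, fun z Q => ?_⟩
  rw [polar_rad_eq_re, apply_eq_sum_comps, contract]
  simp only [Finset.mul_sum, hx]
  congr 1
  refine Finset.sum_congr rfl fun k _ => Finset.sum_congr rfl fun j _ =>
    Finset.sum_congr rfl fun m _ => Finset.sum_congr rfl fun n _ => ?_
  ring

/-! ### Spinors -/

lemma pauli_expand {H : Matrix (Fin 2) (Fin 2) ℂ} (hH : Hᴴ = H) :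
    H = ∑ j, (((1 / 2) * (pauli j * H).trace).re : ℂ) • pauli j := by
  have h00 := congrArg Complex.im (congrFun (congrFun hH 0) 0)
  have h11 := congrArg Complex.im (congrFun (congrFun hH 1) 1)
  have h01 := congrFun (congrFun hH 0) 1
  rw [Matrix.conjTranspose_apply] at h00 h11 h01
  have h01r := congrArg Complex.re h01
  have h01i := congrArg Complex.im h01
  simp at h00 h11 h01r h01i
  have h00' : (H 0 0).im = 0 := by linarith
  have h11' : (H 1 1).im = 0 := by linarith
  ext a b
  fin_cases a <;> fin_cases b <;>
    simp [pauli, Fin.sum_univ_four, Matrix.trace, Matrix.mul_apply, Fin.sum_univ_two,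
      Complex.ext_iff, h00', h11', ← h01r, ← h01i] <;> (try constructor) <;> ring

/-- `spinorMap` is defined by traces; completeness of the Pauli matrices, applied to the Hermitian
matrix B σ_n B†, turns the trace of a product into a matrix product. -/
lemma spinorMap_mul (A B : Matrix.SpecialLinearGroup (Fin 2) ℂ) :
    spinorMap (A * B) = spinorMap A * spinorMap B := by
  ext m n
  have hH : (B.1 * pauli n * B.1ᴴ)ᴴ = B.1 * pauli n * B.1ᴴ := by
    have hp : (pauli n)ᴴ = pauli n := by
      ext a b
      fin_cases n <;> fin_cases a <;> fin_cases b <;> simp [pauli]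
    simp only [Matrix.conjTranspose_mul, Matrix.conjTranspose_conjTranspose, hp, Matrix.mul_assoc]
  have h1 := pauli_expand hH
  rw [Matrix.mul_apply]
  have h2 : pauli m * (A * B).1 * pauli n * ((A * B).1)ᴴ =
      pauli m * A.1 * (B.1 * pauli n * B.1ᴴ) * A.1ᴴ := by
    rw [Matrix.SpecialLinearGroup.coe_mul, Matrix.conjTranspose_mul]
    simp only [Matrix.mul_assoc]
  rw [spinorMap, h2, h1]
  simp only [Matrix.sum_mul, Matrix.trace_sum, Finset.mul_sum, Complex.re_sum,
    Matrix.mul_smul, Matrix.smul_mul, Matrix.trace_smul]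
  refine Finset.sum_congr rfl fun j _ => ?_
  rw [spinorMap, spinorMap, smul_eq_mul, mul_left_comm, Complex.re_ofReal_mul, mul_comm]
  simp only [Matrix.mul_assoc]

lemma spinorMap_one : spinorMap 1 = 1 := by
  ext m n
  fin_cases m <;> fin_cases n <;>
    simp [spinorMap, pauli, Matrix.trace, Fin.sum_univ_two] <;> norm_num

lemma spinorMap_inv (S : Matrix.SpecialLinearGroup (Fin 2) ℂ) :
    spinorMap S⁻¹ = (spinorMap S)⁻¹ := by
  symm
  apply Matrix.inv_eq_left_inv
  rw [← spinorMap_mul, inv_mul_cancel, spinorMap_one]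

/-- The matrix `(1 b; 0 1)`. -/
def upperSL (b : ℂ) : Matrix.SpecialLinearGroup (Fin 2) ℂ := ⟨!![1, b; 0, 1], by simp⟩

/-- The matrix `(1 0; b 1)`. -/
def lowerSL (b : ℂ) : Matrix.SpecialLinearGroup (Fin 2) ℂ := ⟨!![1, 0; b, 1], by simp⟩

/-- The matrix `(0 -1; 1 0)`. -/
def flipSL : Matrix.SpecialLinearGroup (Fin 2) ℂ := ⟨!![0, -1; 1, 0], by simp⟩

lemma spinorMap_upperSL (b : ℂ) : spinorMap (upperSL b) =
    !![1 + (b.re ^ 2 + b.im ^ 2) / 2, b.re, -b.im, -((b.re ^ 2 + b.im ^ 2) / 2);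
      b.re, 1, 0, -b.re; -b.im, 0, 1, b.im;
      (b.re ^ 2 + b.im ^ 2) / 2, b.re, -b.im, 1 - (b.re ^ 2 + b.im ^ 2) / 2] := by
  have hc : (!![1, b; 0, 1])ᴴ = !![1, 0; (starRingEnd ℂ) b, 1] := by
    ext i j
    fin_cases i <;> fin_cases j <;> simp
  ext m n
  fin_cases m <;> fin_cases n <;>
    simp [spinorMap, upperSL, pauli, Matrix.trace, Fin.sum_univ_two, hc] <;> ring

lemma spinorMap_lowerSL (b : ℂ) : spinorMap (lowerSL b) =
    !![1 + (b.re ^ 2 + b.im ^ 2) / 2, b.re, b.im, (b.re ^ 2 + b.im ^ 2) / 2;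
      b.re, 1, 0, b.re; b.im, 0, 1, b.im;
      -((b.re ^ 2 + b.im ^ 2) / 2), -b.re, -b.im, 1 - (b.re ^ 2 + b.im ^ 2) / 2] := by
  have hc : (!![1, 0; b, 1])ᴴ = !![1, (starRingEnd ℂ) b; 0, 1] := by
    ext i j
    fin_cases i <;> fin_cases j <;> simp
  ext m n
  fin_cases m <;> fin_cases n <;>
    simp [spinorMap, lowerSL, pauli, Matrix.trace, Fin.sum_univ_two, hc] <;> ring

lemma spinorMap_flipSL : spinorMap flipSL = Matrix.diagonal ![1, -1, 1, -1] := by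
  have hc : (!![0, -1; 1, 0] : Matrix (Fin 2) (Fin 2) ℂ)ᴴ = !![0, 1; -1, 0] := by
    ext i j
    fin_cases i <;> fin_cases j <;> simp
  ext m n
  fin_cases m <;> fin_cases n <;>
    simp [spinorMap, flipSL, pauli, Matrix.trace, Fin.sum_univ_two, hc] <;> norm_num

lemma isLorentz_spinorMap_lowerSL (b : ℂ) : IsLorentz (spinorMap (lowerSL b)) := by
  rw [IsLorentz, spinorMap_lowerSL]
  ext m n
  fin_cases m <;> fin_cases n <;>
    simp [eta, Matrix.mul_apply, Fin.sum_univ_four, Matrix.diagonal_apply] <;> ring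

lemma isLorentz_spinorMap_flipSL : IsLorentz (spinorMap flipSL) := by
  rw [IsLorentz, spinorMap_flipSL]
  ext m n
  fin_cases m <;> fin_cases n <;>
    simp [eta, Matrix.mul_apply, Matrix.diagonal_apply]

/-- Every light-like covector is brought to canonical form by an element of `SL(2, ℂ)`. -/
lemma exists_spinor_of_null {l : Fin 4 → ℝ} (hl : ∑ a, sig a * l a * l a = 0) (h0 : l ≠ 0) :
    ∃ S, IsLorentz (spinorMap S) ∧ ∃ r : ℝ, r ≠ 0 ∧ pullReal (spinorMap S) l = r • lightCov := by
  have hl' : l 0 * l 0 - l 1 * l 1 - l 2 * l 2 - l 3 * l 3 = 0 := by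
    simp [Fin.sum_univ_four, sig] at hl
    linear_combination hl
  -- If l₀ = l₃, nullity gives l = l₀(1,0,0,1), and the flip reverses the third axis. Otherwise a
  -- null rotation removes the transverse components.
  by_cases h : l 0 - l 3 = 0
  · have h1 : l 1 * l 1 + l 2 * l 2 = 0 := by
      linear_combination (l 0 + l 3) * h - hl'
    have h11 : l 1 = 0 := by nlinarith [mul_self_nonneg (l 1), mul_self_nonneg (l 2)]
    have h12 : l 2 = 0 := by nlinarith [mul_self_nonneg (l 1), mul_self_nonneg (l 2)]
    refine ⟨flipSL, isLorentz_spinorMap_flipSL, l 0, ?_, ?_⟩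
    · intro h00
      apply h0
      funext a
      fin_cases a
      · exact h00
      · exact h11
      · exact h12
      · simpa [h00] using h
    · rw [spinorMap_flipSL]
      funext a
      fin_cases a <;> simp [pullReal, lightCov, Matrix.diagonal_apply, h11, h12]
      linarith
  -- The real and imaginary parts are chosen to cancel the components l₁ and l₂; nullity of l then
  -- gives the remaining two.
  · refine ⟨lowerSL (⟨-l 1 / (l 0 - l 3), -l 2 / (l 0 - l 3)⟩ : ℂ),
      isLorentz_spinorMap_lowerSL _, (l 0 - l 3) / 2, div_ne_zero h two_ne_zero, ?_⟩
    rw [spinorMap_lowerSL]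
    funext a
    fin_cases a <;> simp [pullReal, lightCov, Fin.sum_univ_four] <;> field_simp
    · linear_combination (l 0 - l 3) * hl'
    · ring
    · ring
    · linear_combination (l 0 - l 3) * hl'

/-! ### Reduction of null bivectors to canonical form -/

lemma IsLorentz.sum_pull {L : Mat4} (h : IsLorentz L) (α β : Fin 4 → ℂ) :
    ∑ a, (sig a : ℂ) * pull L α a * pull L β a = ∑ a, (sig a : ℂ) * α a * β a := by
  have e1 : ∀ a, (sig a : ℂ) * pull L α a * pull L β a =
      ∑ j, ∑ k, ((sig a : ℂ) * L j a * L k a) * (α j * β k) := by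
    intro a
    rw [pull, pull, mul_assoc, Finset.sum_mul_sum]
    simp only [Finset.mul_sum]
    refine Finset.sum_congr rfl fun j _ => Finset.sum_congr rfl fun k _ => ?_
    ring
  simp only [e1]
  rw [Finset.sum_comm]
  refine Finset.sum_congr rfl fun j _ => ?_
  rw [Finset.sum_comm]
  simp only [← Finset.sum_mul, h.sum_raise]
  simp [mul_assoc]

lemma pull_ofReal (L : Mat4) (l : Fin 4 → ℝ) (a : Fin 4) :
    pull L (fun k => (l k : ℂ)) a = (pullReal L l a : ℂ) := by
  simp [pull, pullReal]

lemma formInFrame_ne_zero {L : Mat4} (h : IsLorentz L) {F : Fin 4 → Fin 4 → ℂ} (hF : F ≠ 0) :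
    formInFrame F L ≠ 0 := by
  intro h0
  apply hF
  funext m n
  have h1 := h.sum_raise_formInFrame F m n
  rw [h0] at h1
  have hm : (sig m : ℂ) * sig m = 1 := by exact_mod_cast sig_mul_self m
  have hn : (sig n : ℂ) * sig n = 1 := by exact_mod_cast sig_mul_self n
  simp only [Pi.zero_apply, mul_zero, zero_mul, Finset.sum_const_zero] at h1 ⊢
  linear_combination -(sig m : ℂ) * sig n * h1 - F m n * (sig n * sig n) * hm - F m n * hn

/-- A null bivector is brought to one of two canonical forms, up to a factor, by an element of
`SL(2, ℂ)`. -/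
lemma IsNullPair.exists_canonical {l : Fin 4 → ℝ} {w : Fin 4 → ℂ} (h : IsNullPair l w)
    (hb : biv l w ≠ 0) : ∃ S, IsLorentz (spinorMap S) ∧ ∃ κ : ℂ, κ ≠ 0 ∧
      (formInFrame (biv l w) (spinorMap S) = κ • biv lightCov polCov ∨
        formInFrame (biv l w) (spinorMap S) = κ • biv lightCov (star polCov)) := by
  have hl0 : l ≠ 0 := by
    rintro rfl
    apply hb
    funext m n
    simp [biv]
  obtain ⟨S, hS, r, hr, hSl⟩ := exists_spinor_of_null h.null_left hl0
  have hr' : (r : ℂ) ≠ 0 := by exact_mod_cast hr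
  refine ⟨S, hS, ?_⟩
  have hne := formInFrame_ne_zero hS hb
  rw [formInFrame_biv, hSl] at hne ⊢
  have h1 := hS.sum_pull (fun k => (l k : ℂ)) w
  have h2 := hS.sum_pull w w
  rw [h.orthogonal] at h1
  rw [h.null_right] at h2
  simp only [pull_ofReal, hSl] at h1
  generalize pull (spinorMap S) w = v at *
  simp [Fin.sum_univ_four, sig, lightCov] at h1 h2
  have h3 : v 3 = -v 0 := by
    have : (r : ℂ) * (v 0 + v 3) = 0 := by linear_combination h1
    linear_combination (mul_eq_zero.1 this).resolve_left hr'
  -- With v₃ = -v₀, nullity of v reduces to v₁² + v₂² = 0, whose two linear factors correspond to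
  -- the two polarizations.
  have h4 : (v 2 - Complex.I * v 1) * (v 2 + Complex.I * v 1) = 0 := by
    rw [h3] at h2
    linear_combination -h2 - v 1 ^ 2 * Complex.I_sq
  -- The part of v along `lightCov` drops out of the wedge product.
  have key : biv (r • lightCov) v = (r * v 1) • biv lightCov polCov ∨
      biv (r • lightCov) v = (r * v 1) • biv lightCov (star polCov) := by
    rcases mul_eq_zero.1 h4 with h5 | h5
    · left
      have h6 : v 2 = Complex.I * v 1 := by linear_combination h5
      funext m n
      fin_cases m <;> fin_cases n <;> simp [biv, lightCov, polCov, h3, h6] <;> ring_nf <;>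
        simp [Complex.I_sq]
    · right
      have h6 : v 2 = -Complex.I * v 1 := by linear_combination h5
      funext m n
      fin_cases m <;> fin_cases n <;> simp [biv, lightCov, polCov, h3, h6] <;> ring_nf <;>
        simp [Complex.I_sq]
  refine ⟨r * v 1, ?_, key⟩
  intro h0
  rcases key with hk | hk <;> rw [h0, zero_smul] at hk <;> exact hne hk

/-- Conjugating the polarization amounts to conjugating z, so the second canonical form reduces to
the first. -/
lemma rad_star (l : Fin 4 → ℝ) (w : Fin 4 → ℂ) (z : ℂ) :
    rad l (star w) z = rad l w (star z) := by
  apply Subtype.ext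
  funext k j m n
  have h : ∀ a b, biv l (star w) a b = -star (biv l w a b) := fun a b => by rw [star_biv, neg_neg]
  rw [rad_apply, rad_apply, h, h]
  congr 1
  rw [← Complex.conj_re]
  congr 1
  simp

/-- Every invariant quadratic form pairs the curvature of a plane wave with other curvature
tensors by contraction with `F ⊗ F`. -/
lemma exists_polar_rad {q : QuadraticForm ℝ CurvSpace} (hq : IsLorentzInvariant q)
    {l : Fin 4 → ℝ} {w : Fin 4 → ℂ} (h : biv l w = 0 ∨ IsNullPair l w) :
    ∃ c : ℂ, ∀ z Q, QuadraticMap.polar q (rad l w z) Q =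
      (z * (c * contract (biv l w) Q)).re := by
  by_cases hb : biv l w = 0
  · refine ⟨0, fun z Q => ?_⟩
    have : rad l w z = 0 := by
      apply Subtype.ext
      funext k j m n
      simp [rad_apply, hb]
    rw [this, QuadraticMap.polar_zero_left]
    simp
  obtain ⟨S, hS, κ, hκ, hcan⟩ := (h.resolve_left hb).exists_canonical hb
  obtain ⟨c, hc⟩ := polar_rad_canonical hq
  -- The contraction is Lorentz invariant and homogeneous of degree two in F, so the canonical
  -- result can be carried back.
  have hcon : ∀ Q, κ ^ 2 * contract ((1 / κ) • formInFrame (biv l w) (spinorMap S))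
      (inFrame (spinorMap S) Q) = contract (biv l w) Q := by
    intro Q
    rw [contract_smul, hS.contract_inFrame]
    field_simp
  rcases hcan with hcan | hcan
  · refine ⟨c, fun z Q => ?_⟩
    rw [← hq.polar_inFrame hS, hS.inFrame_rad,
      rad_eq_of_biv_eq ((formInFrame_biv l w _).symm.trans hcan), hc, ← hcon, hcan, smul_smul,
      one_div, inv_mul_cancel₀ hκ, one_smul]
    congr 1
    ring
  · refine ⟨star c, fun z Q => ?_⟩
    have hF : biv lightCov (star polCov) = (-1 : ℂ) • star (biv lightCov polCov) := by
      funext m n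
      simp [star_biv]
    rw [← hq.polar_inFrame hS, hS.inFrame_rad,
      rad_eq_of_biv_eq ((formInFrame_biv l w _).symm.trans hcan), rad_star, hc, ← hcon, hcan,
      smul_smul, one_div, inv_mul_cancel₀ hκ, one_smul, hF, contract_smul, contract_star,
      ← Complex.conj_re]
    congr 1
    simp
    ring

/-! ### Nilpotent matrices and their exponentials -/

/-- The endomorphism with matrix `Re(z F)`. -/
def nil (F : Fin 4 → Fin 4 → ℂ) : ℂ →ₗ[ℝ] Mat4 where
  toFun z := Matrix.of fun k n => sig k * (z * F k n).re
  map_add' z z' := by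
    ext k n
    simp [add_mul, mul_add]
  map_smul' r z := by
    ext k n
    simp [mul_assoc]
    ring

lemma nil_apply (F : Fin 4 → Fin 4 → ℂ) (z : ℂ) (k n : Fin 4) :
    nil F z k n = sig k * (z * F k n).re := rfl

lemma nil_smul (F : Fin 4 → Fin 4 → ℂ) (κ z : ℂ) : nil (κ • F) z = nil F (κ * z) := by
  ext k n
  simp only [nil_apply, Pi.smul_apply, smul_eq_mul]
  congr 2
  ring

lemma nil_star (F : Fin 4 → Fin 4 → ℂ) (z : ℂ) : nil (star F) z = nil F (star z) := by
  ext k n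
  rw [nil_apply, nil_apply, ← Complex.conj_re]
  simp

/-- The exponential of `Re(z F)` when this is nilpotent of order three. -/
def transp (F : Fin 4 → Fin 4 → ℂ) (z : ℂ) : Mat4 :=
  1 + nil F z + (1 / 2 : ℝ) • (nil F z * nil F z)

lemma transp_zero (F : Fin 4 → Fin 4 → ℂ) : transp F 0 = 1 := by
  simp [transp]

lemma nil_map_ofReal (F : Fin 4 → Fin 4 → ℂ) (z : ℂ) :
    (nil F z).map Complex.ofRealHom = ((1 / 2) * z) • (Matrix.of fun k n => sig k * F k n) +
      ((1 / 2) * star z) • (Matrix.of fun k n => sig k * star (F k n)) := by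
  ext k n
  have h : ∀ c : ℂ, (c.re : ℂ) = 1 / 2 * (c + star c) := fun c => by
    rw [Complex.star_def, Complex.add_conj]
    push_cast
    ring
  simp only [Matrix.map_apply, nil_apply, Matrix.add_apply, Matrix.smul_apply, Matrix.of_apply,
    smul_eq_mul, Complex.ofRealHom_eq_coe, Complex.ofReal_mul, h, star_mul']
  ring

lemma map_ofReal_injective :
    Function.Injective fun M : Mat4 => M.map Complex.ofRealHom :=
  Matrix.map_injective Complex.ofReal_injective

section

variable {l : Fin 4 → ℝ} {w : Fin 4 → ℂ}

lemma IsNullBivector.nil_mul_nil (h : IsNullBivector l w) (a b : ℂ) :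
    nil (biv l w) a * nil (biv l w) b = nil (biv l w) b * nil (biv l w) a := by
  ext k n
  simpa only [Matrix.mul_apply, nil_apply] using waveConnection_comm h a b k n

/-- After complexification each factor is a combination of N and N̄. These commute and have zero
squares, and any product of three of them repeats one. -/
lemma IsNullBivector.nil_mul_nil_mul_nil (h : IsNullBivector l w) (a b c : ℂ) :
    nil (biv l w) a * nil (biv l w) b * nil (biv l w) c = 0 := by
  apply map_ofReal_injective
  simp only [Matrix.map_mul, nil_map_ofReal]
  set N : Matrix (Fin 4) (Fin 4) ℂ := Matrix.of fun k n => (sig k : ℂ) * biv l w k n with hN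
  set N' : Matrix (Fin 4) (Fin 4) ℂ := Matrix.of fun k n => (sig k : ℂ) * star (biv l w k n) with hN'
  have h1 : N * N = 0 := by
    ext m n
    have := congrArg (fun z => (sig m : ℂ) * z) (h.sq m n)
    simp only [Finset.mul_sum, mul_zero] at this
    simpa [Matrix.mul_apply, hN, mul_assoc] using this
  have h2 : N' * N' = 0 := by
    ext m n
    have := congrArg (fun z => (sig m : ℂ) * star z) (h.sq m n)
    simp only [star_sum, Finset.mul_sum, star_zero, mul_zero] at this
    simpa [Matrix.mul_apply, hN', mul_assoc] using this
  have h3 : N' * N = N * N' := by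
    ext m n
    have := congrArg (fun z => (sig m : ℂ) * z) (h.comm m n)
    simp only [Finset.mul_sum] at this
    simpa [Matrix.mul_apply, hN, hN', mul_assoc] using this.symm
  have h4 : N * N' * N = 0 := by rw [Matrix.mul_assoc, h3, ← Matrix.mul_assoc, h1, Matrix.zero_mul]
  have h5 : N * N' * N' = 0 := by rw [Matrix.mul_assoc, h2, Matrix.mul_zero]
  simp [add_mul, mul_add, h1, h2, h3, h4, h5]

/-- For commuting matrices this is the exponential law, the terms of degree three and higher being
zero. -/
lemma IsNullBivector.transp_add (h : IsNullBivector l w) (a b : ℂ) :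
    transp (biv l w) (a + b) = transp (biv l w) a * transp (biv l w) b := by
  have hc := h.nil_mul_nil b a
  have h1 := h.nil_mul_nil_mul_nil a b b
  have h2 := h.nil_mul_nil_mul_nil a a b
  simp only [transp, map_add]
  generalize nil (biv l w) a = A at *
  generalize nil (biv l w) b = B at *
  simp only [add_mul, mul_add, one_mul, mul_one, smul_mul_assoc, mul_smul_comm, ← mul_assoc, h1, h2,
    hc, smul_zero, add_zero]
  module

lemma IsNullBivector.transp_mul_neg (h : IsNullBivector l w) (a : ℂ) :
    transp (biv l w) (-a) * transp (biv l w) a = 1 := by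
  rw [← h.transp_add, neg_add_cancel, transp_zero]

lemma IsNullBivector.transp_mul_nil (h : IsNullBivector l w) (z ζ : ℂ) :
    transp (biv l w) z * nil (biv l w) ζ = nil (biv l w) ζ * transp (biv l w) z := by
  have hc := h.nil_mul_nil z ζ
  simp only [transp, add_mul, mul_add, one_mul, mul_one, smul_mul_assoc, mul_smul_comm]
  rw [mul_assoc, hc, ← mul_assoc, hc, mul_assoc]

/-! ### Parallel transport -/

/-- Along any velocity the connection matrix is Re(ζF) for a complex number ζ, so parallel transport
reduces to integrating a scalar function. -/
lemma sum_waveConnection_mul (x : Pt) (v : Fin 4 → ℝ) (P : Mat4) (i j : Fin 4) :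
    ∑ m, ∑ n, waveConnection l w x i m n * v m * P n j =
      (nil (biv l w) (1 / 2 * osc (2 • l) x * ∑ m, w m * v m) * P) i j := by
  rw [Matrix.mul_apply, Finset.sum_comm]
  refine Finset.sum_congr rfl fun n _ => ?_
  rw [← Finset.sum_mul]
  congr 1
  rw [nil_apply, Finset.mul_sum, Finset.sum_mul, Complex.re_sum, Finset.mul_sum]
  refine Finset.sum_congr rfl fun m _ => ?_
  rw [waveConnection]
  have : ∀ z : ℂ, 1 / 2 * z.re * v m = (((1 / 2 * v m : ℝ) : ℂ) * z).re := fun z => by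
    rw [Complex.re_ofReal_mul]
    ring
  rw [mul_assoc, this]
  congr 2
  push_cast
  ring

open scoped Matrix.Norms.Operator in
lemma hasDerivWithinAt_matrix {P : ℝ → Mat4} {P' : Mat4} {s : Set ℝ} {t : ℝ}
    (h : ∀ i j, HasDerivWithinAt (fun τ => P τ i j) (P' i j) s t) : HasDerivWithinAt P P' s t := by
  have h1 : ∀ M : Mat4, M = ∑ i, ∑ j, M i j • Matrix.single i j (1 : ℝ) := fun M => by
    conv_lhs => rw [Matrix.matrix_eq_sum_single M]
    simp [Matrix.smul_single]
  have h2 : P = fun τ => ∑ i, ∑ j, P τ i j • Matrix.single i j (1 : ℝ) := funext fun τ => h1 (P τ)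
  rw [h2, h1 P']
  exact HasDerivWithinAt.fun_sum fun i _ => HasDerivWithinAt.fun_sum fun j _ =>
    (h i j).smul_const _

open scoped Matrix.Norms.Operator in
lemma hasDerivWithinAt_apply {P : ℝ → Mat4} {P' : Mat4} {s : Set ℝ} {t : ℝ}
    (h : HasDerivWithinAt P P' s t) (i j : Fin 4) :
    HasDerivWithinAt (fun τ => P τ i j) (P' i j) s t := by
  let e : Mat4 →ₗ[ℝ] ℝ :=
    { toFun := fun M => M i j
      map_add' := fun _ _ => rfl
      map_smul' := fun _ _ => rfl }
  exact (LinearMap.toContinuousLinearMap e).hasFDerivAt.comp_hasDerivWithinAt t h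

open scoped Matrix.Norms.Operator in
lemma hasDerivAt_nil (F : Fin 4 → Fin 4 → ℂ) {Z : ℝ → ℂ} {ζ : ℂ} {t : ℝ} (h : HasDerivAt Z ζ t) :
    HasDerivAt (fun τ => nil F (Z τ)) (nil F ζ) t :=
  (LinearMap.toContinuousLinearMap (nil F)).hasFDerivAt.comp_hasDerivAt t h

open scoped Matrix.Norms.Operator in
lemma IsNullBivector.hasDerivAt_transp (h : IsNullBivector l w) {Z : ℝ → ℂ} {ζ : ℂ} {t : ℝ}
    (hZ : HasDerivAt Z ζ t) : HasDerivAt (fun τ => transp (biv l w) (Z τ))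
      (transp (biv l w) (Z t) * nil (biv l w) ζ) t := by
  have h1 := hasDerivAt_nil (biv l w) hZ
  have h2 := (h1.const_add 1).add ((h1.mul h1).const_smul (1 / 2 : ℝ))
  refine h2.congr_deriv ?_
  have hc := h.nil_mul_nil ζ (Z t)
  have h0 := h.nil_mul_nil_mul_nil (Z t) (Z t) ζ
  simp only [transp, add_mul, one_mul, smul_mul_assoc, h0, hc, smul_zero, add_zero]
  module

open scoped Matrix.Norms.Operator in
-- If Z is an antiderivative of the scalar ζ along the path, `transp` of Z is an integrating factor:
-- its product with P has derivative zero, so P at 1 is `transp` of -Z(1).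
lemma IsNullBivector.exists_transp_of_along (h : IsNullBivector l w) {c : ℝ → Pt} {P : ℝ → Mat4}
    (hc : ContDiffOn ℝ 1 c (Set.Icc 0 1)) (h0 : P 0 = 1)
    (hP : ∀ t ∈ Set.Icc (0 : ℝ) 1, ∀ i j, HasDerivWithinAt (fun s => P s i j)
      (-∑ m, ∑ n, waveConnection l w (c t) i m n * derivWithin c (Set.Icc 0 1) t m * P t n j)
      (Set.Icc 0 1) t) : ∃ z, P 1 = transp (biv l w) z := by
  set ζ : ℝ → ℂ := fun t => 1 / 2 * osc (2 • l) (c t) *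
    ∑ m, w m * (derivWithin c (Set.Icc 0 1) t m : ℂ) with hζ
  have hcont : ContinuousOn ζ (Set.Icc 0 1) := by
    have h1 : ContinuousOn (derivWithin c (Set.Icc 0 1)) (Set.Icc 0 1) :=
      hc.continuousOn_derivWithin (uniqueDiffOn_Icc zero_lt_one) le_rfl
    have h2 : ContinuousOn (fun t => osc (2 • l) (c t)) (Set.Icc 0 1) :=
      (contDiff_osc _).continuous.comp_continuousOn hc.continuousOn
    refine (continuousOn_const.mul h2).mul (continuousOn_finsetSum _ fun m _ => ?_)
    refine continuousOn_const.mul (Complex.continuous_ofReal.comp_continuousOn ?_)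
    exact (continuous_apply m).comp_continuousOn h1
  -- ζ is only continuous on [0,1]; the constant extension makes its integral differentiable
  -- everywhere, including the endpoints.
  set η : ℝ → ℂ := Set.IccExtend zero_le_one ((Set.Icc 0 1).domRestrict ζ) with hη
  have hηc : Continuous η := hcont.domRestrict.Icc_extend'
  have hηζ : ∀ t ∈ Set.Icc (0 : ℝ) 1, η t = ζ t := fun t ht => Set.IccExtend_of_mem _ _ ht
  set Z : ℝ → ℂ := fun t => ∫ τ in (0 : ℝ)..t, η τ with hZdef
  have hZ : ∀ t, HasDerivAt Z (η t) t := fun t => (hηc.integral_hasStrictDerivAt 0 t).hasDerivAt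
  have hQ : ∀ t ∈ Set.Icc (0 : ℝ) 1,
      HasDerivWithinAt (fun τ => transp (biv l w) (Z τ) * P τ) 0 (Set.Icc 0 1) t := by
    intro t ht
    have h1 : HasDerivWithinAt P (-(nil (biv l w) (η t) * P t)) (Set.Icc 0 1) t := by
      refine hasDerivWithinAt_matrix fun i j => ?_
      have := hP t ht i j
      rw [sum_waveConnection_mul] at this
      rw [hηζ t ht]
      exact this
    have h2 := ((h.hasDerivAt_transp (hZ t)).hasDerivWithinAt (s := Set.Icc 0 1)).mul h1
    refine h2.congr_deriv ?_
    rw [mul_neg, mul_assoc, add_neg_cancel]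
  have hconst := constant_of_derivWithin_zero (a := (0 : ℝ)) (b := 1)
    (fun t ht => (hQ t ht).differentiableWithinAt) (fun t ht =>
      (hQ t ⟨ht.1, ht.2.le⟩).derivWithin (uniqueDiffOn_Icc zero_lt_one t ⟨ht.1, ht.2.le⟩)) 1
      (by simp)
  have hZ0 : Z 0 = 0 := by simp [hZdef]
  rw [hZ0, h0, transp_zero, one_mul] at hconst
  refine ⟨-Z 1, ?_⟩
  calc P 1 = transp (biv l w) (-Z 1) * transp (biv l w) (Z 1) * P 1 := by
        rw [h.transp_mul_neg, one_mul]
    _ = transp (biv l w) (-Z 1) := by rw [mul_assoc, hconst, mul_one]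

lemma IsNullBivector.exists_transp (h : IsNullBivector l w) {x y : Pt} {A : Mat4}
    (hA : ParallelTransport (waveConnection l w) x y A) : ∃ z, A = transp (biv l w) z := by
  induction hA with
  | along c P hc h0 hP => exact h.exists_transp_of_along hc h0 hP
  | concat _ _ ih1 ih2 =>
    obtain ⟨z1, rfl⟩ := ih1
    obtain ⟨z2, rfl⟩ := ih2
    exact ⟨z2 + z1, (h.transp_add z2 z1).symm⟩

lemma osc_two_smul_add (x v : Pt) : osc (2 • l) (x + v) = osc (2 • l) x *
    Complex.exp (-Complex.I * ((2 * ∑ a, l a * v a : ℝ) : ℂ)) := by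
  rw [osc_add]
  congr 1
  rw [osc]
  simp [Finset.mul_sum, mul_assoc]

open scoped Matrix.Norms.Operator in
/-- Parallel transport along a segment on which the connection form is constant. -/
lemma IsNullBivector.parallelTransport_segment (h : IsNullBivector l w) (x : Pt) (v : Fin 4 → ℝ)
    (hv : ∑ a, l a * v a = 0 ∨ ∑ m, w m * (v m : ℂ) = 0) :
    ParallelTransport (waveConnection l w) x (x + v)
      (transp (biv l w) (-(1 / 2 * osc (2 • l) x * ∑ m, w m * v m))) := by
  set ζ : ℂ := 1 / 2 * osc (2 • l) x * ∑ m, w m * v m with hζ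
  set c : ℝ → Pt := fun t => x + t • v with hc
  have hcd : ∀ t, HasDerivAt c v t := fun t =>
    (((hasDerivAt_id t).smul_const v).const_add x).congr_deriv (one_smul _ _)
  have hζt : ∀ t, 1 / 2 * osc (2 • l) (c t) * ∑ m, w m * (v m : ℂ) = ζ := by
    intro t
    -- If l·v = 0 the phase is constant along the segment; if w·v = 0 both sides are zero.
    rcases hv with hv | hv
    · have : ∑ a, l a * (t • v) a = 0 := by
        have h1 : ∑ a, l a * (t • v) a = t * ∑ a, l a * v a := by
          rw [Finset.mul_sum]
          refine Finset.sum_congr rfl fun a _ => ?_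
          simp
          ring
        rw [h1, hv, mul_zero]
      simp only [hc]
      rw [osc_two_smul_add, this]
      simp [hζ]
    · rw [hζ, hv, mul_zero, mul_zero]
  have key := ParallelTransport.along (Γ := waveConnection l w) c
    (fun t => transp (biv l w) (-((t : ℂ) * ζ))) ?_ ?_ ?_
  · simpa [hc] using key
  · exact (contDiff_const.add (contDiff_id.smul contDiff_const)).contDiffOn
  · simp [transp_zero]
  · intro t ht i j
    have h1 : derivWithin c (Set.Icc 0 1) t = v :=
      (hcd t).hasDerivWithinAt.derivWithin (uniqueDiffOn_Icc zero_lt_one t ht)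
    have h2 : HasDerivAt (fun τ : ℝ => -((τ : ℂ) * ζ)) (-ζ) t :=
      ((hasDerivAt_id t).ofReal_comp.mul_const ζ).neg.congr_deriv (by simp)
    have h3 := hasDerivWithinAt_apply (h.hasDerivAt_transp h2).hasDerivWithinAt i j (s := Set.Icc 0 1)
    rw [h1, sum_waveConnection_mul, hζt]
    refine h3.congr_deriv ?_
    rw [map_neg, mul_neg, h.transp_mul_nil, Matrix.neg_apply]

end

/-! ### The holonomy group -/

/-- A real covector orthogonal to a light-like one and itself null is proportional to it. -/
lemma mul_eq_mul_of_null {l a : Fin 4 → ℝ} (hl : ∑ k, sig k * l k * l k = 0)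
    (ha : ∑ k, sig k * a k * a k = 0) (hla : ∑ k, sig k * l k * a k = 0) (m n : Fin 4) :
    l m * a n = l n * a m := by
  simp [Fin.sum_univ_four, sig] at hl ha hla
  -- Replacing the spatial products by l₀², a₀² and l₀a₀ makes the sum cancel, so each square
  -- vanishes.
  have hsum : (a 0 * l 1 - l 0 * a 1) ^ 2 + (a 0 * l 2 - l 0 * a 2) ^ 2 +
      (a 0 * l 3 - l 0 * a 3) ^ 2 = 0 := by
    linear_combination -a 0 ^ 2 * hl - l 0 ^ 2 * ha + 2 * a 0 * l 0 * hla
  have h1 : a 0 * l 1 - l 0 * a 1 = 0 := by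
    nlinarith [sq_nonneg (a 0 * l 1 - l 0 * a 1), sq_nonneg (a 0 * l 2 - l 0 * a 2),
      sq_nonneg (a 0 * l 3 - l 0 * a 3)]
  have h2 : a 0 * l 2 - l 0 * a 2 = 0 := by
    nlinarith [sq_nonneg (a 0 * l 1 - l 0 * a 1), sq_nonneg (a 0 * l 2 - l 0 * a 2),
      sq_nonneg (a 0 * l 3 - l 0 * a 3)]
  have h3 : a 0 * l 3 - l 0 * a 3 = 0 := by
    nlinarith [sq_nonneg (a 0 * l 1 - l 0 * a 1), sq_nonneg (a 0 * l 2 - l 0 * a 2),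
      sq_nonneg (a 0 * l 3 - l 0 * a 3)]
  have h0 : ∀ k, a 0 * l k = l 0 * a k := by
    intro k
    fin_cases k
    · exact mul_comm _ _
    · exact sub_eq_zero.1 h1
    · exact sub_eq_zero.1 h2
    · exact sub_eq_zero.1 h3
  by_cases hl0 : l 0 = 0
  · have hz : ∀ k, l k = 0 := by
      intro k
      fin_cases k
      · exact hl0
      all_goals
        simp only [hl0] at hl
        simp
        nlinarith [sq_nonneg (l 1), sq_nonneg (l 2), sq_nonneg (l 3)]
    rw [hz, hz, zero_mul, zero_mul]
  · apply mul_left_cancel₀ hl0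
    linear_combination l n * h0 m - l m * h0 n

section

variable {l : Fin 4 → ℝ} {w : Fin 4 → ℂ}

/-- If w·w̄ were zero along with w·w, then Re w and Im w would be null and orthogonal to l, hence
proportional to l, and F would vanish. -/
lemma IsNullPair.sum_mul_star_ne_zero (h : IsNullPair l w) (hb : biv l w ≠ 0) :
    ∑ k, (sig k : ℂ) * w k * star (w k) ≠ 0 := by
  intro h0
  have h1 := h.orthogonal
  have h2 := h.null_right
  have o1 := congrArg Complex.re h1
  have o2 := congrArg Complex.im h1
  have n1 := congrArg Complex.re h2
  have n2 := congrArg Complex.re h0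
  simp [Fin.sum_univ_four, sig] at o1 o2 n1 n2
  have hr := mul_eq_mul_of_null (a := fun k => (w k).re) h.null_left
    (by simp [Fin.sum_univ_four, sig]; linarith) (by simp [Fin.sum_univ_four, sig]; linarith)
  have hi := mul_eq_mul_of_null (a := fun k => (w k).im) h.null_left
    (by simp [Fin.sum_univ_four, sig]; linarith) (by simp [Fin.sum_univ_four, sig]; linarith)
  apply hb
  funext m n
  have : (l m * w n : ℂ) = l n * w m := by
    apply Complex.ext
    · simpa using hr m n
    · simpa using hi m n
  simp [biv, this]

/-- Take v = Re(α w̄) with raised index. Then l·w̄ = 0 gives l·v = 0, and w·w = 0 leaves w·v = ½ α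
(w·w̄); since w·w̄ ≠ 0, α can be solved for. -/
lemma IsNullPair.exists_vector (h : IsNullPair l w) (hb : biv l w ≠ 0) (p : ℂ) :
    ∃ v : Fin 4 → ℝ, ∑ a, l a * v a = 0 ∧ ∑ m, w m * (v m : ℂ) = p := by
  have hρ := h.sum_mul_star_ne_zero hb
  set ρ := ∑ k, (sig k : ℂ) * w k * star (w k) with hρd
  set α : ℂ := 2 * p / ρ with hα
  have hre : ∀ c : ℂ, (c.re : ℂ) = 1 / 2 * (c + star c) := fun c => by
    rw [Complex.star_def, Complex.add_conj]
    push_cast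
    ring
  refine ⟨fun k => sig k * (α * star (w k)).re, ?_, ?_⟩
  · have h1 := h.star_right.orthogonal
    have h2 : ∑ a, l a * (sig a * (α * star (w a)).re) =
        (α * ∑ a, (sig a : ℂ) * l a * star w a).re := by
      rw [Finset.mul_sum, Complex.re_sum]
      refine Finset.sum_congr rfl fun a _ => ?_
      rw [← Complex.re_ofReal_mul, ← Complex.re_ofReal_mul]
      congr 1
      simp only [Pi.star_apply]
      ring
    rw [h2, h1, mul_zero, Complex.zero_re]
  · have h2 : ∑ m, w m * ((sig m * (α * star (w m)).re : ℝ) : ℂ) = 1 / 2 * α * ρ +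
        1 / 2 * star α * ∑ a, (sig a : ℂ) * w a * w a := by
      rw [hρd, Finset.mul_sum, Finset.mul_sum, ← Finset.sum_add_distrib]
      refine Finset.sum_congr rfl fun a _ => ?_
      rw [Complex.ofReal_mul, hre, star_mul', star_star]
      ring
    rw [h2, h.null_right, hα]
    field_simp
    ring

/-- The loop is a parallelogram with sides n and v. Transport along ±n is trivial, while n reverses
the sign of the phase, so the contributions of v and -v add instead of cancelling. -/
lemma IsNullPair.mem_holonomy (h : IsNullPair l w) (hb : biv l w ≠ 0) (x : Pt) (z : ℂ) :
    transp (biv l w) z ∈ holonomy (waveConnection l w) x := by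
  have hN := h.isNullBivector
  have he : osc (2 • l) x ≠ 0 := Complex.exp_ne_zero _
  obtain ⟨v, hv1, hv2⟩ := h.exists_vector hb (z / osc (2 • l) x)
  have hl2 : ∑ a, l a * l a ≠ 0 := by
    intro h0
    apply hb
    have : ∀ a, l a = 0 := fun a => by
      have := (Finset.sum_eq_zero_iff_of_nonneg fun a _ => mul_self_nonneg (l a)).1 h0 a (by simp)
      simpa using this
    funext m n
    simp [biv, this]
  -- The value π/2 makes e^{-2il·n} = -1. A Euclidean multiple of l achieves it, and a correction u
  -- with l·u = 0 removes the contraction with w.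
  obtain ⟨n, hn1, hn2⟩ : ∃ n : Fin 4 → ℝ, ∑ a, l a * n a = Real.pi / 2 ∧
      ∑ m, w m * (n m : ℂ) = 0 := by
    set n₀ : Fin 4 → ℝ := (Real.pi / 2 / ∑ a, l a * l a) • l with hn₀
    obtain ⟨u, hu1, hu2⟩ := h.exists_vector hb (∑ m, w m * (n₀ m : ℂ))
    refine ⟨n₀ - u, ?_, ?_⟩
    · have : ∑ a, l a * n₀ a = Real.pi / 2 := by
        have : ∑ a, l a * n₀ a = (Real.pi / 2 / ∑ a, l a * l a) * ∑ a, l a * l a := by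
          rw [Finset.mul_sum]
          refine Finset.sum_congr rfl fun a _ => ?_
          simp [hn₀]
          ring
        rw [this, div_mul_cancel₀ _ hl2]
      simp [mul_sub, Finset.sum_sub_distrib, this, hu1]
    · simp [mul_sub, Finset.sum_sub_distrib, hu2]
  have hneg : osc (2 • l) (x + n) = -osc (2 • l) x := by
    rw [osc_two_smul_add, hn1]
    have : -Complex.I * ((2 * (Real.pi / 2) : ℝ) : ℂ) = -(Real.pi * Complex.I) := by
      push_cast
      ring
    rw [this, Complex.exp_neg, Complex.exp_pi_mul_I]
    norm_num
  have hvx : osc (2 • l) (x + v) = osc (2 • l) x := by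
    rw [osc_two_smul_add, hv1]
    simp
  have p1 := hN.parallelTransport_segment x n (Or.inr hn2)
  have p2 := hN.parallelTransport_segment (x + n) v (Or.inl hv1)
  have p3 := hN.parallelTransport_segment (x + n + v) (-n) (Or.inr (by simp [hn2]))
  have p4 := hN.parallelTransport_segment (x + v) (-v) (Or.inl (by simp [hv1]))
  rw [show x + n + v + -n = x + v by abel] at p3
  rw [show x + v + -v = x by abel] at p4
  have p := ((p1.concat p2).concat p3).concat p4
  simp only [Pi.neg_apply, Complex.ofReal_neg, mul_neg, Finset.sum_neg_distrib, hn2, hv2, hneg, hvx,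
    mul_zero, neg_zero, transp_zero, one_mul, mul_one, neg_neg, neg_mul] at p
  rw [← hN.transp_add] at p
  have hz : 1 / 2 * osc (2 • l) x * (z / osc (2 • l) x) +
      1 / 2 * osc (2 • l) x * (z / osc (2 • l) x) = z := by
    field_simp
    ring
  rw [hz] at p
  exact p

lemma IsNullPair.holonomy_eq (h : IsNullPair l w) (hb : biv l w ≠ 0) (x : Pt) :
    holonomy (waveConnection l w) x = Set.range (transp (biv l w)) := by
  ext A
  constructor
  · intro hA
    obtain ⟨z, rfl⟩ := h.isNullBivector.exists_transp hA
    exact ⟨z, rfl⟩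
  · rintro ⟨z, rfl⟩
    exact h.mem_holonomy hb x z

end

/-! ### Conjugation of the holonomy group to the upper triangular group -/

lemma inv_mul_nil_mul {L : Mat4} (hL : IsLorentz L) (F : Fin 4 → Fin 4 → ℂ) (z : ℂ) :
    L⁻¹ * nil F z * L = nil (formInFrame F L) z := by
  ext a b
  have h1 : nil (formInFrame F L) z a b = (z * endoInFrame F L a b).re := by
    rw [nil_apply, hL.endoInFrame, ← Complex.re_ofReal_mul]
    congr 1
    ring
  rw [h1, endoInFrame, Finset.mul_sum, Complex.re_sum, Matrix.mul_assoc, Matrix.mul_apply]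
  refine Finset.sum_congr rfl fun k _ => ?_
  rw [Finset.mul_sum, Complex.re_sum, Matrix.mul_apply, Finset.mul_sum]
  refine Finset.sum_congr rfl fun j _ => ?_
  rw [nil_apply, ← Complex.re_ofReal_mul, mul_comm _ (L j b), ← Complex.re_ofReal_mul,
    ← Complex.re_ofReal_mul]
  congr 1
  ring

lemma inv_mul_transp_mul {L : Mat4} (hL : IsLorentz L) (hLi : L * L⁻¹ = 1)
    (F : Fin 4 → Fin 4 → ℂ) (z : ℂ) :
    transp F z = L * transp (formInFrame F L) z * L⁻¹ := by
  have hLi' : L⁻¹ * L = 1 := mul_eq_one_comm.1 hLi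
  have h2 : nil F z = L * nil (formInFrame F L) z * L⁻¹ := by
    rw [← inv_mul_nil_mul hL]
    calc nil F z = (L * L⁻¹) * nil F z * (L * L⁻¹) := by rw [hLi, one_mul, mul_one]
      _ = _ := by simp only [mul_assoc]
  obtain ⟨N, hN⟩ : ∃ N, nil (formInFrame F L) z = N := ⟨_, rfl⟩
  rw [hN] at h2
  have h3 : L * N * L⁻¹ * (L * N * L⁻¹) = L * (N * N) * L⁻¹ := by
    calc _ = L * N * (L⁻¹ * L) * N * L⁻¹ := by simp only [mul_assoc]
      _ = _ := by rw [hLi', mul_one]; simp only [mul_assoc]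
  rw [transp, transp, h2, h3, hN]
  simp only [mul_add, add_mul, mul_one, hLi, mul_smul_comm, smul_mul_assoc]

lemma transp_canonical (z : ℂ) :
    transp (biv lightCov polCov) z = spinorMap (upperSL (-Complex.I * z)) := by
  rw [spinorMap_upperSL, transp]
  ext m n
  fin_cases m <;> fin_cases n <;>
    simp [Matrix.mul_apply, nil_apply, Fin.sum_univ_four, biv, lightCov, polCov, sig] <;> ring

lemma transp_smul (F : Fin 4 → Fin 4 → ℂ) (κ z : ℂ) : transp (κ • F) z = transp F (κ * z) := by
  rw [transp, transp, nil_smul]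

lemma transp_star (F : Fin 4 → Fin 4 → ℂ) (z : ℂ) : transp (star F) z = transp F (star z) := by
  rw [transp, transp, nil_star]

lemma IsNullPair.isConjB2_holonomy {l : Fin 4 → ℝ} {w : Fin 4 → ℂ} (h : IsNullPair l w)
    (hb : biv l w ≠ 0) (x : Pt) : IsConjB2 (holonomy (waveConnection l w) x) := by
  obtain ⟨S, hS, κ, hκ, hcan⟩ := h.exists_canonical hb
  have hinv : spinorMap S * (spinorMap S)⁻¹ = 1 := by
    rw [← spinorMap_inv, ← spinorMap_mul, mul_inv_cancel, spinorMap_one]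
  have hconj : ∀ A, spinorMap (S * A * S⁻¹) = spinorMap S * spinorMap A * (spinorMap S)⁻¹ :=
    fun A => by rw [spinorMap_mul, spinorMap_mul, spinorMap_inv]
  -- f gives the spinor parameter of the transport z; its right inverse g ensures that every b
  -- occurs. Conjugations appear for the second polarization.
  have key : ∃ f g : ℂ → ℂ, (∀ z, f (g z) = z) ∧ ∀ z,
      transp (biv l w) z = spinorMap (S * upperSL (f z) * S⁻¹) := by
    rcases hcan with hcan | hcan
    · refine ⟨fun z => -Complex.I * (κ * z), fun b => Complex.I * b / κ, fun b => ?_, fun z => ?_⟩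
      · field_simp
        simp
      · rw [hconj, inv_mul_transp_mul hS hinv, hcan, transp_smul, transp_canonical]
    · refine ⟨fun z => -Complex.I * star (κ * -z), fun b => -star (Complex.I * b) / κ, fun b => ?_,
        fun z => ?_⟩
      · change -Complex.I * star (κ * -(-star (Complex.I * b) / κ)) = b
        rw [show κ * -(-star (Complex.I * b) / κ) = star (Complex.I * b) by field_simp, star_star]
        linear_combination -b * Complex.I_mul_I
      · have hF : κ • biv lightCov (star polCov) = (-κ) • star (biv lightCov polCov) := by
          funext m n
          simp [star_biv]
        rw [hconj, inv_mul_transp_mul hS hinv, hcan, hF, transp_smul, transp_star, transp_canonical]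
        congr 6
        ring
  obtain ⟨f, g, hfg, hf⟩ := key
  refine ⟨S, ?_⟩
  rw [h.holonomy_eq hb]
  ext A
  constructor
  · rintro ⟨z, rfl⟩
    exact ⟨upperSL (f z), ⟨f z, rfl⟩, (hf z).symm⟩
  · rintro ⟨B, ⟨b, hB⟩, rfl⟩
    have : B = upperSL b := Subtype.ext hB
    exact ⟨g b, by rw [hf, hfg, this]⟩

/-! ### Continuity of quadratic forms -/

lemma continuous_quadraticForm (q : QuadraticForm ℝ CurvSpace) : Continuous q := by
  have h : ∀ x, q x = (LinearMap.toContinuousBilinearMap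
      (QuadraticMap.associated (R := ℝ) q) x) x := fun x =>
    (QuadraticMap.associated_eq_self_apply ℝ q x).symm
  rw [show (q : CurvSpace → ℝ) = _ from funext h]
  fun_prop

lemma continuous_curvSpace {X : Type*} [TopologicalSpace X] {Q : X → CurvSpace}
    (h : ∀ k j m n, Continuous fun x => (Q x).1 k j m n) : Continuous Q := by
  refine Continuous.subtype_mk (f := fun x => (Q x).1) ?_ (fun x => (Q x).2)
  exact continuous_pi fun k => continuous_pi fun j => continuous_pi fun m => continuous_pi fun n =>
    h k j m n

lemma continuous_polar (q : QuadraticForm ℝ CurvSpace) {X : Type*} [TopologicalSpace X]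
    {Q Q' : X → CurvSpace} (h : Continuous Q) (h' : Continuous Q') :
    Continuous fun x => QuadraticMap.polar q (Q x) (Q' x) := by
  have hq := continuous_quadraticForm q
  exact ((hq.comp (h.add h')).sub (hq.comp h)).sub (hq.comp h')

/-! ### Variation of the connection -/

/-- The first variation of the curvature. -/
def curvatureVariation (Γ B : Connection) (x : Pt) : CurvSpace :=
  ⟨fun k l m n => pd m (fun y => B y k n l) x - pd n (fun y => B y k m l) x
      + ∑ j, (Γ x k m j * B x j n l + B x k m j * Γ x j n l)
      - ∑ j, (Γ x k n j * B x j m l + B x k n j * Γ x j m l), by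
    intro k l m n
    ring⟩

/-- The commutator part of the curvature. -/
def curvatureBracket (B : Connection) (x : Pt) : CurvSpace :=
  ⟨fun k l m n => ∑ j, B x k m j * B x j n l - ∑ j, B x k n j * B x j m l, by
    intro k l m n
    ring⟩

lemma pd_add_smul {f g : Pt → ℝ} (hf : Differentiable ℝ f) (hg : Differentiable ℝ g) (t : ℝ)
    (m : Fin 4) (x : Pt) : pd m (fun y => f y + t * g y) x = pd m f x + t * pd m g x := by
  rw [pd, fderiv_fun_add (hf x) ((hg x).const_mul t), fderiv_const_mul (hg x)]
  rfl

lemma curvature_add_smul {Γ B : Connection}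
    (hΓ : ∀ k m n, Differentiable ℝ fun x => Γ x k m n)
    (hB : ∀ k m n, Differentiable ℝ fun x => B x k m n) (t : ℝ) (x : Pt) :
    curvature (fun y => Γ y + t • B y) x =
      curvature Γ x + t • curvatureVariation Γ B x + t ^ 2 • curvatureBracket B x := by
  apply Subtype.ext
  funext k l m n
  have h1 : ∀ k m n p, pd p (fun y => (Γ y + t • B y) k m n) x =
      pd p (fun y => Γ y k m n) x + t * pd p (fun y => B y k m n) x := fun k m n p =>
    pd_add_smul (hΓ k m n) (hB k m n) t p x
  change pd m (fun y => (Γ y + t • B y) k n l) x - pd n (fun y => (Γ y + t • B y) k m l) x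
      + ∑ j, (Γ x + t • B x) k m j * (Γ x + t • B x) j n l
      - ∑ j, (Γ x + t • B x) k n j * (Γ x + t • B x) j m l =
    (pd m (fun y => Γ y k n l) x - pd n (fun y => Γ y k m l) x
      + ∑ j, Γ x k m j * Γ x j n l - ∑ j, Γ x k n j * Γ x j m l) +
    t * (pd m (fun y => B y k n l) x - pd n (fun y => B y k m l) x
      + ∑ j, (Γ x k m j * B x j n l + B x k m j * Γ x j n l)
      - ∑ j, (Γ x k n j * B x j m l + B x k n j * Γ x j m l)) +
    t ^ 2 * (∑ j, B x k m j * B x j n l - ∑ j, B x k n j * B x j m l)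
  rw [h1, h1]
  simp only [Pi.add_apply, Pi.smul_apply, smul_eq_mul, Fin.sum_univ_four]
  ring

lemma quadAt_eta {q : QuadraticForm ℝ CurvSpace} (hq : IsLorentzInvariant q) (R : CurvSpace) :
    quadAt q eta R = q R := by
  rw [quadAt_eq hq (e := 1) (by simp [IsOrthonormalFrame]), inFrame_one]

lemma lagrangian_minkowski {q : QuadraticForm ℝ CurvSpace} (hq : IsLorentzInvariant q)
    (Γ : Connection) (x : Pt) : lagrangian q minkowski Γ x = q (curvature Γ x) := by
  rw [lagrangian, minkowski, quadAt_eta hq, det_eta]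
  simp

lemma quadraticForm_expand (q : QuadraticForm ℝ CurvSpace) (R D E : CurvSpace) (t : ℝ) :
    q (R + t • D + t ^ 2 • E) = q R + t * QuadraticMap.polar q R D +
      t ^ 2 * (q D + QuadraticMap.polar q R E) + t ^ 3 * QuadraticMap.polar q D E +
      t ^ 4 * q E := by
  have h : ∀ x y, q (x + y) = q x + q y + QuadraticMap.polar q x y := fun x y => by
    simp [QuadraticMap.polar]
  rw [h, h, QuadraticMap.polar_add_left]
  simp only [QuadraticMap.polar_smul_left, QuadraticMap.polar_smul_right, QuadraticMap.map_smul,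
    smul_eq_mul]
  ring

lemma integral_quartic {f₀ f₁ f₂ f₃ f₄ : Pt → ℝ} {μ : MeasureTheory.Measure Pt}
    (h₀ : MeasureTheory.Integrable f₀ μ) (h₁ : MeasureTheory.Integrable f₁ μ)
    (h₂ : MeasureTheory.Integrable f₂ μ) (h₃ : MeasureTheory.Integrable f₃ μ)
    (h₄ : MeasureTheory.Integrable f₄ μ) (t : ℝ) :
    ∫ x, (f₀ x + t * f₁ x + t ^ 2 * f₂ x + t ^ 3 * f₃ x + t ^ 4 * f₄ x) ∂μ =
      (∫ x, f₀ x ∂μ) + t * (∫ x, f₁ x ∂μ) + t ^ 2 * (∫ x, f₂ x ∂μ) + t ^ 3 * (∫ x, f₃ x ∂μ) +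
        t ^ 4 * ∫ x, f₄ x ∂μ := by
  have j₁ : MeasureTheory.Integrable (fun x => f₀ x + t * f₁ x) μ := h₀.add (h₁.const_mul t)
  have j₂ : MeasureTheory.Integrable (fun x => f₀ x + t * f₁ x + t ^ 2 * f₂ x) μ :=
    j₁.add (h₂.const_mul _)
  have j₃ : MeasureTheory.Integrable (fun x => f₀ x + t * f₁ x + t ^ 2 * f₂ x + t ^ 3 * f₃ x) μ :=
    j₂.add (h₃.const_mul _)
  rw [MeasureTheory.integral_add j₃ (h₄.const_mul _),
    MeasureTheory.integral_add j₂ (h₃.const_mul _), MeasureTheory.integral_add j₁ (h₂.const_mul _),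
    MeasureTheory.integral_add h₀ (h₁.const_mul _)]
  simp only [MeasureTheory.integral_const_mul]

/-- If the integrand of the first variation integrates to zero, the connection is stationary. -/
lemma connectionEquation_of_integral_eq_zero {q : QuadraticForm ℝ CurvSpace}
    (hq : IsLorentzInvariant q) {Γ : Connection} (hΓ : ∀ k m n, ContDiff ℝ ∞ fun x => Γ x k m n)
    (h : ∀ (K : Set Pt) (B : Connection), IsCompact K →
      (∀ k m n, ContDiff ℝ ∞ (fun x => B x k m n)) → (∀ x, x ∉ K → B x = 0) →
      ∫ x in K, QuadraticMap.polar q (curvature Γ x) (curvatureVariation Γ B x) = 0) :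
    ConnectionEquation q minkowski Γ := by
  intro K B hK hB hB0
  have hpd : ∀ {Γ : Connection}, (∀ k m n, ContDiff ℝ ∞ fun x => Γ x k m n) → ∀ k m n p,
      Continuous fun x => pd p (fun y => Γ y k m n) x := fun hΓ k m n p =>
    ((hΓ k m n).continuous_fderiv (by simp)).clm_apply continuous_const
  have hR : Continuous (curvature Γ) := continuous_curvSpace fun k l m n =>
    (((hpd hΓ k n l m).sub (hpd hΓ k m l n)).add (continuous_finsetSum _ fun j _ =>
      (hΓ k m j).continuous.mul (hΓ j n l).continuous)).sub (continuous_finsetSum _ fun j _ =>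
      (hΓ k n j).continuous.mul (hΓ j m l).continuous)
  have hD : Continuous (curvatureVariation Γ B) := continuous_curvSpace fun k l m n =>
    (((hpd hB k n l m).sub (hpd hB k m l n)).add (continuous_finsetSum _ fun j _ =>
      ((hΓ k m j).continuous.mul (hB j n l).continuous).add
        ((hB k m j).continuous.mul (hΓ j n l).continuous))).sub (continuous_finsetSum _ fun j _ =>
      ((hΓ k n j).continuous.mul (hB j m l).continuous).add
        ((hB k n j).continuous.mul (hΓ j m l).continuous))
  have hE : Continuous (curvatureBracket B) := continuous_curvSpace fun k l m n =>
    (continuous_finsetSum _ fun j _ => (hB k m j).continuous.mul (hB j n l).continuous).sub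
      (continuous_finsetSum _ fun j _ => (hB k n j).continuous.mul (hB j m l).continuous)
  have hqc := continuous_quadraticForm q
  -- The Lagrangian is a quartic polynomial in t, so the action can be differentiated coefficient by
  -- coefficient, without differentiating under the integral sign.
  have hL : ∀ t : ℝ, lagrangian q minkowski (fun x => Γ x + t • B x) = fun x =>
      q (curvature Γ x) + t * QuadraticMap.polar q (curvature Γ x) (curvatureVariation Γ B x) +
      t ^ 2 * (q (curvatureVariation Γ B x) +
        QuadraticMap.polar q (curvature Γ x) (curvatureBracket B x)) +
      t ^ 3 * QuadraticMap.polar q (curvatureVariation Γ B x) (curvatureBracket B x) +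
      t ^ 4 * q (curvatureBracket B x) := by
    intro t
    funext x
    rw [lagrangian_minkowski hq, curvature_add_smul
      (fun k m n => (hΓ k m n).differentiable (by simp))
      (fun k m n => (hB k m n).differentiable (by simp)), quadraticForm_expand]
  have c0 : Continuous fun x => q (curvature Γ x) := hqc.comp hR
  have c1 := continuous_polar q hR hD
  have c2 : Continuous fun x => q (curvatureVariation Γ B x) +
        QuadraticMap.polar q (curvature Γ x) (curvatureBracket B x) :=
    (hqc.comp hD).add (continuous_polar q hR hE)
  have c3 := continuous_polar q hD hE
  have c4 : Continuous fun x => q (curvatureBracket B x) := hqc.comp hE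
  have hint : ∀ {f : Pt → ℝ}, Continuous f → MeasureTheory.IntegrableOn f K := fun hf =>
    hf.continuousOn.integrableOn_compact hK
  constructor
  · refine Filter.Eventually.of_forall fun t => ?_
    rw [hL]
    exact hint (by fun_prop)
  · have hA : (fun t : ℝ => action q K minkowski (fun x => Γ x + t • B x)) = fun t =>
        (∫ x in K, q (curvature Γ x)) +
        t * (∫ x in K, QuadraticMap.polar q (curvature Γ x) (curvatureVariation Γ B x)) +
        t ^ 2 * (∫ x in K, (q (curvatureVariation Γ B x) +
          QuadraticMap.polar q (curvature Γ x) (curvatureBracket B x))) +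
        t ^ 3 * (∫ x in K, QuadraticMap.polar q (curvatureVariation Γ B x) (curvatureBracket B x)) +
        t ^ 4 * ∫ x in K, q (curvatureBracket B x) := by
      funext t
      rw [action, hL]
      exact integral_quartic (hint c0) (hint c1) (hint c2) (hint c3) (hint c4) t
    rw [hA, h K B hK hB hB0]
    have hd := ((((hasDerivAt_const (0 : ℝ) (∫ x in K, q (curvature Γ x))).add
      ((hasDerivAt_id (0 : ℝ)).mul_const 0)).add
      ((hasDerivAt_pow 2 (0 : ℝ)).mul_const (∫ x in K, (q (curvatureVariation Γ B x) +
          QuadraticMap.polar q (curvature Γ x) (curvatureBracket B x))))).add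
      ((hasDerivAt_pow 3 (0 : ℝ)).mul_const (∫ x in K, QuadraticMap.polar q
        (curvatureVariation Γ B x) (curvatureBracket B x)))).add
      ((hasDerivAt_pow 4 (0 : ℝ)).mul_const (∫ x in K, q (curvatureBracket B x)))
    exact hd.congr_deriv (by norm_num)

/-- The integral of a derivative of a compactly supported function vanishes. -/
lemma integral_pd_eq_zero {f : Pt → ℝ} (hf : ContDiff ℝ 1 f) (hc : HasCompactSupport f)
    (m : Fin 4) : ∫ x, pd m f x = 0 := by
  have hi : MeasureTheory.Integrable (fun x => fderiv ℝ f x (Pi.single m 1)) :=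
    ((hf.continuous_fderiv (by simp)).clm_apply continuous_const).integrable_of_hasCompactSupport
      (hc.fderiv_apply (𝕜 := ℝ) (Pi.single m 1))
  -- Integration by parts against the constant function 1.
  have h := integral_mul_fderiv_eq_neg_fderiv_mul_of_integrable (μ := MeasureTheory.volume)
    (f := fun _ : Pt => (1 : ℝ)) (g := f) (v := Pi.single m 1) (by simp) (by simpa using hi)
    (by simpa using hf.continuous.integrable_of_hasCompactSupport hc) (fun _ _ => by fun_prop)
    (fun x _ => hf.differentiable (by simp) x)
  simpa [pd] using h

/-! ### The connection equation -/

lemma contract_of_eq_sub (l : Fin 4 → ℝ) (w : Fin 4 → ℂ) (Q : CurvSpace) (A : Tensor4)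
    (h : ∀ k j m n, Q.1 k j m n = A k j m n - A k j n m) :
    contract (biv l w) Q = 2 * ∑ m, ∑ n, (sig m * biv l w m n * sig n) *
      ∑ k, ∑ j, biv l w k j * sig j * (A k j m n : ℂ) := by
  have h1 : ∀ k j, ∑ m, ∑ n, biv l w k j * sig j * (sig m * biv l w m n * sig n) * (A k j n m : ℂ) =
      -∑ m, ∑ n, biv l w k j * sig j * (sig m * biv l w m n * sig n) * (A k j m n : ℂ) := by
    intro k j
    rw [Finset.sum_comm, ← Finset.sum_neg_distrib]
    refine Finset.sum_congr rfl fun m _ => ?_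
    rw [← Finset.sum_neg_distrib]
    refine Finset.sum_congr rfl fun n _ => ?_
    rw [biv_antisymm l w n m]
    ring
  have h2 : contract (biv l w) Q = 2 * ∑ k, ∑ j, ∑ m, ∑ n,
      biv l w k j * sig j * (sig m * biv l w m n * sig n) * (A k j m n : ℂ) := by
    rw [contract]
    simp only [h, Complex.ofReal_sub, mul_sub, Finset.sum_sub_distrib]
    simp only [← Finset.sum_sub_distrib, h1]
    simp only [sub_neg_eq_add, ← two_mul, Finset.mul_sum]
  rw [h2, sum_comm_two_two]
  simp only [Finset.mul_sum]
  refine Finset.sum_congr rfl fun m _ => Finset.sum_congr rfl fun n _ =>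
    Finset.sum_congr rfl fun k _ => Finset.sum_congr rfl fun j _ => ?_
  ring

/-- The endomorphisms `Re(z F)` commute with `F`. -/
lemma IsNullBivector.sum_mul_re {l : Fin 4 → ℝ} {w : Fin 4 → ℂ} (h : IsNullBivector l w)
    (z : ℂ) (a b : Fin 4) :
    ∑ k, biv l w k b * sig b * ((sig k * (z * biv l w k a).re : ℝ) : ℂ) =
      ∑ j, biv l w a j * sig j * ((sig b * (z * biv l w b j).re : ℝ) : ℂ) := by
  have hre : ∀ c : ℂ, (c.re : ℂ) = 1 / 2 * (c + star c) := fun c => by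
    rw [Complex.star_def, Complex.add_conj]
    push_cast
    ring
  have h1 : ∑ k, biv l w k b * sig b * ((sig k * (z * biv l w k a).re : ℝ) : ℂ) =
      -(1 / 2 * sig b) * (z * ∑ k, biv l w a k * sig k * biv l w k b +
        star z * ∑ k, star (biv l w a k) * sig k * biv l w k b) := by
    simp only [Finset.mul_sum, ← Finset.sum_add_distrib]
    refine Finset.sum_congr rfl fun k _ => ?_
    rw [Complex.ofReal_mul, hre, biv_antisymm l w k a, star_mul', star_neg]
    ring
  have h2 : ∑ j, biv l w a j * sig j * ((sig b * (z * biv l w b j).re : ℝ) : ℂ) =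
      -(1 / 2 * sig b) * (z * ∑ k, biv l w a k * sig k * biv l w k b +
        star z * ∑ k, biv l w a k * sig k * star (biv l w k b)) := by
    simp only [Finset.mul_sum, ← Finset.sum_add_distrib]
    refine Finset.sum_congr rfl fun k _ => ?_
    rw [Complex.ofReal_mul, hre, biv_antisymm l w b k, star_mul', star_neg]
    ring
  rw [h1, h2, h.comm]

/-- This is tr(F[A,M]) = tr([F,A]M) = 0 for A = Re(zF), which commutes with F. -/
lemma IsNullBivector.contract_commutator {l : Fin 4 → ℝ} {w : Fin 4 → ℂ} (h : IsNullBivector l w)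
    (z : ℂ) (M : Fin 4 → Fin 4 → ℝ) :
    ∑ k, ∑ j, biv l w k j * sig j * ((∑ p, sig k * (z * biv l w k p).re * M p j -
      ∑ p, M k p * (sig p * (z * biv l w p j).re) : ℝ) : ℂ) = 0 := by
  have h1 : ∑ k, ∑ j, ∑ p, biv l w k j * sig j * ((sig k * (z * biv l w k p).re * M p j : ℝ) : ℂ) =
      ∑ a, ∑ b, (M a b : ℂ) *
        ∑ k, biv l w k b * sig b * ((sig k * (z * biv l w k a).re : ℝ) : ℂ) := by
    simp only [Finset.mul_sum]
    rw [Finset.sum_congr rfl fun k _ => Finset.sum_comm, Finset.sum_comm]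
    refine Finset.sum_congr rfl fun a _ => ?_
    rw [Finset.sum_comm]
    refine Finset.sum_congr rfl fun b _ => Finset.sum_congr rfl fun k _ => ?_
    push_cast
    ring
  have h2 : ∑ k, ∑ j, ∑ p, biv l w k j * sig j * ((M k p * (sig p * (z * biv l w p j).re) : ℝ) : ℂ) =
      ∑ a, ∑ b, (M a b : ℂ) *
        ∑ j, biv l w a j * sig j * ((sig b * (z * biv l w b j).re : ℝ) : ℂ) := by
    simp only [Finset.mul_sum]
    refine Finset.sum_congr rfl fun a _ => ?_
    rw [Finset.sum_comm]
    refine Finset.sum_congr rfl fun b _ => Finset.sum_congr rfl fun j _ => ?_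
    push_cast
    ring
  simp only [Complex.ofReal_sub, Complex.ofReal_sum, mul_sub, Finset.sum_sub_distrib,
    Finset.mul_sum]
  rw [h1, h2, sub_eq_zero]
  refine Finset.sum_congr rfl fun a _ => Finset.sum_congr rfl fun b _ => ?_
  rw [h.sum_mul_re]

lemma IsNullBivector.contract_curvatureVariation {l : Fin 4 → ℝ} {w : Fin 4 → ℂ}
    (h : IsNullBivector l w) (B : Connection) (x : Pt) :
    contract (biv l w) (curvatureVariation (waveConnection l w) B x) =
      2 * ∑ m, ∑ n, (sig m * biv l w m n * sig n) *
        ∑ k, ∑ j, biv l w k j * sig j * ((pd m (fun y => B y k n j) x : ℝ) : ℂ) := by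
  rw [contract_of_eq_sub l w _ fun k j m n => pd m (fun y => B y k n j) x +
    (∑ p, waveConnection l w x k m p * B x p n j - ∑ p, B x k n p * waveConnection l w x p m j)]
  · congr 1
    refine Finset.sum_congr rfl fun m _ => Finset.sum_congr rfl fun n _ => ?_
    congr 1
    have hc := h.contract_commutator (1 / 2 * (w m * osc (2 • l) x)) fun p j => B x p n j
    have hw : ∀ k p, waveConnection l w x k m p =
        sig k * (1 / 2 * (w m * osc (2 • l) x) * biv l w k p).re := fun k p => by
      rw [waveConnection, show (1 / 2 * (w m * osc (2 • l) x) * biv l w k p) =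
        ((1 / 2 : ℝ) : ℂ) * (w m * biv l w k p * osc (2 • l) x) by push_cast; ring,
        Complex.re_ofReal_mul]
    simp only [hw]
    simp only [Complex.ofReal_add, mul_add, Finset.sum_add_distrib]
    rw [hc, add_zero]
  · intro k j m n
    simp only [curvatureVariation, Finset.sum_add_distrib]
    ring

lemma pd_sum {ι : Type*} (s : Finset ι) {f : ι → Pt → ℝ} (hf : ∀ i, Differentiable ℝ (f i))
    (m : Fin 4) (x : Pt) : pd m (fun y => ∑ i ∈ s, f i y) x = ∑ i ∈ s, pd m (f i) x := by
  simp only [pd]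
  rw [fderiv_fun_sum fun i _ => hf i x]
  simp

lemma pd_mul {f g : Pt → ℝ} (hf : Differentiable ℝ f) (hg : Differentiable ℝ g)
    (m : Fin 4) (x : Pt) : pd m (fun y => f y * g y) x = f x * pd m g x + g x * pd m f x := by
  simp only [pd]
  rw [fderiv_fun_mul (hf x) (hg x)]
  simp

/-- The field whose divergence is the first variation of the action. -/
def variationFlux (l : Fin 4 → ℝ) (w : Fin 4 → ℂ) (c : ℂ) (B : Connection) (m : Fin 4)
    (x : Pt) : ℝ :=
  ∑ n, ∑ k, ∑ j, (2 * c * (sig m * biv l w m n * sig n) * (biv l w k j * sig j) *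
    osc (2 • l) x).re * B x k n j

lemma contDiff_variationFlux (l : Fin 4 → ℝ) (w : Fin 4 → ℂ) (c : ℂ) {B : Connection}
    (hB : ∀ k m n, ContDiff ℝ ∞ fun x => B x k m n) (m : Fin 4) :
    ContDiff ℝ ∞ (variationFlux l w c B m) :=
  ContDiff.sum fun n _ => ContDiff.sum fun k _ => ContDiff.sum fun j _ =>
    (contDiff_re_const_mul_osc _ _).mul (hB k n j)

/-- When the divergence falls on B it gives the dB term, which is all that the contraction retains.
When it falls on the phase it produces l^m F_{mn} = 0. -/
lemma IsNullBivector.sum_pd_variationFlux {l : Fin 4 → ℝ} {w : Fin 4 → ℂ}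
    (h : IsNullBivector l w) (c : ℂ) {B : Connection}
    (hB : ∀ k m n, ContDiff ℝ ∞ fun x => B x k m n) (x : Pt) :
    ∑ m, pd m (variationFlux l w c B m) x = (osc (2 • l) x *
      (c * contract (biv l w) (curvatureVariation (waveConnection l w) B x))).re := by
  have ho : ∀ z : ℂ, Differentiable ℝ fun y => (z * osc (2 • l) y).re := fun z =>
    (contDiff_re_const_mul_osc _ _).differentiable (by simp)
  have hB' : ∀ k m n, Differentiable ℝ fun x => B x k m n := fun k m n =>
    (hB k m n).differentiable (by simp)
  have h1 : ∀ m, pd m (variationFlux l w c B m) x = ∑ n, ∑ k, ∑ j,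
      ((2 * c * (sig m * biv l w m n * sig n) * (biv l w k j * sig j) * osc (2 • l) x).re *
        pd m (fun y => B y k n j) x + B x k n j * (-Complex.I * ((2 • l) m : ℝ) *
        (2 * c * (sig m * biv l w m n * sig n) * (biv l w k j * sig j) * osc (2 • l) x)).re) := by
    intro m
    unfold variationFlux
    rw [pd_sum _ (by fun_prop)]
    refine Finset.sum_congr rfl fun n _ => ?_
    rw [pd_sum _ (by fun_prop)]
    refine Finset.sum_congr rfl fun k _ => ?_
    rw [pd_sum _ (by fun_prop)]
    refine Finset.sum_congr rfl fun j _ => ?_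
    rw [pd_mul (ho _) (hB' k n j), pd_re_const_mul_osc]
  have h2 : ∑ m, ∑ n, ∑ k, ∑ j, B x k n j * (-Complex.I * ((2 • l) m : ℝ) *
      (2 * c * (sig m * biv l w m n * sig n) * (biv l w k j * sig j) * osc (2 • l) x)).re = 0 := by
    rw [Finset.sum_comm]
    refine Finset.sum_eq_zero fun n _ => ?_
    rw [Finset.sum_comm]
    refine Finset.sum_eq_zero fun k _ => ?_
    rw [Finset.sum_comm]
    refine Finset.sum_eq_zero fun j _ => ?_
    rw [← Finset.mul_sum, ← Complex.re_sum]
    have h3 : ∑ m, (-Complex.I * ((2 • l) m : ℝ) *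
      (2 * c * (sig m * biv l w m n * sig n) * (biv l w k j * sig j) * osc (2 • l) x)) =
      (-4 * Complex.I * c * sig n * (biv l w k j * sig j) * osc (2 • l) x) *
        ∑ m, (sig m : ℂ) * l m * biv l w m n := by
      rw [Finset.mul_sum]
      refine Finset.sum_congr rfl fun m _ => ?_
      simp only [Pi.smul_apply, nsmul_eq_mul]
      push_cast
      ring
    rw [h3, h.contract_left]
    simp
  simp only [h1, Finset.sum_add_distrib]
  rw [h2, add_zero, h.contract_curvatureVariation]
  simp only [Finset.mul_sum, Complex.re_sum]
  refine Finset.sum_congr rfl fun m _ => Finset.sum_congr rfl fun n _ =>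
    Finset.sum_congr rfl fun k _ => Finset.sum_congr rfl fun j _ => ?_
  rw [← Complex.re_mul_ofReal]
  congr 1
  ring

/-- The first variation is the divergence of a compactly supported flux, so its integral is zero. -/
lemma connectionEquation_waveConnection {l : Fin 4 → ℝ} {w : Fin 4 → ℂ}
    (h : IsNullBivector l w) {q : QuadraticForm ℝ CurvSpace} (hq : IsLorentzInvariant q) {c : ℂ}
    (hc : ∀ z Q, QuadraticMap.polar q (rad l w z) Q = (z * (c * contract (biv l w) Q)).re) :
    ConnectionEquation q minkowski (waveConnection l w) := by
  refine connectionEquation_of_integral_eq_zero hq (contDiff_waveConnection l w) ?_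
  intro K B hK hB hB0
  have hp : ∀ x, QuadraticMap.polar q (curvature (waveConnection l w) x)
      (curvatureVariation (waveConnection l w) B x) =
      ∑ m, pd m (variationFlux l w c B m) x := fun x => by
    rw [curvature_waveConnection h, hc, h.sum_pd_variationFlux c hB]
  have hsupp : ∀ m, Function.support (variationFlux l w c B m) ⊆ K := by
    intro m x hx
    by_contra hxK
    exact hx (by simp [variationFlux, hB0 x hxK])
  have hcomp : ∀ m, HasCompactSupport (variationFlux l w c B m) := fun m =>
    HasCompactSupport.of_support_subset_isCompact hK (hsupp m)
  have hzero : ∀ m x, x ∉ K → pd m (variationFlux l w c B m) x = 0 := by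
    intro m x hx
    have h1 : x ∉ tsupport (variationFlux l w c B m) := fun h2 =>
      hx (closure_minimal (hsupp m) hK.isClosed h2)
    rw [pd, fderiv_of_notMem_tsupport _ h1]
    rfl
  simp only [hp]
  rw [MeasureTheory.setIntegral_eq_integral_of_forall_compl_eq_zero fun x hx =>
    Finset.sum_eq_zero fun m _ => hzero m x hx, MeasureTheory.integral_finsetSum]
  · exact Finset.sum_eq_zero fun m _ => integral_pd_eq_zero
      ((contDiff_variationFlux l w c hB m).of_le (by simp)) (hcomp m) m
  · intro m _
    exact (((contDiff_variationFlux l w c hB m).continuous_fderiv (by simp)).clm_apply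
      continuous_const).integrable_of_hasCompactSupport
      ((hcomp m).fderiv_apply (𝕜 := ℝ) (Pi.single m 1))

/-! ### Orthonormal frames of nearby metrics -/

section

open scoped Matrix.Norms.Operator

/-- The squaring map of a Banach algebra is locally invertible at `1`, smoothly. -/
lemma exists_sqrt {A : Type*} [NormedRing A] [NormedAlgebra ℝ A] [CompleteSpace A] :
    ∃ s : A → A, ContDiffAt ℝ 1 s 1 ∧ s 1 = 1 ∧ (∀ᶠ y in 𝓝 (1 : A), s y * s y = y) ∧
      ∀ᶠ x in 𝓝 (1 : A), s (x * x) = x := by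
  let f' : A ≃L[ℝ] A := ContinuousLinearEquiv.smulLeft (Units.mk0 (2 : ℝ) two_ne_zero)
  have hf : ContDiffAt ℝ 1 (fun x : A => x * x) 1 := contDiffAt_id.mul contDiffAt_id
  have hf' : HasFDerivAt (fun x : A => x * x) (f' : A →L[ℝ] A) 1 := by
    have h := (hasFDerivAt_id (𝕜 := ℝ) (1 : A)).mul' (hasFDerivAt_id (𝕜 := ℝ) (1 : A))
    refine h.congr_fderiv ?_
    ext x
    simp [f', two_smul]
  have h1 : (1 : A) * 1 = 1 := mul_one 1
  have hs := hf.hasStrictFDerivAt' hf' one_ne_zero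
  refine ⟨hs.localInverse, ?_, ?_, ?_, ?_⟩
  · have := hf.to_localInverse hf' one_ne_zero
    rw [h1] at this
    exact this
  · have := hs.localInverse_apply_image
    simpa only [h1] using this
  · have := hs.eventually_right_inverse
    simpa only [h1] using this
  · exact hs.eventually_left_inverse

/-- Metrics close to the Minkowski metric have orthonormal frames depending smoothly on them. -/
lemma exists_frame : ∃ e : Mat4 → Mat4, ContDiffAt ℝ 1 e eta ∧
    ContDiffAt ℝ 1 (fun g => (e g)⁻¹) eta ∧ e eta = 1 ∧
    ∀ᶠ g in 𝓝 eta, g.IsSymm → IsOrthonormalFrame g (e g) := by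
  obtain ⟨s, hs, hs1, hr, hl⟩ := exists_sqrt (A := Mat4)
  have he : ContDiffAt ℝ 1 (fun g : Mat4 => eta * g) eta := contDiffAt_const.mul contDiffAt_id
  have hA : ContDiffAt ℝ 1 (fun g : Mat4 => s (eta * g)) eta := by
    refine ContDiffAt.comp eta (g := s) ?_ he
    rwa [eta_mul_eta]
  have hA1 : s (eta * eta) = 1 := by rw [eta_mul_eta, hs1]
  have hinv : ContDiffAt ℝ 1 (fun g : Mat4 => (s (eta * g))⁻¹) eta := by
    simp only [Matrix.nonsing_inv_eq_ringInverse]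
    refine ContDiffAt.comp eta (g := Ring.inverse) ?_ hA
    rw [hA1]
    exact contDiffAt_ringInverse ℝ (1 : Mat4ˣ)
  have hte : Filter.Tendsto (fun g : Mat4 => eta * g) (𝓝 eta) (𝓝 1) := by
    have := he.continuousAt.tendsto
    rw [eta_mul_eta] at this
    exact this
  have htA : Filter.Tendsto (fun g : Mat4 => s (eta * g)) (𝓝 eta) (𝓝 1) := by
    have := hA.continuousAt.tendsto
    rw [hA1] at this
    exact this
  have htT : Filter.Tendsto (fun g : Mat4 => eta * (s (eta * g))ᵀ * eta) (𝓝 eta) (𝓝 1) := by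
    have hc : Continuous fun M : Mat4 => eta * Mᵀ * eta := by fun_prop
    have := (hc.tendsto 1).comp htA
    simpa [Function.comp_def, eta_mul_eta] using this
  have hdet : ∀ᶠ g in 𝓝 eta, (s (eta * g)).det ≠ 0 := by
    have hc : Continuous fun M : Mat4 => M.det := by fun_prop
    have := (hc.tendsto 1).comp htA
    exact this.eventually_ne (by simp)
  refine ⟨fun g => (s (eta * g))⁻¹, hinv, ?_, by simp [hA1], ?_⟩
  · refine hA.congr_of_eventuallyEq ?_
    filter_upwards [hdet] with g hg
    exact Matrix.nonsing_inv_nonsing_inv _ (isUnit_iff_ne_zero.2 hg)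
  · filter_upwards [hdet, hte.eventually hr, htA.eventually hl, htT.eventually hl]
      with g hg hr hl hlT hsymm
    set M := s (eta * g) with hM
    have hu : IsUnit M.det := isUnit_iff_ne_zero.2 hg
    -- The η-adjoint of M is another square root of ηg near 1, so local uniqueness makes M
    -- self-adjoint. Then MᵀηM = ηM² = g, and M⁻¹ is an orthonormal frame.
    have h1 : eta * Mᵀ * eta = M := by
      have h2 : (eta * Mᵀ * eta) * (eta * Mᵀ * eta) = eta * g := by
        calc (eta * Mᵀ * eta) * (eta * Mᵀ * eta) = eta * (M * M)ᵀ * eta := by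
              rw [Matrix.transpose_mul]
              simp only [Matrix.mul_assoc]
              rw [← Matrix.mul_assoc eta eta, eta_mul_eta, Matrix.one_mul]
          _ = eta * g := by
              rw [hr, Matrix.transpose_mul, hsymm.eq, eta_transpose, Matrix.mul_assoc,
                Matrix.mul_assoc, eta_mul_eta, Matrix.mul_one]
      rw [← hlT, h2]
    have h3 : Mᵀ * eta * M = g := by
      have h4 : Mᵀ * eta = eta * M := by
        calc Mᵀ * eta = eta * (eta * Mᵀ * eta) := by
              simp only [← Matrix.mul_assoc, eta_mul_eta, Matrix.one_mul]
          _ = eta * M := by rw [h1]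
      rw [h4, Matrix.mul_assoc, hr, ← Matrix.mul_assoc, eta_mul_eta, Matrix.one_mul]
    have h5 : (M⁻¹)ᵀ * Mᵀ = 1 := by
      rw [← Matrix.transpose_mul, Matrix.mul_nonsing_inv _ hu, Matrix.transpose_one]
    change (M⁻¹)ᵀ * g * M⁻¹ = eta
    calc (M⁻¹)ᵀ * g * M⁻¹ = ((M⁻¹)ᵀ * Mᵀ) * eta * (M * M⁻¹) := by
          rw [← h3]
          simp only [Matrix.mul_assoc]
      _ = eta := by rw [h5, Matrix.mul_nonsing_inv _ hu, Matrix.one_mul, Matrix.mul_one]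

end

/-! ### The energy of the wave in a nearby frame -/

/-- The contraction of `F` with the endomorphism `G` in the frame `e`. -/
def endoPair (F G : Fin 4 → Fin 4 → ℂ) (e : Mat4) : ℂ :=
  ∑ k, ∑ j, F k j * sig j * endoInFrame G e k j

/-- The contraction of `F` with the 2-form `G` in the frame `e`. -/
def formPair (F G : Fin 4 → Fin 4 → ℂ) (e : Mat4) : ℂ :=
  ∑ m, ∑ n, sig m * F m n * sig n * formInFrame G e m n

lemma endoInFrame_one (F : Fin 4 → Fin 4 → ℂ) (a b : Fin 4) :
    endoInFrame F 1 a b = sig a * F a b := by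
  simp [endoInFrame, Matrix.one_apply, apply_ite (Complex.ofReal)]

lemma formInFrame_one (F : Fin 4 → Fin 4 → ℂ) (a b : Fin 4) : formInFrame F 1 a b = F a b := by
  simp [formInFrame, Matrix.one_apply, apply_ite (Complex.ofReal)]

lemma endoInFrame_star (F : Fin 4 → Fin 4 → ℂ) (e : Mat4) (a b : Fin 4) :
    endoInFrame (star F) e a b = star (endoInFrame F e a b) := by
  simp [endoInFrame]

lemma formInFrame_star (F : Fin 4 → Fin 4 → ℂ) (e : Mat4) (a b : Fin 4) :
    formInFrame (star F) e a b = star (formInFrame F e a b) := by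
  simp [formInFrame]

/-- Writing Re as half the sum with the conjugate separates the endomorphism indices from the form
indices. Each term becomes a product of two scalar functions of the frame, whose vanishing can be
examined separately. -/
lemma contract_inFrame_rad (l : Fin 4 → ℝ) (w : Fin 4 → ℂ) (z : ℂ) (e : Mat4) :
    contract (biv l w) (inFrame e (rad l w z)) =
      1 / 2 * (z * (endoPair (biv l w) (biv l w) e * formPair (biv l w) (biv l w) e) +
        star z * (endoPair (biv l w) (star (biv l w)) e *
          formPair (biv l w) (star (biv l w)) e)) := by
  have hre : ∀ c : ℂ, (c.re : ℂ) = 1 / 2 * (c + star c) := fun c => by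
    rw [Complex.star_def, Complex.add_conj]
    push_cast
    ring
  simp only [endoPair, formPair, sum_two_mul_sum_two]
  simp only [contract, inFrame_rad_apply, hre,
    endoInFrame_star, formInFrame_star, Finset.mul_sum, ← Finset.sum_add_distrib, star_mul']
  refine Finset.sum_congr rfl fun k _ => Finset.sum_congr rfl fun j _ =>
    Finset.sum_congr rfl fun m _ => Finset.sum_congr rfl fun n _ => ?_
  ring

section

variable {l : Fin 4 → ℝ} {w : Fin 4 → ℂ}

/-- In the identity frame this pairing is -tr N², which is zero. -/
lemma IsNullBivector.formPair_one (h : IsNullBivector l w) :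
    formPair (biv l w) (biv l w) 1 = 0 := by
  have h1 : formPair (biv l w) (biv l w) 1 =
      -∑ m, (sig m : ℂ) * ∑ a, biv l w m a * sig a * biv l w a m := by
    simp only [formPair, formInFrame_one, Finset.mul_sum, ← Finset.sum_neg_distrib]
    refine Finset.sum_congr rfl fun k _ => Finset.sum_congr rfl fun j _ => ?_
    rw [biv_antisymm l w j k]
    ring
  simp [h1, h.sq]

lemma IsNullBivector.formPair_star_one (h : IsNullBivector l w) :
    formPair (biv l w) (star (biv l w)) 1 = 0 := by
  rw [← neg_eq_zero, ← h.cross]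
  simp only [formPair, formInFrame_one, ← Finset.sum_neg_distrib, Pi.star_apply]
  refine Finset.sum_congr rfl fun k _ => Finset.sum_congr rfl fun j _ => ?_
  rw [biv_antisymm l w j k, star_neg]
  ring

lemma endoPair_one (F G : Fin 4 → Fin 4 → ℂ) : endoPair F G 1 = formPair F G 1 := by
  simp only [endoPair, formPair, endoInFrame_one, formInFrame_one]
  refine Finset.sum_congr rfl fun k _ => Finset.sum_congr rfl fun j _ => ?_
  ring

end

lemma QuadraticForm.isBigO_sq {E α : Type*} [NormedAddCommGroup E] [NormedSpace ℝ E]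
    [FiniteDimensional ℝ E] (q : QuadraticForm ℝ E) (f : α → E) (L : Filter α) :
    (fun x => q (f x)) =O[L] fun x => ‖f x‖ ^ 2 := by
  set b := LinearMap.toContinuousBilinearMap (QuadraticMap.associated (R := ℝ) q)
  refine Asymptotics.IsBigO.of_bound ‖b‖ (Filter.Eventually.of_forall fun x => ?_)
  have h : q (f x) = b (f x) (f x) := (QuadraticMap.associated_eq_self_apply ℝ q (f x)).symm
  rw [h, norm_pow, norm_norm, sq, ← mul_assoc]
  exact b.le_opNorm₂ _ _

section

open scoped Matrix.Norms.Operator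

lemma isBigO_sub_of_eq_zero {E : Type*} [NormedAddCommGroup E] [NormedSpace ℝ E] {f : Mat4 → E}
    (hf : ContDiffAt ℝ 1 f eta) (h0 : f eta = 0) : f =O[𝓝 eta] fun g => g - eta := by
  have := (hf.differentiableAt one_ne_zero).isBigO_sub
  simp only [h0, sub_zero] at this
  exact this

lemma contDiffAt_matrix_apply {f : Mat4 → Mat4} {x : Mat4} (hf : ContDiffAt ℝ 1 f x)
    (i j : Fin 4) : ContDiffAt ℝ 1 (fun g => ((f g i j : ℝ) : ℂ)) x :=
  Complex.ofRealCLM.contDiff.contDiffAt.comp x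
    ((LinearMap.toContinuousLinearMap (Matrix.entryLinearMap ℝ ℝ i j)).contDiff.contDiffAt.comp
      x hf)

variable {e : Mat4 → Mat4} {x : Mat4}

lemma contDiffAt_endoInFrame (he : ContDiffAt ℝ 1 e x) (hi : ContDiffAt ℝ 1 (fun g => (e g)⁻¹) x)
    (F : Fin 4 → Fin 4 → ℂ) (a b : Fin 4) :
    ContDiffAt ℝ 1 (fun g => endoInFrame F (e g) a b) x :=
  ContDiffAt.sum fun k _ => ContDiffAt.sum fun j _ =>
    ((contDiffAt_matrix_apply hi a k).mul (contDiffAt_matrix_apply he j b)).mul contDiffAt_const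

lemma contDiffAt_formInFrame (he : ContDiffAt ℝ 1 e x) (F : Fin 4 → Fin 4 → ℂ) (a b : Fin 4) :
    ContDiffAt ℝ 1 (fun g => formInFrame F (e g) a b) x :=
  ContDiffAt.sum fun m _ => ContDiffAt.sum fun n _ =>
    ((contDiffAt_matrix_apply he m a).mul (contDiffAt_matrix_apply he n b)).mul contDiffAt_const

lemma contDiffAt_endoPair (he : ContDiffAt ℝ 1 e x) (hi : ContDiffAt ℝ 1 (fun g => (e g)⁻¹) x)
    (F G : Fin 4 → Fin 4 → ℂ) : ContDiffAt ℝ 1 (fun g => endoPair F G (e g)) x :=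
  ContDiffAt.sum fun k _ => ContDiffAt.sum fun j _ =>
    contDiffAt_const.mul (contDiffAt_endoInFrame he hi G k j)

lemma contDiffAt_formPair (he : ContDiffAt ℝ 1 e x) (F G : Fin 4 → Fin 4 → ℂ) :
    ContDiffAt ℝ 1 (fun g => formPair F G (e g)) x :=
  ContDiffAt.sum fun m _ => ContDiffAt.sum fun n _ =>
    contDiffAt_const.mul (contDiffAt_formInFrame he G m n)

lemma contDiffAt_inFrame_rad (he : ContDiffAt ℝ 1 e x)
    (hi : ContDiffAt ℝ 1 (fun g => (e g)⁻¹) x) (l : Fin 4 → ℝ) (w : Fin 4 → ℂ) (z : ℂ)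
    (a b c d : Fin 4) : ContDiffAt ℝ 1 (fun g => (inFrame (e g) (rad l w z)).1 a b c d) x := by
  simp only [inFrame_rad_apply]
  exact Complex.reCLM.contDiff.contDiffAt.comp x
    ((contDiffAt_const.mul (contDiffAt_endoInFrame he hi _ a b)).mul
      (contDiffAt_formInFrame he _ c d))

lemma isBigO_inFrame_rad_sub (he : ContDiffAt ℝ 1 e eta)
    (hi : ContDiffAt ℝ 1 (fun g => (e g)⁻¹) eta) (h1 : e eta = 1) (l : Fin 4 → ℝ)
    (w : Fin 4 → ℂ) (z : ℂ) :
    (fun g => inFrame (e g) (rad l w z) - rad l w z) =O[𝓝 eta] fun g => g - eta := by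
  have h : (fun g => (inFrame (e g) (rad l w z) - rad l w z).1) =O[𝓝 eta] fun g => g - eta := by
    refine Asymptotics.isBigO_pi.2 fun a => Asymptotics.isBigO_pi.2 fun b =>
      Asymptotics.isBigO_pi.2 fun c => Asymptotics.isBigO_pi.2 fun d => ?_
    refine isBigO_sub_of_eq_zero
      ((contDiffAt_inFrame_rad he hi l w z a b c d).sub (contDiffAt_const (c :=
        (rad l w z).1 a b c d))) ?_
    change (inFrame (e eta) (rad l w z)).1 a b c d - (rad l w z).1 a b c d = 0
    rw [h1, inFrame_one, sub_self]
  have h' : (fun g => ‖inFrame (e g) (rad l w z) - rad l w z‖) =O[𝓝 eta] fun g => g - eta :=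
    h.norm_left
  exact h'.of_norm_left

/-- Both scalar factors in each product are C¹ and vanish at η, so each is O(‖g-η‖). -/
lemma IsNullBivector.isBigO_contract {l : Fin 4 → ℝ} {w : Fin 4 → ℂ} (h : IsNullBivector l w)
    (he : ContDiffAt ℝ 1 e eta) (hi : ContDiffAt ℝ 1 (fun g => (e g)⁻¹) eta) (h1 : e eta = 1)
    (z : ℂ) : (fun g => contract (biv l w) (inFrame (e g) (rad l w z))) =O[𝓝 eta]
      fun g => ‖g - eta‖ ^ 2 := by
  have hprod : ∀ G : Fin 4 → Fin 4 → ℂ, formPair (biv l w) G 1 = 0 →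
      (fun g => endoPair (biv l w) G (e g) * formPair (biv l w) G (e g)) =O[𝓝 eta]
        fun g => ‖g - eta‖ ^ 2 := by
    intro G hG
    refine Asymptotics.IsBigO.congr_right ?_ fun g => (pow_two ‖g - eta‖).symm
    exact (isBigO_sub_of_eq_zero (contDiffAt_endoPair he hi _ G)
      (by rw [h1, endoPair_one, hG])).norm_right.mul
      (isBigO_sub_of_eq_zero (contDiffAt_formPair he _ G) (by rw [h1, hG])).norm_right
  simp only [contract_inFrame_rad]
  exact (((hprod _ h.formPair_one).const_mul_left z).add
    ((hprod _ h.formPair_star_one).const_mul_left (star z))).const_mul_left _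

/-- The energy of the wave vanishes to second order at the Minkowski metric. -/
lemma IsNullBivector.isBigO_quadraticForm_inFrame {l : Fin 4 → ℝ} {w : Fin 4 → ℂ}
    (h : IsNullBivector l w) (he : ContDiffAt ℝ 1 e eta)
    (hi : ContDiffAt ℝ 1 (fun g => (e g)⁻¹) eta) (h1 : e eta = 1)
    {q : QuadraticForm ℝ CurvSpace} {c : ℂ}
    (hc : ∀ z Q, QuadraticMap.polar q (rad l w z) Q = (z * (c * contract (biv l w) Q)).re) (z : ℂ) :
    (fun g => q (inFrame (e g) (rad l w z))) =O[𝓝 eta] fun g => ‖g - eta‖ ^ 2 := by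
  have hpol : (fun g => QuadraticMap.polar q (rad l w z) (inFrame (e g) (rad l w z))) =O[𝓝 eta]
      fun g => ‖g - eta‖ ^ 2 := by
    simp only [hc]
    refine Asymptotics.IsBigO.trans (Asymptotics.IsBigO.of_bound' (Filter.Eventually.of_forall
      fun g => ?_)) (((h.isBigO_contract he hi h1 z).const_mul_left c).const_mul_left z)
    exact Complex.abs_re_le_norm _
  have hself : ∀ R : CurvSpace, QuadraticMap.polar q R R = 2 * q R := fun R => by
    rw [QuadraticMap.polar_self, two_smul, two_mul]
  have h0 : q (rad l w z) = 0 := by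
    have h2 : QuadraticMap.polar q (rad l w z) (rad l w z) = 0 := by
      have h3 := contract_inFrame_rad l w z 1
      rw [inFrame_one, h.formPair_one, h.formPair_star_one] at h3
      rw [hc, h3]
      simp
    rw [hself] at h2
    linarith
  -- This expands q around R, using q(R) = 0. The polar term is second order by the contraction
  -- estimate, and the last term is quadratic in a first-order difference.
  have hexp : ∀ g, q (inFrame (e g) (rad l w z)) =
      QuadraticMap.polar q (rad l w z) (inFrame (e g) (rad l w z)) +
        q (inFrame (e g) (rad l w z) - rad l w z) := by
    intro g
    set R := rad l w z
    set Q := inFrame (e g) R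
    have h4 : q Q = q (R + (Q - R)) := by rw [add_sub_cancel]
    have h5 : QuadraticMap.polar q R (Q - R) = QuadraticMap.polar q R Q := by
      rw [QuadraticMap.polar_sub_right, hself, h0, mul_zero, sub_zero]
    have h6 : q (R + (Q - R)) = q R + q (Q - R) + QuadraticMap.polar q R (Q - R) := by
      simp only [QuadraticMap.polar]
      ring
    rw [h4, h6, h5, h0]
    ring
  simp only [hexp]
  exact hpol.add ((QuadraticForm.isBigO_sq q _ _).trans
    ((isBigO_inFrame_rad_sub he hi h1 l w z).norm_norm.pow 2))

end

/-! ### The metric equation -/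

/-- In z this is a real binary quadratic form, determined by its values at 1, i and 1+i.
Second-order estimates at these three values thereby become uniform over all phases of the wave. -/
lemma quadraticForm_inFrame_rad (q : QuadraticForm ℝ CurvSpace) (l : Fin 4 → ℝ) (w : Fin 4 → ℂ)
    (e : Mat4) (z : ℂ) : q (inFrame e (rad l w z)) =
      z.re ^ 2 * q (inFrame e (rad l w 1)) + z.im ^ 2 * q (inFrame e (rad l w Complex.I)) +
        z.re * z.im * (q (inFrame e (rad l w (1 + Complex.I))) - q (inFrame e (rad l w 1)) -
          q (inFrame e (rad l w Complex.I))) := by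
  have h : rad l w z = z.re • rad l w 1 + z.im • rad l w Complex.I := by
    rw [← rad_real_mul, ← rad_real_mul, ← rad_add, mul_one, Complex.re_add_im]
  have h2 : ∀ x y, q (x + y) = q x + q y + QuadraticMap.polar q x y := fun x y => by
    simp [QuadraticMap.polar]
  rw [h, rad_add, inFrame_add, inFrame_add, inFrame_smul, inFrame_smul, h2, h2]
  simp only [QuadraticMap.polar_smul_left, QuadraticMap.polar_smul_right, QuadraticMap.map_smul,
    smul_eq_mul]
  ring

lemma abs_quadraticForm_inFrame_rad_le (q : QuadraticForm ℝ CurvSpace) (l : Fin 4 → ℝ)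
    (w : Fin 4 → ℂ) (e : Mat4) {z : ℂ} (hz : ‖z‖ = 1) : |q (inFrame e (rad l w z))| ≤
      2 * |q (inFrame e (rad l w 1))| + 2 * |q (inFrame e (rad l w Complex.I))| +
        |q (inFrame e (rad l w (1 + Complex.I)))| := by
  rw [quadraticForm_inFrame_rad]
  set A := q (inFrame e (rad l w 1))
  set B := q (inFrame e (rad l w Complex.I))
  set C := q (inFrame e (rad l w (1 + Complex.I)))
  have h1 : |z.re| ≤ 1 := hz ▸ Complex.abs_re_le_norm z
  have h2 : |z.im| ≤ 1 := hz ▸ Complex.abs_im_le_norm z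
  have key : ∀ r X : ℝ, |r| ≤ 1 → |r * X| ≤ |X| := fun r X hr => by
    rw [abs_mul]
    exact mul_le_of_le_one_left (abs_nonneg X) hr
  have h3 : |z.re ^ 2| ≤ 1 := by
    rw [abs_pow]
    exact pow_le_one₀ (abs_nonneg _) h1
  have h4 : |z.im ^ 2| ≤ 1 := by
    rw [abs_pow]
    exact pow_le_one₀ (abs_nonneg _) h2
  have h5 : |z.re * z.im| ≤ 1 := (key _ _ h1).trans h2
  calc |z.re ^ 2 * A + z.im ^ 2 * B + z.re * z.im * (C - A - B)|
      ≤ |z.re ^ 2 * A| + |z.im ^ 2 * B| + |z.re * z.im * (C - A - B)| := abs_add_three _ _ _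
    _ ≤ |A| + |B| + |C - A - B| :=
        add_le_add (add_le_add (key _ _ h3) (key _ _ h4)) (key _ _ h5)
    _ ≤ 2 * |A| + 2 * |B| + |C| := by
        have h6 := abs_sub (C - A) B
        have h7 := abs_sub C A
        linarith

section

open scoped Matrix.Norms.Operator

lemma continuousAt_inFrame_rad {e : Mat4 → Mat4} {g : Pt → Mat4} {z : Pt → ℂ} {x : Pt}
    (he : ContDiffAt ℝ 1 e (g x)) (hi : ContDiffAt ℝ 1 (fun g => (e g)⁻¹) (g x))
    (hg : ContinuousAt g x) (hz : ContinuousAt z x) (l : Fin 4 → ℝ) (w : Fin 4 → ℂ) :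
    ContinuousAt (fun y => inFrame (e (g y)) (rad l w (z y))) x := by
  rw [Topology.IsInducing.subtypeVal.continuousAt_iff]
  refine continuousAt_pi.2 fun a => continuousAt_pi.2 fun b => continuousAt_pi.2 fun c =>
    continuousAt_pi.2 fun d => ?_
  simp only [Function.comp_apply, inFrame_rad_apply]
  exact Complex.continuous_re.continuousAt.comp ((hz.mul
    (ContinuousAt.comp (f := g) (contDiffAt_endoInFrame he hi (biv l w) a b).continuousAt hg)).mul
    (ContinuousAt.comp (f := g) (contDiffAt_formInFrame he (biv l w) c d).continuousAt hg))

/-- On the compact set K the varied metric stays within O(t) of η, uniformly in x. The Lagrangian is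
therefore O(t²) uniformly on K, and so is the action. -/
lemma metricEquation_waveConnection {l : Fin 4 → ℝ} {w : Fin 4 → ℂ}
    (h : IsNullBivector l w) {q : QuadraticForm ℝ CurvSpace} (hq : IsLorentzInvariant q) {c : ℂ}
    (hc : ∀ z Q, QuadraticMap.polar q (rad l w z) Q = (z * (c * contract (biv l w) Q)).re) :
    MetricEquation q minkowski (waveConnection l w) := by
  intro K k hK hk hsymm hk0
  obtain ⟨e, he, hi, h1, hfr⟩ := exists_frame
  have hdet : Continuous fun g : Mat4 => √|g.det| := by fun_prop
  obtain ⟨C, hC⟩ : ∃ C : ℝ, ∀ᶠ g in 𝓝 eta,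
      (2 * |q (inFrame (e g) (rad l w 1))| + 2 * |q (inFrame (e g) (rad l w Complex.I))| +
        |q (inFrame (e g) (rad l w (1 + Complex.I)))|) * √|g.det| ≤ C * ‖g - eta‖ ^ 2 := by
    have hO : ∀ z, (fun g => |q (inFrame (e g) (rad l w z))|) =O[𝓝 eta]
        fun g => ‖g - eta‖ ^ 2 := fun z =>
      (h.isBigO_quadraticForm_inFrame he hi h1 hc z).abs_left
    have hO' := ((((hO 1).const_mul_left 2).add ((hO Complex.I).const_mul_left 2)).add
      (hO (1 + Complex.I))).mul ((hdet.tendsto eta).isBigO_one ℝ)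
    obtain ⟨C, hC⟩ := hO'.bound
    refine ⟨C, hC.mono fun g hg => (le_abs_self _).trans ?_⟩
    simpa using hg
  obtain ⟨δ, hδ, hball⟩ := Metric.eventually_nhds_iff_ball.1
    (hfr.and ((he.eventually (by simp)).and ((hi.eventually (by simp)).and hC)))
  have hkc : Continuous k := continuous_pi fun m => continuous_pi fun n => (hk m n).continuous
  obtain ⟨M, hM⟩ := hK.exists_bound_of_continuousOn hkc.continuousOn
  have hM0 : 0 < |M| + 1 := by positivity
  have hnorm : ∀ t : ℝ, ∀ x ∈ K, ‖eta + t • k x - eta‖ ≤ |t| * (|M| + 1) := by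
    intro t x hx
    rw [add_sub_cancel_left, norm_smul, Real.norm_eq_abs]
    gcongr
    linarith [hM x hx, le_abs_self M]
  have hsmall : ∀ᶠ t in 𝓝 (0 : ℝ), ∀ x ∈ K, eta + t • k x ∈ Metric.ball eta δ := by
    have ht : ∀ᶠ t in 𝓝 (0 : ℝ), |t| * (|M| + 1) < δ := by
      have hcont : Continuous fun t : ℝ => |t| * (|M| + 1) := by fun_prop
      exact (hcont.tendsto 0).eventually_lt_const (by simpa using hδ)
    filter_upwards [ht] with t ht x hx
    rw [mem_ball_iff_norm]
    exact (hnorm t x hx).trans_lt ht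
  have hsym : ∀ (t : ℝ) (x : Pt), (eta + t • k x).IsSymm := fun t x => by
    rw [Matrix.IsSymm, Matrix.transpose_add, Matrix.transpose_smul, (hsymm x).eq, eta_transpose]
  have hL : ∀ t : ℝ, (∀ x ∈ K, eta + t • k x ∈ Metric.ball eta δ) → ∀ x ∈ K,
      lagrangian q (fun x => minkowski x + t • k x) (waveConnection l w) x =
        q (inFrame (e (eta + t • k x)) (rad l w (osc (2 • l) x))) * √|(eta + t • k x).det| := by
    intro t ht x hx
    rw [lagrangian, minkowski, quadAt_eq hq ((hball _ (ht x hx)).1 (hsym t x)),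
      curvature_waveConnection h]
  constructor
  · filter_upwards [hsmall] with t ht
    have hgc : Continuous fun x => eta + t • k x := by fun_prop
    refine ContinuousOn.integrableOn_compact hK (ContinuousOn.congr ?_ (hL t ht))
    intro x hx
    obtain ⟨-, hex, hix, -⟩ := hball _ (ht x hx)
    exact (((continuous_quadraticForm q).continuousAt.comp (continuousAt_inFrame_rad hex hix
      hgc.continuousAt (contDiff_osc _).continuous.continuousAt l w)).mul
      (hdet.comp hgc).continuousAt).continuousWithinAt
  -- A quadratic bound at t = 0 contains both the vanishing of the action there and that of its
  -- derivative.
  · have hbig : (fun t : ℝ => action q K (fun x => minkowski x + t • k x) (waveConnection l w))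
        =O[𝓝 0] fun t : ℝ => ‖t - 0‖ ^ 2 := by
      refine Asymptotics.IsBigO.of_bound (|C| * (|M| + 1) ^ 2 * MeasureTheory.volume.real K) ?_
      filter_upwards [hsmall] with t ht
      have hb : ∀ x ∈ K, ‖lagrangian q (fun x => minkowski x + t • k x) (waveConnection l w) x‖ ≤
          |C| * (|t| * (|M| + 1)) ^ 2 := by
        intro x hx
        rw [hL t ht x hx, Real.norm_eq_abs, abs_mul, abs_of_nonneg (Real.sqrt_nonneg _)]
        calc _ ≤ _ := mul_le_mul_of_nonneg_right
              (abs_quadraticForm_inFrame_rad_le q l w _ (norm_osc _ x)) (Real.sqrt_nonneg _)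
          _ ≤ C * ‖eta + t • k x - eta‖ ^ 2 := (hball _ (ht x hx)).2.2.2
          _ ≤ |C| * (|t| * (|M| + 1)) ^ 2 := by
              gcongr
              exacts [le_abs_self C, hnorm t x hx]
      refine (MeasureTheory.norm_setIntegral_le_of_norm_le_const hK.measure_lt_top hb).trans_eq ?_
      rw [sub_zero, norm_pow, norm_norm, Real.norm_eq_abs]
      ring
    simpa using (hbig.hasFDerivAt one_lt_two).hasDerivAt

end

/-! ### The field equations and the main theorem -/

lemma solvesFieldEquations_waveConnection {l : Fin 4 → ℝ} {w : Fin 4 → ℂ}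
    (h : biv l w = 0 ∨ IsNullPair l w) (hb : IsNullBivector l w) {q : QuadraticForm ℝ CurvSpace}
    (hq : IsLorentzInvariant q) : SolvesFieldEquations q minkowski (waveConnection l w) := by
  obtain ⟨c, hc⟩ := exists_polar_rad hq h
  exact ⟨metricEquation_waveConnection hb hq hc, connectionEquation_waveConnection hb hq hc⟩


end TorsionWave

end

theorem mainTheorem5 (l : Fin 4 → ℝ) (w : Fin 4 → ℂ)
    (hu : (∀ x, TorsionWave.hodge TorsionWave.eta
              (TorsionWave.dform (TorsionWave.planeWave l w) x)
            = Complex.I • TorsionWave.dform (TorsionWave.planeWave l w) x) ∨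
          (∀ x, TorsionWave.hodge TorsionWave.eta
              (TorsionWave.dform (TorsionWave.planeWave l w) x)
            = (-Complex.I) • TorsionWave.dform (TorsionWave.planeWave l w) x)) :
    (∃! Γ : TorsionWave.Connection,
      TorsionWave.MetricCompatible TorsionWave.minkowski Γ ∧
      TorsionWave.torsion Γ = TorsionWave.waveTorsion (TorsionWave.planeWave l w)) ∧
    ∀ Γ : TorsionWave.Connection,
      TorsionWave.MetricCompatible TorsionWave.minkowski Γ →
      TorsionWave.torsion Γ = TorsionWave.waveTorsion (TorsionWave.planeWave l w) →
      TorsionWave.IsWeylPseudoinstanton TorsionWave.minkowski Γ ∧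
      (∀ x k j m n,
        TorsionWave.lower TorsionWave.eta (TorsionWave.curvature Γ x).1 k j m n =
          (TorsionWave.dform (TorsionWave.planeWave l w) x k j *
            TorsionWave.dform (TorsionWave.planeWave l w) x m n).re) ∧
      (∀ q : QuadraticForm ℝ TorsionWave.CurvSpace, TorsionWave.IsLorentzInvariant q →
        TorsionWave.SolvesFieldEquations q TorsionWave.minkowski Γ) ∧
      (¬ TorsionWave.IsRiemannian TorsionWave.minkowski Γ ↔
        l ≠ 0 ∧ w ∉ Submodule.span ℂ {fun m => (l m : ℂ)}) ∧
      ((∃ x, TorsionWave.curvature Γ x ≠ 0) ↔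
        l ≠ 0 ∧ w ∉ Submodule.span ℂ {fun m => (l m : ℂ)}) ∧
      (l ≠ 0 → w ∉ Submodule.span ℂ {fun m => (l m : ℂ)} →
        ∀ x, TorsionWave.IsConjB2 (TorsionWave.holonomy Γ x)) := by
  have hb := TorsionWave.biv_eq_zero_or_isNullPair hu
  have hN : TorsionWave.IsNullBivector l w :=
    hb.elim TorsionWave.isNullBivector_of_biv_eq_zero TorsionWave.IsNullPair.isNullBivector
  have hW : ∀ z, TorsionWave.IsWeyl TorsionWave.eta (TorsionWave.rad l w z) := fun z =>
    hu.elim (fun h => TorsionWave.isWeyl_rad hN (TorsionWave.hodge_biv h) z)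
      (fun h => TorsionWave.isWeyl_rad hN (TorsionWave.hodge_biv h) z)
  have hiff : TorsionWave.biv l w ≠ 0 ↔
      l ≠ 0 ∧ w ∉ Submodule.span ℂ {fun m => (l m : ℂ)} :=
    (not_congr (TorsionWave.biv_eq_zero_iff l w)).trans not_not
  have hmetric := TorsionWave.metricCompatible_waveConnection l w
  have htorsion := TorsionWave.torsion_waveConnection l w
  refine ⟨⟨TorsionWave.waveConnection l w, ⟨hmetric, htorsion⟩, fun Γ hΓ =>
    TorsionWave.eq_of_torsion_eq hΓ.1 hmetric (hΓ.2.trans htorsion.symm)⟩, ?_⟩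
  intro Γ hΓ hT
  -- Uniqueness reduces all the remaining claims to the explicit connection.
  obtain rfl := TorsionWave.eq_of_torsion_eq hΓ hmetric (hT.trans htorsion.symm)
  refine ⟨⟨TorsionWave.isSpacetime_waveConnection l w, hmetric, fun x => ?_⟩, ?_, ?_, ?_, ?_, ?_⟩
  · rw [TorsionWave.curvature_waveConnection hN]
    exact hW _
  · intro x k j m n
    rw [TorsionWave.curvature_waveConnection hN, TorsionWave.lower_rad,
      TorsionWave.dform_planeWave, TorsionWave.dform_planeWave, ← TorsionWave.osc_mul_self]
    congr 1
    ring
  · exact fun q hq => TorsionWave.solvesFieldEquations_waveConnection hb hN hq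
  · rw [TorsionWave.IsRiemannian, TorsionWave.christoffel_minkowski,
      TorsionWave.waveConnection_eq_zero_iff, ← hiff]
  · simp only [TorsionWave.curvature_waveConnection hN]
    rw [TorsionWave.exists_rad_osc_ne_zero_iff, hiff]
  · intro hl hw x
    have h0 := hiff.2 ⟨hl, hw⟩
    exact TorsionWave.IsNullPair.isConjB2_holonomy (hb.resolve_left h0) h0 x
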